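/- **Notation.** $\mathcal P_1(\mathbb R^d)$ is the set of Borel probability measures on $\mathbb R^d$ with finite first moment, with the 1-Wasserstein metric $W_1$. $C([0,1];\mathcal P_1(\mathbb R^d))$ is the set of $W_1$-continuous curves with the uniform metric $\sup_t W_1(\mu_t,\eta_t)$, and $AC([0,1];\mathcal P_1(\mathbb R^d))$ is the set of $W_1$-absolutely continuous curves. For a subspace $U\subseteq\mathbb R^d$, $\mathcal M(\mathbb R^d\times[0,1];U)$ is the space of finite $U$-valued Borel measures, with narrow convergence (convergence in duality with bounded continuous functions $f:\mathbb R^d\times[0,1]\to U$). **Assumptions on the data.** (i) $m_0,m_1\in\mathcal P_1(\mathbb R^d)$, and $m_1$ is absolutely continuous with respect to Lebesgue measure, with density $m_1(\cdot)\in L^2(\mathbb R^d)$. (ii) $U\subseteq\mathbb R^d$ is a linear subspace. (iii) $L:\mathbb R^d\times\mathcal P_1(\mathbb R^d)\to[0,+\infty]$ is either (a) finite everywhere and jointly uniformly continuous, or (b) independent of its second variable, with $\{L=+\infty\}$ open and $L$ continuous on $\{L<+\infty\}$. (iv) $\psi:U\to[0,\infty)$ is convex and lower semicontinuous with $\psi(0)=0$,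 and there is a strictly convex $C^1$ function $\phi:[0,\infty)\to[0,\infty)$ with $\phi(0)=\phi'(0)=0$ and $\phi(r)/r\to\infty$ as $r\to\infty$, and there are $K,C>0$, such that $\phi(2r)\le K(1+\phi(r))$ for all $r\ge0$ and $\phi(|u|)-1\le\psi(u)\le C(1+\phi(|u|))$ for all $u\in U$ (for instance $\psi(u)=|u|^p/p$ with $p>1$). (v) $\mathbf F:\mathbb R^d\times\mathcal P_1(\mathbb R^d)\to\mathbb R^d$ is jointly uniformly continuous, and there are $C_F,C_F'\ge0$ with $|\mathbf F(y,\mu)|\le C_F+C_F'\big(|y|+\int|z|\,d\mu(z)\big)$ for all $y,\mu$. **The problems.** Let $\mathcal C(m_0)$ be the set of $(\mu,\boldsymbol\nu)\in AC([0,1];\mathcal P_1(\mathbb R^d))\times\mathcal M(\mathbb R^d\times[0,1];U)$ with $\mu_0=m_0$ and $\partial_t\mu_t+\nabla\cdot(\mathbf F(\cdot,\mu_t)\mu_t+\boldsymbol\nu_t)=0$ in the sense of distributions on $\mathbb R^d\times(0,1)$, that is, for all $\varphi\in C_c^\infty(\mathbb R^d\times(0,1))$, $$\int_0^1\!\!\int_{\mathbb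 R^d}\big(\partial_t\varphi(y,t)+\nabla\varphi(y,t)\cdot\mathbf F(y,\mu_t)\big)\,d\mu_t(y)\,dt+\int_{\mathbb R^d\times[0,1]}\nabla\varphi\cdot d\boldsymbol\nu=0 .$$ Put $\Psi(\boldsymbol\nu|\mu)=\int_0^1\int\psi(\mathbf u(y,t))\,d\mu_t(y)\,dt$ if $d\boldsymbol\nu(y,t)=\mathbf u(y,t)\,d\mu_t(y)\,dt$ for some $U$-valued $\mathbf u$, and $\Psi(\boldsymbol\nu|\mu)=+\infty$ otherwise, and $$\mathcal G(\mu,\boldsymbol\nu)=\Psi(\boldsymbol\nu|\mu)+\int_0^1\!\!\int_{\mathbb R^d}L(y,\mu_t)\,d\mu_t(y)\,dt .$$ Problem (MFC) is to minimize $\mathcal E(\mu,\boldsymbol\nu)=\mathcal G(\mu,\boldsymbol\nu)+\mathcal F(\mu_1)$ over $\mathcal C(m_0)$, where $\mathcal F(\mu)=0$ if $\mu=m_1$ and $\mathcal F(\mu)=+\infty$ otherwise; it is *feasible* if $\mathcal E<+\infty$ somewhere on $\mathcal C(m_0)$. For $\varepsilon>0$, problem (MFC$_\varepsilon$) is to minimize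 $\mathcal E_\varepsilon(\mu,\boldsymbol\nu)=\mathcal G(\mu,\boldsymbol\nu)+\mathcal F_\varepsilon(\mu_1)$ over $\mathcal C(m_0)$, where $\mathcal F_\varepsilon(\mu)=\frac1\varepsilon\int|\mu(y)-m_1(y)|^2\,dy$ if $\mu$ has a Lebesgue density $\mu(\cdot)\in L^2(\mathbb R^d)$, and $\mathcal F_\varepsilon(\mu)=+\infty$ otherwise. **Proposition (convergence as $\varepsilon\to0$).** Suppose the assumptions above hold and (MFC) is feasible. Let $\varepsilon_n>0$ with $\varepsilon_n\to0$, and for each $n$ let $(\mu_n,\boldsymbol\nu_n)$ be a solution (minimizer) of (MFC$_{\varepsilon_n}$). Then there exists $(\mu,\boldsymbol\nu)\in\mathcal C(m_0)$ such that, up to a subsequence, $$(\mu_n,\boldsymbol\nu_n)\to(\mu,\boldsymbol\nu)\quad\text{in } C([0,1];\mathcal P_1(\mathbb R^d))\times\mathcal M(\mathbb R^d\times[0,1];U),$$ and $(\mu,\boldsymbol\nu)$ is a solution (minimizer) of (MFC); in particular $\mu_1=m_1$. -/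

import Mathlib

open MeasureTheory Set Filter Topology
open scoped ENNReal NNReal ContDiff unitInterval

noncomputable section

namespace MeanFieldControl

/-- The Euclidean space `ℝ^d`. -/
abbrev E (d : ℕ) : Type := EuclideanSpace ℝ (Fin d)

/-- `P₁(ℝ^d)`: Borel probability measures on `ℝ^d` with finite first moment. -/
@[ext]
structure P1 (d : ℕ) where
  toMeasure : Measure (E d)
  isProbabilityMeasure : IsProbabilityMeasure toMeasure
  moment_lt_top : ∫⁻ x, ‖x‖ₑ ∂toMeasure < ⊤

attribute [instance] P1.isProbabilityMeasure

/-- The 1-Wasserstein distance: the infimum of the transport cost `∫ |x - y| dπ(x, y)` over all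
couplings `π` of `μ` and `ν`. On `P₁(ℝ^d)` it takes finite values. -/
def W1 {d : ℕ} (μ ν : P1 d) : ℝ≥0∞ :=
  ⨅ (π : Measure (E d × E d)) (_ : π.map Prod.fst = μ.toMeasure ∧ π.map Prod.snd = ν.toMeasure),
    ∫⁻ p, edist p.1 p.2 ∂π

/-- `C([0,1]; P₁(ℝ^d))`: curves that are continuous for the metric `W₁`. -/
structure Curve (d : ℕ) where
  toFun : I → P1 d
  continuous_toFun : ∀ s : I, Tendsto (fun t : I => W1 (toFun t) (toFun s)) (𝓝 s) (𝓝 0)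

instance (d : ℕ) : CoeFun (Curve d) (fun _ => I → P1 d) := ⟨Curve.toFun⟩

/-- The uniform distance `sup_{t ∈ [0,1]} W₁(μ_t, η_t)` on `C([0,1]; P₁(ℝ^d))`. -/
def Curve.supDist {d : ℕ} (μ η : Curve d) : ℝ≥0∞ := ⨆ t : I, W1 (μ t) (η t)

/-- `μ ∈ AC([0,1]; P₁(ℝ^d))`: there is `g ∈ L¹(0,1)` with `W₁(μ_s, μ_t) ≤ ∫_s^t g(r) dr` for all
`0 ≤ s ≤ t ≤ 1`. -/
def Curve.IsAC {d : ℕ} (μ : Curve d) : Prop :=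
  ∃ g : ℝ → ℝ, IntervalIntegrable g volume 0 1 ∧
    ∀ s t : I, s ≤ t → W1 (μ s) (μ t) ≤ ENNReal.ofReal (∫ r in (s : ℝ)..t, g r)

/-- The probability measure `dμ_t ⊗ dt` on `ℝ^d × [0,1]`. -/
def Curve.spaceTime {d : ℕ} (μ : Curve d) : Measure (E d × I) :=
  (volume : Measure I).bind fun t => (μ t).toMeasure.map fun y => (y, t)

/-- `M(ℝ^d × [0,1]; U)`: finite `U`-valued Borel measures on `ℝ^d × [0,1]`. -/
abbrev Momentum {d : ℕ} (U : Submodule ℝ (E d)) : Type := VectorMeasure (E d × I) U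

/-- The Euclidean inner product `v · u` of `v ∈ ℝ^d` and `u ∈ U`. -/
def dot {d : ℕ} (U : Submodule ℝ (E d)) : E d →L[ℝ] U →L[ℝ] ℝ :=
  (innerSL ℝ).bilinearComp (ContinuousLinearMap.id ℝ (E d)) U.subtypeL

/-- `∫ f(y,t) · dν(y,t)` for an `ℝ^d`-valued function `f` and a `U`-valued measure `ν`. -/
def Momentum.pair {d : ℕ} {U : Submodule ℝ (E d)} (f : E d × I → E d) (ν : Momentum U) : ℝ :=
  ν.integral f (dot U)

/-- Narrow convergence of a sequence in `M(ℝ^d × [0,1]; U)`: convergence in duality with bounded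
continuous functions `f : ℝ^d × [0,1] → U`. -/
def Momentum.NarrowTendsto {d : ℕ} {U : Submodule ℝ (E d)}
    (ν : ℕ → Momentum U) (ν' : Momentum U) : Prop :=
  ∀ f : BoundedContinuousFunction (E d × I) U,
    Tendsto (fun n => Momentum.pair (fun x => (f x : E d)) (ν n)) atTop
      (𝓝 (Momentum.pair (fun x => (f x : E d)) ν'))

/-- The data of the control problem: control space `U`, state and measure cost `L`, control cost
`ψ`, vector field `F`, source `m₀` and target `m₁`. -/
structure Problem (d : ℕ) where
  U : Submodule ℝ (E d)
  L : E d → P1 d → ℝ≥0∞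
  ψ : U → ℝ
  F : E d → P1 d → E d
  m₀ : P1 d
  m₁ : P1 d

/-- The Lebesgue density of a measure `μ` on `ℝ^d` (meaningful if `μ ≪ volume`). -/
def density {d : ℕ} (μ : P1 d) (y : E d) : ℝ := (μ.toMeasure.rnDeriv volume y).toReal

/-- `dμ(y) = μ(y) dy` with `μ(·) ∈ L²(ℝ^d)`. -/
def HasL2Density {d : ℕ} (μ : P1 d) : Prop :=
  μ.toMeasure ≪ volume ∧ MemLp (density μ) 2 volume

/-- The conditions on a control cost `ψ : U → [0,∞)`, including the existence of a moderating
function `φ : [0,∞) → [0,∞)`. -/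
structure IsControlCost {d : ℕ} {U : Submodule ℝ (E d)} (ψ : U → ℝ) : Prop where
  nonneg : ∀ u, 0 ≤ ψ u
  convex : ConvexOn ℝ univ ψ
  lsc : LowerSemicontinuous ψ
  map_zero : ψ 0 = 0
  exists_moderating : ∃ φ : ℝ → ℝ,
    (∀ r, 0 ≤ r → 0 ≤ φ r) ∧
    StrictConvexOn ℝ (Ici 0) φ ∧
    ContDiffOn ℝ 1 φ (Ici 0) ∧
    φ 0 = 0 ∧
    HasDerivWithinAt φ 0 (Ici 0) 0 ∧
    Tendsto (fun r => φ r / r) atTop atTop ∧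
    (∃ K : ℝ, 0 < K ∧ ∀ r, 0 ≤ r → φ (2 * r) ≤ K * (1 + φ r)) ∧
    (∃ C : ℝ, 0 < C ∧ ∀ u : U, φ ‖u‖ - 1 ≤ ψ u ∧ ψ u ≤ C * (1 + φ ‖u‖))

/-- `L` is real-valued and jointly uniformly continuous on `ℝ^d × P₁(ℝ^d)`. -/
def IsUniformlyContinuousCost {d : ℕ} (L : E d → P1 d → ℝ≥0∞) : Prop :=
  (∀ y μ, L y μ ≠ ⊤) ∧
  ∀ ε : ℝ, 0 < ε → ∃ δ : ℝ, 0 < δ ∧ ∀ y z μ η, dist y z < δ → W1 μ η < ENNReal.ofReal δ →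
    |(L y μ).toReal - (L z η).toReal| < ε

/-- `L` is independent of the measure, `{L = ∞}` is open and `L` is continuous on `{L < ∞}`. -/
def IsObstacleCost {d : ℕ} (L : E d → P1 d → ℝ≥0∞) : Prop :=
  (∀ y μ η, L y μ = L y η) ∧
  ∀ μ, IsOpen {y | L y μ = ⊤} ∧ ContinuousOn (fun y => L y μ) {y | L y μ < ⊤}

/-- `F` is jointly uniformly continuous on `ℝ^d × P₁(ℝ^d)` and has linear growth. -/
def IsAdmissibleField {d : ℕ} (F : E d → P1 d → E d) : Prop :=
  (∀ ε : ℝ, 0 < ε → ∃ δ : ℝ, 0 < δ ∧ ∀ y z μ η, dist y z < δ → W1 μ η < ENNReal.ofReal δ →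
    dist (F y μ) (F z η) < ε) ∧
  ∃ C C' : ℝ, 0 ≤ C ∧ 0 ≤ C' ∧
    ∀ y μ, ‖F y μ‖ ≤ C + C' * (‖y‖ + ∫ z, ‖z‖ ∂μ.toMeasure)

namespace Problem

variable {d : ℕ} (P : Problem d)

/-- The standing assumptions on the data. -/
structure Admissible : Prop where
  target : HasL2Density P.m₁
  cost : IsUniformlyContinuousCost P.L ∨ IsObstacleCost P.L
  control : IsControlCost P.ψ
  field : IsAdmissibleField P.F

/-- The control cost functional `Ψ(ν|μ)`: equal to `∫ ψ(u) d(μ_t ⊗ dt)` if `dν = u dμ_t dt`, and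
`∞` if `ν` has no such density. The density is unique almost everywhere, so the infimum is over
equal values (or over the empty set, with value `∞`). -/
def Psi (ν : Momentum P.U) (μ : Curve d) : ℝ≥0∞ :=
  ⨅ (u : E d × I → P.U) (_ : Integrable u μ.spaceTime ∧ ν = μ.spaceTime.withDensityᵥ u),
    ∫⁻ x, ENNReal.ofReal (P.ψ (u x)) ∂μ.spaceTime

/-- `G(μ,ν) = Ψ(ν|μ) + ∫₀¹ ∫ L(y, μ_t) dμ_t(y) dt`. -/
def G (μ : Curve d) (ν : Momentum P.U) : ℝ≥0∞ :=
  P.Psi ν μ + ∫⁻ t : I, ∫⁻ y, P.L y (μ t) ∂(μ t).toMeasure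

open Classical in
/-- The hard terminal constraint: `0` if `μ = m₁` and `∞` otherwise. -/
def hardPenalty (μ : P1 d) : ℝ≥0∞ := if μ = P.m₁ then 0 else ⊤

open Classical in
/-- The soft terminal penalty: `(1/ε) ∫ |μ(y) - m₁(y)|² dy` if `μ` has an `L²` density and `∞`
otherwise. -/
def softPenalty (ε : ℝ) (μ : P1 d) : ℝ≥0∞ :=
  if HasL2Density μ then
    ENNReal.ofReal (1 / ε) * ∫⁻ y, ENNReal.ofReal (|density μ y - density P.m₁ y| ^ 2)
  else ⊤

/-- The objective of the problem with hard terminal constraint. -/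
def energy (μ : Curve d) (ν : Momentum P.U) : ℝ≥0∞ := P.G μ ν + P.hardPenalty (μ 1)

/-- The objective of the problem with soft terminal constraint. -/
def softEnergy (ε : ℝ) (μ : Curve d) (ν : Momentum P.U) : ℝ≥0∞ :=
  P.G μ ν + P.softPenalty ε (μ 1)

/-- `∂_t μ_t + ∇ · (F(·, μ_t) μ_t + ν_t) = 0` on `ℝ^d × (0,1)` in the sense of distributions. The
test functions are smooth with compact support in `ℝ^d × (0,1)`. -/
def ContinuityEquation (μ : Curve d) (ν : Momentum P.U) : Prop :=
  ∀ φ : E d × ℝ → ℝ, ContDiff ℝ ∞ φ → HasCompactSupport φ →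
    tsupport φ ⊆ {p | p.2 ∈ Ioo (0 : ℝ) 1} →
    (∫ t : I, ∫ y, (deriv (fun s : ℝ => φ (y, s)) (t : ℝ)
        + inner ℝ (gradient (fun z : E d => φ (z, (t : ℝ))) y) (P.F y (μ t))) ∂(μ t).toMeasure)
      + Momentum.pair (fun x => gradient (fun z : E d => φ (z, (x.2 : ℝ))) x.1) ν = 0

/-- The constraint set `C(m₀)`. -/
def constraintSet : Set (Curve d × Momentum P.U) :=
  {p | p.1.IsAC ∧ P.ContinuityEquation p.1 p.2 ∧ p.1 0 = P.m₀}

/-- Feasibility of the problem with hard terminal constraint: the objective is finite somewhere on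
the constraint set. -/
def Feasible : Prop := ∃ p ∈ P.constraintSet, P.energy p.1 p.2 < ⊤

/-- `p` solves the problem with hard terminal constraint. -/
def IsSolution (p : Curve d × Momentum P.U) : Prop :=
  p ∈ P.constraintSet ∧ IsMinOn (fun q => P.energy q.1 q.2) P.constraintSet p

/-- `p` solves the problem with soft terminal constraint. -/
def IsSoftSolution (ε : ℝ) (p : Curve d × Momentum P.U) : Prop :=
  p ∈ P.constraintSet ∧ IsMinOn (fun q => P.softEnergy ε q.1 q.2) P.constraintSet p

end Problem

end MeanFieldControl

end

noncomputable section

namespace MeanFieldControl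

/-! ### Kantorovich duality -/

/-! This is the direct method, with a comparison in place of a recovery sequence. The soft penalty
vanishes at `P.m₁`, so any competitor `q` ending at `P.m₁` bounds every soft minimum by `P.G q.1
q.2`, whatever `ε` is. Feasibility provides one such `q` with finite value. Hence both `P.G (μ n) (ν
n)` and the penalties are bounded uniformly in `n`. The penalty bound makes the squared `L²`
distance of the terminal density to the target at most a constant times `ε n`, so a limit curve ends
at `P.m₁` (`eq_of_tendsto_of_tendsto_density`). Lower semicontinuity of `G` and the same comparison
with an arbitrary `q` give minimality.

What remains is `Problem.exists_limit`: compactness and lower semicontinuity under a bound on `G`.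
Superlinear growth of the control cost gives `‖u‖ ≤ A + δ ψ(u)` with `δ` as small as desired
(`IsControlCost.exists_norm_le`), and this replaces every uniform integrability argument. Testing
the continuity equation with truncated moments `⟨x⟩² / (R + ⟨x⟩)` and applying Gronwall gives
uniformly small tails of the first moments (`exists_tailMoment_bound`). Testing with 1-Lipschitz
functions bounds the `W₁` speed by the mean velocity, hence equicontinuity (`exists_modulus`).
Arzelà–Ascoli then yields uniform convergence of curves.

The controls converge as Young measures: the laws of `(x, u_n(x))` are tight, and the limit control
is the barycentre of the disintegrated limit law, with Jensen giving lower semicontinuity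
(`exists_limit_control`). The continuity equation passes to the limit by uniform continuity of the
field.

Since `W1` is an infimum over couplings while the equation only sees test functions, all of this
rests on Kantorovich–Rubinstein duality, obtained from Hahn–Banach in finite dimension and
simple-function approximation. -/

/-- Duality for the transport problem between finite probability vectors. -/
theorem exists_finite_coupling {ι κ : Type*} [Fintype ι] [Fintype κ]
    (p : ι → ℝ) (q : κ → ℝ) (hp : p ∈ stdSimplex ℝ ι) (hq : q ∈ stdSimplex ℝ κ)
    (c : ι → κ → ℝ) (c₀ : ℝ)
    (h : ∀ (f : ι → ℝ) (g : κ → ℝ), (∀ i j, f i + g j ≤ c i j) →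
      ∑ i, f i * p i + ∑ j, g j * q j ≤ c₀) :
    ∃ w : ι → κ → ℝ, (∀ i j, 0 ≤ w i j) ∧ (∀ i, ∑ j, w i j = p i) ∧ (∀ j, ∑ i, w i j = q j) ∧
      ∑ i, ∑ j, w i j * c i j ≤ c₀ := by
  classical
  let A : (ι × κ → ℝ) →ₗ[ℝ] (ι → ℝ) × (κ → ℝ) × ℝ :=
    { toFun := fun w => (fun i => ∑ j, w (i, j), fun j => ∑ i, w (i, j),
        ∑ i, ∑ j, w (i, j) * c i j)
      map_add' := by
        intro x y
        simp [Finset.sum_add_distrib, add_mul, funext_iff]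
      map_smul' := by
        intro r x
        simp [Finset.mul_sum, mul_assoc, funext_iff] }
  have hAc : Continuous A := A.continuous_of_finiteDimensional
  let K := A '' stdSimplex ℝ (ι × κ)
  have hK : IsCompact K := (isCompact_stdSimplex ℝ (ι × κ)).image hAc
  have hKc : Convex ℝ K := (convex_stdSimplex ℝ (ι × κ)).linear_image A
  let T : Set ((ι → ℝ) × (κ → ℝ) × ℝ) := {x | x.1 = p ∧ x.2.1 = q ∧ x.2.2 ≤ c₀}
  have hT : IsClosed T := by
    refine (isClosed_eq continuous_fst continuous_const).inter
      ((isClosed_eq (continuous_fst.comp continuous_snd) continuous_const).inter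
        (isClosed_le (continuous_snd.comp continuous_snd) continuous_const))
  have hTc : Convex ℝ T := by
    rintro ⟨x, y, s⟩ ⟨hx, hy, hs⟩ ⟨x', y', s'⟩ ⟨hx', hy', hs'⟩ a b ha hb hab
    simp only at hx hy hs hx' hy' hs'
    subst hx hy hx' hy'
    refine ⟨?_, ?_, ?_⟩
    · simp [← add_smul, hab]
    · simp [← add_smul, hab]
    · simp only [Prod.smul_mk, Prod.mk_add_mk, smul_eq_mul]
      calc a * s + b * s' ≤ a * c₀ + b * c₀ := by gcongr
        _ = c₀ := by rw [← add_mul, hab, one_mul]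
  -- `K` collects the marginals and costs of all plans, `T` the admissible outcomes. A common point
  -- is the coupling sought. If there is none, a separating functional produces a dual pair
  -- violating `h`.
  by_cases hd : Disjoint K T
  · exfalso
    obtain ⟨L, u, v, hLK, huv, hLT⟩ := geometric_hahn_banach_compact_closed hKc hK hTc hT hd
    let f : ι → ℝ := fun i => L (Pi.single i 1, 0, 0)
    let g : κ → ℝ := fun j => L (0, Pi.single j 1, 0)
    let l : ℝ := L (0, 0, 1)
    have hL : ∀ x y s, L (x, y, s) = ∑ i, f i * x i + ∑ j, g j * y j + l * s := by
      intro x y s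
      have h1 : (x, y, s) = ∑ i, x i • ((Pi.single i 1, 0, 0) : (ι → ℝ) × (κ → ℝ) × ℝ)
          + ∑ j, y j • ((0, Pi.single j 1, 0) : (ι → ℝ) × (κ → ℝ) × ℝ)
          + s • ((0, 0, 1) : (ι → ℝ) × (κ → ℝ) × ℝ) := by
        ext <;> simp [Prod.fst_sum, Prod.snd_sum, Finset.sum_apply, Pi.single_apply]
      rw [h1]
      simp only [map_add, map_sum, map_smul, smul_eq_mul]
      simp [f, g, l, mul_comm]
    -- The product plan has the right marginals at some cost `s₀`. It lies on the vertical line of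
    -- `T`, which forces the cost coefficient `l` of the functional to be negative.
    have hprod : A (fun x => p x.1 * q x.2) ∈ K := by
      refine ⟨_, ⟨fun x => mul_nonneg (hp.1 _) (hq.1 _), ?_⟩, rfl⟩
      rw [Fintype.sum_prod_type]
      simp [← Finset.mul_sum, hq.2, hp.2]
    have hprod' : A (fun x => p x.1 * q x.2) = (p, q, ∑ i, ∑ j, p i * q j * c i j) := by
      simp only [A, LinearMap.coe_mk, AddHom.coe_mk, Prod.mk.injEq, and_true]
      constructor
      · ext i; simp [← Finset.mul_sum, hq.2]
      · ext j; simp [← Finset.sum_mul, hp.2]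
    have h1 := hLK _ hprod
    rw [hprod', hL] at h1
    set s₀ := ∑ i, ∑ j, p i * q j * c i j
    set B := ∑ i, f i * p i + ∑ j, g j * q j
    have h2 : ∀ s ≤ c₀, v < B + l * s := fun s hs => by
      have := hLT (p, q, s) ⟨rfl, rfl, hs⟩
      rwa [hL] at this
    have hl : l < 0 := by
      by_contra hl
      push Not at hl
      have := h2 (min s₀ c₀) (min_le_right _ _)
      have h3 : l * min s₀ c₀ ≤ l * s₀ := by gcongr; exact min_le_left _ _
      linarith
    -- Evaluation at the vertices of the simplex. After division by `-l > 0` this is the dual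
    -- constraint for `(f - u)/(-l)` and `g/(-l)`, whose dual value exceeds `c₀` because `u < v`.
    have h3 : ∀ i j, f i + g j + l * c i j < u := by
      intro i j
      have hm : A (Pi.single (i, j) 1) ∈ K := ⟨_, single_mem_stdSimplex ℝ (i, j), rfl⟩
      have he : A (Pi.single (i, j) 1) = (Pi.single i 1, Pi.single j 1, c i j) := by
        simp only [A, LinearMap.coe_mk, AddHom.coe_mk, Prod.mk.injEq]
        refine ⟨?_, ?_, ?_⟩
        · ext a
          by_cases ha : a = i
          · subst ha; simp [Pi.single_apply]
          · simp [ha]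
        · ext a
          by_cases ha : a = j
          · subst ha; simp [Pi.single_apply]
          · simp [ha]
        · rw [Finset.sum_eq_single i, Finset.sum_eq_single j] <;> simp +contextual [Pi.single_apply]
      have := hLK _ hm
      rw [he, hL] at this
      simpa [Pi.single_apply] using this
    have h4 := h (fun i => (f i - u) / (-l)) (fun j => g j / (-l)) (fun i j => by
      rw [← add_div, div_le_iff₀ (by linarith)]
      have := h3 i j
      linarith)
    have h5 : ∑ i, (f i - u) / (-l) * p i + ∑ j, g j / (-l) * q j = (B - u) / (-l) := by
      have : ∑ i, u * p i = u := by rw [← Finset.mul_sum, hp.2, mul_one]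
      simp only [div_mul_eq_mul_div, ← Finset.sum_div, sub_mul, Finset.sum_sub_distrib, this, B]
      ring
    rw [h5, div_le_iff₀ (by linarith)] at h4
    have := h2 c₀ le_rfl
    linarith
  · rw [Set.not_disjoint_iff] at hd
    obtain ⟨x, ⟨w, hw, rfl⟩, hx⟩ := hd
    refine ⟨fun i j => w (i, j), fun i j => hw.1 _, fun i => ?_, fun j => ?_, hx.2.2⟩
    · exact congrFun hx.1 i
    · exact congrFun hx.2.1 j

variable {d : ℕ}

theorem P1.integrable_norm (μ : P1 d) : Integrable (fun x : E d => ‖x‖) μ.toMeasure := by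
  refine ⟨by fun_prop, ?_⟩
  simpa [HasFiniteIntegral] using μ.moment_lt_top

theorem P1.integrable_lipschitz (μ : P1 d) {K : ℝ≥0} {f : E d → ℝ} (hf : LipschitzWith K f) :
    Integrable f μ.toMeasure := by
  refine Integrable.mono' (g := fun x => |f 0| + K * ‖x‖)
    ((integrable_const _).add (μ.integrable_norm.const_mul _))
    hf.continuous.aestronglyMeasurable (ae_of_all _ fun x => ?_)
  have := hf.dist_le_mul x 0
  rw [dist_zero_right, Real.dist_eq] at this
  have h2 := abs_sub_abs_le_abs_sub (f x) (f 0)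
  rw [Real.norm_eq_abs]
  linarith


/-- The easy half of Kantorovich-Rubinstein duality. -/
theorem enorm_integral_sub_le_W1 (μ η : P1 d) {K : ℝ≥0} {f : E d → ℝ} (hf : LipschitzWith K f) :
    ‖∫ x, f x ∂μ.toMeasure - ∫ x, f x ∂η.toMeasure‖ₑ ≤ K * W1 μ η := by
  -- Moving `K` inside the infimum requires `K ≠ 0`.
  rcases eq_or_ne K 0 with rfl | hK
  · have hc : ∀ x, f x = f 0 := fun x => by simpa using hf x 0
    obtain ⟨c, rfl⟩ : ∃ c, f = fun _ => c := ⟨f 0, funext hc⟩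
    simp
  rw [W1, ENNReal.mul_iInf_of_ne (by simpa) (by simp)]
  refine le_iInf fun π => ?_
  rw [ENNReal.mul_iInf_of_ne (by simpa) (by simp)]
  refine le_iInf fun hπ => ?_
  have h1 : Integrable (fun p : E d × E d => f p.1) π := by
    have := μ.integrable_lipschitz hf
    rw [← hπ.1] at this
    exact this.comp_measurable measurable_fst
  have h2 : Integrable (fun p : E d × E d => f p.2) π := by
    have := η.integrable_lipschitz hf
    rw [← hπ.2] at this
    exact this.comp_measurable measurable_snd
  have e1 : ∫ x, f x ∂μ.toMeasure = ∫ p, f p.1 ∂π := by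
    rw [← hπ.1, integral_map measurable_fst.aemeasurable hf.continuous.aestronglyMeasurable]
  have e2 : ∫ x, f x ∂η.toMeasure = ∫ p, f p.2 ∂π := by
    rw [← hπ.2, integral_map measurable_snd.aemeasurable hf.continuous.aestronglyMeasurable]
  rw [e1, e2, ← integral_sub h1 h2, ← lintegral_const_mul _ (by fun_prop)]
  refine (enorm_integral_le_lintegral_enorm _).trans (lintegral_mono fun p => ?_)
  rw [← edist_eq_enorm_sub]
  exact hf p.1 p.2

/-- A finite coupling of the masses of the cells of a partition lifts to a coupling. -/
theorem W1_le_of_simpleFunc (μ η : P1 d) (T : SimpleFunc (E d) (E d)) (a : ℝ≥0∞)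
    (w : T.range → T.range → ℝ) (hw : ∀ i j, 0 ≤ w i j)
    (hw₁ : ∀ i, ∑ j, w i j = μ.toMeasure.real (T ⁻¹' {(i : E d)}))
    (hw₂ : ∀ j, ∑ i, w i j = η.toMeasure.real (T ⁻¹' {(j : E d)}))
    (ha₁ : ∫⁻ x, edist (T x) x ∂μ.toMeasure ≤ a) (ha₂ : ∫⁻ x, edist (T x) x ∂η.toMeasure ≤ a) :
    W1 μ η ≤ a + ENNReal.ofReal (∑ i, ∑ j, w i j * dist (i : E d) (j : E d)) + a := by
  classical
  let A : T.range → Set (E d) := fun i => T ⁻¹' {(i : E d)}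
  have hA : ∀ i, MeasurableSet (A i) := fun i => T.measurableSet_fiber _
  -- A positive weight forces both cells to have positive mass, so that the conditional measures
  -- used below are probabilities.
  have hz₁ : ∀ i j, w i j ≠ 0 → μ.toMeasure (A i) ≠ 0 := by
    intro i j hij h0
    have h1 : ∑ j, w i j = 0 := by rw [hw₁]; simp [measureReal_def, A] at h0 ⊢; simp [h0]
    exact hij ((Finset.sum_eq_zero_iff_of_nonneg fun j _ => hw i j).1 h1 j (Finset.mem_univ _))
  have hz₂ : ∀ i j, w i j ≠ 0 → η.toMeasure (A j) ≠ 0 := by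
    intro i j hij h0
    have h1 : ∑ i, w i j = 0 := by rw [hw₂]; simp [measureReal_def, A] at h0 ⊢; simp [h0]
    exact hij ((Finset.sum_eq_zero_iff_of_nonneg fun i _ => hw i j).1 h1 i (Finset.mem_univ _))
  have hsum : ∀ ρ : Measure (E d), IsFiniteMeasure ρ →
      ∑ i, ρ (A i) • ProbabilityTheory.cond ρ (A i) = ρ := by
    intro ρ hρ
    have h1 : ∀ i, ρ (A i) • ProbabilityTheory.cond ρ (A i) = ρ.restrict (A i) := by
      intro i
      rcases eq_or_ne (ρ (A i)) 0 with h | h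
      · rw [h, zero_smul, Measure.restrict_eq_zero.2 h]
      · rw [ProbabilityTheory.cond, smul_smul, ENNReal.mul_inv_cancel h (measure_ne_top _ _),
          one_smul]
    simp_rw [h1]
    rw [← Measure.sum_fintype, ← Measure.restrict_iUnion (fun i j hij => ?_) hA]
    · have : ⋃ i, A i = univ := by
        ext x
        simp only [mem_iUnion, mem_univ, iff_true]
        exact ⟨⟨T x, T.mem_range_self x⟩, rfl⟩
      rw [this, Measure.restrict_univ]
    · refine Set.disjoint_left.2 fun x hx hx' => hij (Subtype.ext ?_)
      exact (show T x = i from hx).symm.trans hx'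
  -- Inside a pair of cells the mass `w i j` is spread independently. How it is spread does not
  -- matter, since `T` is constant on each cell.
  let π : Measure (E d × E d) := ∑ i, ∑ j, ENNReal.ofReal (w i j) •
    (ProbabilityTheory.cond μ.toMeasure (A i)).prod (ProbabilityTheory.cond η.toMeasure (A j))
  have hmap₁ : ∀ i j, ENNReal.ofReal (w i j) • ((ProbabilityTheory.cond μ.toMeasure (A i)).prod
      (ProbabilityTheory.cond η.toMeasure (A j))).map Prod.fst
      = ENNReal.ofReal (w i j) • ProbabilityTheory.cond μ.toMeasure (A i) := by
    intro i j
    rcases eq_or_ne (w i j) 0 with h | h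
    · simp [h]
    · have := ProbabilityTheory.cond_isProbabilityMeasure (hz₂ i j h)
      rw [Measure.map_fst_prod, measure_univ, one_smul]
  have hmap₂ : ∀ i j, ENNReal.ofReal (w i j) • ((ProbabilityTheory.cond μ.toMeasure (A i)).prod
      (ProbabilityTheory.cond η.toMeasure (A j))).map Prod.snd
      = ENNReal.ofReal (w i j) • ProbabilityTheory.cond η.toMeasure (A j) := by
    intro i j
    rcases eq_or_ne (w i j) 0 with h | h
    · simp [h]
    · have := ProbabilityTheory.cond_isProbabilityMeasure (hz₁ i j h)
      rw [Measure.map_snd_prod, measure_univ, one_smul]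
  have hπ₁ : π.map Prod.fst = μ.toMeasure := by
    simp only [π, ← Measure.mapₗ_apply_of_measurable measurable_fst, map_sum, map_smul]
    simp only [Measure.mapₗ_apply_of_measurable measurable_fst]
    simp_rw [hmap₁, ← Finset.sum_smul]
    rw [← hsum μ.toMeasure inferInstance]
    refine Finset.sum_congr rfl fun i _ => ?_
    rw [hsum μ.toMeasure inferInstance, ← ENNReal.ofReal_sum_of_nonneg fun j _ => hw i j, hw₁,
      ofReal_measureReal]
  have hπ₂ : π.map Prod.snd = η.toMeasure := by
    simp only [π, ← Measure.mapₗ_apply_of_measurable measurable_snd, map_sum, map_smul]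
    simp only [Measure.mapₗ_apply_of_measurable measurable_snd]
    rw [Finset.sum_comm]
    simp_rw [hmap₂, ← Finset.sum_smul]
    rw [← hsum η.toMeasure inferInstance]
    refine Finset.sum_congr rfl fun i _ => ?_
    rw [hsum η.toMeasure inferInstance, ← ENNReal.ofReal_sum_of_nonneg fun j _ => hw j i, hw₂,
      ofReal_measureReal]
  have hTm : Measurable T := T.measurable
  calc W1 μ η ≤ ∫⁻ p, edist p.1 p.2 ∂π := iInf₂_le π ⟨hπ₁, hπ₂⟩
    _ ≤ ∫⁻ p, edist (T p.1) p.1 + edist (T p.1) (T p.2) + edist (T p.2) p.2 ∂π := by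
        refine lintegral_mono fun p => ?_
        refine (edist_triangle4 p.1 (T p.1) (T p.2) p.2).trans ?_
        rw [edist_comm p.1]
    _ = ∫⁻ p, edist (T p.1) p.1 ∂π + ∫⁻ p, edist (T p.1) (T p.2) ∂π
          + ∫⁻ p, edist (T p.2) p.2 ∂π := by
        rw [lintegral_add_right _ (by fun_prop), lintegral_add_right _ (by fun_prop)]
    _ ≤ _ := by
        gcongr
        · rw [← hπ₁, lintegral_map (by fun_prop) measurable_fst] at ha₁
          exact ha₁
        · simp only [π, lintegral_finsetSum_measure, lintegral_smul_measure]
          rw [ENNReal.ofReal_sum_of_nonneg fun i _ =>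
            Finset.sum_nonneg fun j _ => mul_nonneg (hw i j) dist_nonneg]
          refine Finset.sum_le_sum fun i _ => ?_
          rw [ENNReal.ofReal_sum_of_nonneg fun j _ => mul_nonneg (hw i j) dist_nonneg]
          refine Finset.sum_le_sum fun j _ => ?_
          rw [ENNReal.ofReal_mul (hw i j), ← edist_dist, smul_eq_mul]
          rcases eq_or_ne (w i j) 0 with h | h
          · simp [h]
          gcongr
          have i1 := ProbabilityTheory.cond_isProbabilityMeasure (hz₁ i j h)
          have i2 := ProbabilityTheory.cond_isProbabilityMeasure (hz₂ i j h)
          rw [lintegral_prod _ (by fun_prop)]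
          have a1 : ∀ᵐ x ∂(ProbabilityTheory.cond μ.toMeasure (A i)), T x = i :=
            ProbabilityTheory.ae_cond_mem (hA i)
          have a2 : ∀ᵐ x ∂(ProbabilityTheory.cond η.toMeasure (A j)), T x = j :=
            ProbabilityTheory.ae_cond_mem (hA j)
          have : ∀ᵐ x ∂(ProbabilityTheory.cond μ.toMeasure (A i)),
              ∫⁻ y, edist (T x) (T y) ∂(ProbabilityTheory.cond η.toMeasure (A j))
                = edist (i : E d) (j : E d) := by
            filter_upwards [a1] with x hx
            rw [lintegral_congr_ae (g := fun _ => edist (i : E d) (j : E d))]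
            · simp
            · filter_upwards [a2] with y hy
              rw [hx, hy]
          rw [lintegral_congr_ae this]
          simp
        · rw [← hπ₂, lintegral_map (by fun_prop) measurable_snd] at ha₂
          exact ha₂

/-- The hard half of Kantorovich-Rubinstein duality. -/
theorem W1_le_of_forall_lipschitz (μ η : P1 d) (c : ℝ)
    (h : ∀ f : E d → ℝ, LipschitzWith 1 f →
      ∫ x, f x ∂μ.toMeasure - ∫ x, f x ∂η.toMeasure ≤ c) :
    W1 μ η ≤ ENNReal.ofReal c := by
  have hc : 0 ≤ c := by simpa using h (fun _ => 0) (LipschitzWith.const' _)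
  -- The four `δ`: replacing the points by their images under `T` costs one for each measure in the
  -- dual bound, and one for each measure in the final coupling.
  have key : ∀ δ : ℝ, 0 < δ → W1 μ η ≤ ENNReal.ofReal (c + 4 * δ) := by
    intro δ hδ
    obtain ⟨T, hT₁, hT₂⟩ : ∃ T : SimpleFunc (E d) (E d),
        ∫⁻ x, edist (T x) x ∂μ.toMeasure < ENNReal.ofReal δ ∧
        ∫⁻ x, edist (T x) x ∂η.toMeasure < ENNReal.ofReal δ := by
      have hlim : ∀ ρ : P1 d, Tendsto (fun n => ∫⁻ x, ‖SimpleFunc.approxOn (fun x : E d => x)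
          measurable_id univ 0 (mem_univ _) n x - x‖ₑ ∂ρ.toMeasure) atTop (𝓝 0) := fun ρ =>
        SimpleFunc.tendsto_approxOn_L1_enorm measurable_id (mem_univ _)
          (ae_of_all _ fun x => by simp) (by
            simpa [hasFiniteIntegral_iff_enorm] using ρ.moment_lt_top)
      have hδ' : (0 : ℝ≥0∞) < ENNReal.ofReal δ := by simpa
      obtain ⟨n, h1, h2⟩ := (((hlim μ).eventually_lt_const hδ').and
        ((hlim η).eventually_lt_const hδ')).exists
      exact ⟨_, by simpa only [edist_eq_enorm_sub] using h1,
        by simpa only [edist_eq_enorm_sub] using h2⟩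
    have hprob : ∀ ρ : P1 d, (fun i : T.range => ρ.toMeasure.real (T ⁻¹' {(i : E d)}))
        ∈ stdSimplex ℝ T.range := by
      intro ρ
      refine ⟨fun i => measureReal_nonneg, ?_⟩
      have h1 := T.sum_range_measure_preimage_singleton ρ.toMeasure
      rw [measure_univ] at h1
      rw [Finset.sum_coe_sort T.range fun i => ρ.toMeasure.real (T ⁻¹' {i})]
      simp only [measureReal_def]
      rw [← ENNReal.toReal_sum fun _ _ => measure_ne_top _ _, h1, ENNReal.toReal_one]
    have hint : ∀ (ρ : P1 d) (g : E d → ℝ), ∑ i : T.range, g i * ρ.toMeasure.real (T ⁻¹' {(i : E d)})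
        = ∫ x, g (T x) ∂ρ.toMeasure := by
      intro ρ g
      rw [Finset.sum_coe_sort T.range fun i => g i * ρ.toMeasure.real (T ⁻¹' {i})]
      have h1 : (fun x => g (T x)) = fun x =>
          ∑ i ∈ T.range, (T ⁻¹' {i}).indicator (fun _ => g i) x := by
        ext x
        rw [Finset.sum_eq_single (T x)]
        · simp
        · intro i _ hi
          rw [indicator_of_notMem]
          exact fun h => hi h.symm
        · exact fun h => absurd (T.mem_range_self x) h
      rw [h1, integral_finsetSum _ fun i _ => (integrable_const _).indicator (T.measurableSet_fiber i)]
      refine Finset.sum_congr rfl fun i _ => ?_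
      rw [integral_indicator_const _ (T.measurableSet_fiber i), smul_eq_mul, mul_comm]
    have hclose : ∀ (ρ : P1 d), ∫⁻ x, edist (T x) x ∂ρ.toMeasure < ENNReal.ofReal δ →
        ∀ g : E d → ℝ, LipschitzWith 1 g →
          |∫ x, g (T x) ∂ρ.toMeasure - ∫ x, g x ∂ρ.toMeasure| ≤ δ := by
      intro ρ hρ g hg
      have hi : Integrable (fun x => g (T x)) ρ.toMeasure :=
        SimpleFunc.integrable_of_isFiniteMeasure (T.map g)
      rw [← integral_sub hi (ρ.integrable_lipschitz hg), ← Real.norm_eq_abs,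
        ← ENNReal.ofReal_le_ofReal_iff hδ.le, ofReal_norm]
      refine (enorm_integral_le_lintegral_enorm _).trans ((lintegral_mono fun x => ?_).trans hρ.le)
      rw [← edist_eq_enorm_sub]
      simpa using hg (T x) x
    obtain ⟨w, hw, hw₁, hw₂, hwc⟩ := exists_finite_coupling _ _ (hprob μ) (hprob η)
      (fun i j => dist (i : E d) (j : E d)) (c + 2 * δ) (by
        intro f g hfg
        have hne : (Finset.univ : Finset T.range).Nonempty :=
          ⟨⟨T 0, T.mem_range_self 0⟩, Finset.mem_univ _⟩
        -- The `c`-transform of `g`: a dual pair `(f, g)` is dominated by `(h', -h')` with a single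
        -- 1-Lipschitz `h'`.
        let h' : E d → ℝ := fun x => Finset.univ.inf' hne fun j : T.range => dist x j - g j
        have hLip : LipschitzWith 1 h' := by
          refine LipschitzWith.of_le_add fun x y => ?_
          rw [← sub_le_iff_le_add]
          refine Finset.le_inf' _ _ fun j _ => ?_
          have h1 : h' x ≤ dist x j - g j := Finset.inf'_le _ (Finset.mem_univ j)
          have h2 := dist_triangle x y j
          linarith
        have hf : ∀ i : T.range, f i ≤ h' i := fun i =>
          Finset.le_inf' _ _ fun j _ => by linarith [hfg i j]
        have hg : ∀ j : T.range, g j ≤ - h' j := fun j => by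
          have : h' j ≤ dist (j : E d) j - g j := Finset.inf'_le _ (Finset.mem_univ j)
          rw [dist_self] at this
          linarith
        have e1 := (abs_le.1 (hclose μ hT₁ h' hLip)).2
        have e2 := (abs_le.1 (hclose η hT₂ h' hLip)).1
        have e3 := h h' hLip
        rw [← hint] at e1 e2
        calc _ ≤ ∑ i : T.range, h' i * μ.toMeasure.real (T ⁻¹' {(i : E d)})
              + ∑ j : T.range, (- h' j) * η.toMeasure.real (T ⁻¹' {(j : E d)}) := by
              gcongr with i _ j _
              · exact hf i
              · exact hg j
          _ ≤ _ := by
              simp only [neg_mul, Finset.sum_neg_distrib]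
              linarith)
    refine (W1_le_of_simpleFunc μ η T (ENNReal.ofReal δ) w hw hw₁ hw₂ hT₁.le hT₂.le).trans ?_
    have hn : 0 ≤ ∑ i, ∑ j, w i j * dist (i : E d) (j : E d) :=
      Finset.sum_nonneg fun i _ => Finset.sum_nonneg fun j _ => mul_nonneg (hw i j) dist_nonneg
    rw [← ENNReal.ofReal_add hδ.le hn, ← ENNReal.ofReal_add (by linarith) hδ.le]
    apply ENNReal.ofReal_le_ofReal
    linarith
  refine ENNReal.le_of_forall_pos_le_add fun ε hε _ => ?_
  have := key (ε / 4) (by positivity)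
  rwa [mul_div_cancel₀ _ (by norm_num : (4 : ℝ) ≠ 0), ENNReal.ofReal_add hc (by positivity),
    ENNReal.ofReal_coe_nnreal] at this

/-- Mollification: a `1`-Lipschitz function is a uniform limit of smooth `1`-Lipschitz functions. -/
theorem exists_smooth_lipschitz_approx {f : E d → ℝ} (hf : LipschitzWith 1 f) {δ : ℝ}
    (hδ : 0 < δ) :
    ∃ g : E d → ℝ, ContDiff ℝ ∞ g ∧ LipschitzWith 1 g ∧ ∀ x, |g x - f x| ≤ δ := by
  -- An average of `f` over shifts of length at most `δ` stays 1-Lipschitz and moves `f` by at most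
  -- `δ`.
  let b : ContDiffBump (0 : E d) := ⟨δ / 2, δ, by positivity, by linarith⟩
  let g : E d → ℝ := convolution (b.normed volume) f (ContinuousLinearMap.lsmul ℝ ℝ) volume
  have hcs : HasCompactSupport (b.normed (volume : Measure (E d))) := b.hasCompactSupport_normed
  have hcont : Continuous (b.normed (volume : Measure (E d))) := b.continuous_normed
  have hint : ∀ x, Integrable (fun t => b.normed volume t * f (x - t)) (volume : Measure (E d)) :=
    fun x => Continuous.integrable_of_hasCompactSupport
      (hcont.mul (hf.continuous.comp (by fun_prop))) hcs.mul_right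
  have hg : ∀ x, g x = ∫ t, b.normed volume t * f (x - t) := fun x => by
    simp [g, convolution]
  refine ⟨g, ?_, ?_, ?_⟩
  · exact hcs.contDiff_convolution_left (n := (⊤ : ℕ∞)) _ b.contDiff_normed
      hf.continuous.locallyIntegrable
  · refine LipschitzWith.of_le_add fun x y => ?_
    rw [hg, hg]
    have h1 : ∫ t, b.normed volume t * dist x y ∂(volume : Measure (E d)) = dist x y := by
      rw [integral_mul_const, b.integral_normed, one_mul]
    rw [← h1, ← integral_add (hint y) (b.integrable_normed.mul_const _)]
    refine integral_mono (hint x) ((hint y).add (b.integrable_normed.mul_const _)) fun t => ?_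
    simp only [← mul_add]
    refine mul_le_mul_of_nonneg_left ?_ (b.nonneg_normed t)
    have := (le_abs_self _).trans (hf.dist_le_mul (x - t) (y - t))
    rw [NNReal.coe_one, one_mul, dist_sub_right] at this
    linarith
  · intro x
    rw [← Real.dist_eq]
    refine ContDiffBump.dist_normed_convolution_le hf.continuous.aestronglyMeasurable fun y hy => ?_
    refine (hf.dist_le_mul y x).trans ?_
    rw [NNReal.coe_one, one_mul]
    exact (Metric.mem_ball.1 hy).le

/-- Mollification changes each integral by an arbitrarily small amount. Smooth test functions are
those to which the continuity equation applies. -/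
theorem W1_le_of_forall_smooth (μ η : P1 d) (c : ℝ)
    (h : ∀ f : E d → ℝ, ContDiff ℝ ∞ f → LipschitzWith 1 f →
      ∫ x, f x ∂μ.toMeasure - ∫ x, f x ∂η.toMeasure ≤ c) :
    W1 μ η ≤ ENNReal.ofReal c := by
  refine W1_le_of_forall_lipschitz μ η c fun f hf => ?_
  refine le_of_forall_pos_le_add fun δ hδ => ?_
  obtain ⟨g, hg, hgL, hgf⟩ := exists_smooth_lipschitz_approx hf (half_pos hδ)
  have h1 : ∀ ρ : P1 d, |∫ x, g x ∂ρ.toMeasure - ∫ x, f x ∂ρ.toMeasure| ≤ δ / 2 := by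
    intro ρ
    rw [← integral_sub (ρ.integrable_lipschitz hgL) (ρ.integrable_lipschitz hf)]
    have := norm_integral_le_of_norm_le_const (μ := ρ.toMeasure)
      (f := fun x => g x - f x) (ae_of_all _ hgf)
    simpa using this
  have h2 := abs_le.1 (h1 μ)
  have h3 := abs_le.1 (h1 η)
  have h4 := h g hg hgL
  linarith [h2.1, h3.2]

/-! ### `W₁` as a metric on `P₁`, and its relation to narrow convergence -/

theorem W1_ne_top (μ η : P1 d) : W1 μ η ≠ ⊤ := by
  refine ne_top_of_le_ne_top ENNReal.ofReal_ne_top (W1_le_of_forall_lipschitz μ η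
    (∫ x, ‖x‖ ∂μ.toMeasure + ∫ x, ‖x‖ ∂η.toMeasure) fun f hf => ?_)
  -- Duality reduces finiteness to the first moments: the constant `f 0` cancels between two
  -- probability measures.
  have hb : ∀ x, |f x - f 0| ≤ ‖x‖ := fun x => by simpa [Real.dist_eq] using hf.dist_le_mul x 0
  have h1 : ∫ x, f x ∂μ.toMeasure ≤ f 0 + ∫ x, ‖x‖ ∂μ.toMeasure := by
    calc _ ≤ ∫ x, (f 0 + ‖x‖) ∂μ.toMeasure := integral_mono (μ.integrable_lipschitz hf)
          ((integrable_const _).add μ.integrable_norm) fun x => by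
            have := (abs_le.1 (hb x)).2
            simp only
            linarith
      _ = _ := by rw [integral_add (integrable_const _) μ.integrable_norm]; simp
  have h2 : f 0 - ∫ x, ‖x‖ ∂η.toMeasure ≤ ∫ x, f x ∂η.toMeasure := by
    calc _ = ∫ x, (f 0 - ‖x‖) ∂η.toMeasure := by
          rw [integral_sub (integrable_const _) η.integrable_norm]; simp
      _ ≤ _ := integral_mono ((integrable_const _).sub η.integrable_norm)
          (η.integrable_lipschitz hf) fun x => by
            have := (abs_le.1 (hb x)).1
            simp only
            linarith
  linarith

theorem abs_integral_sub_le_toReal_W1 (μ η : P1 d) {K : ℝ≥0} {f : E d → ℝ}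
    (hf : LipschitzWith K f) :
    |∫ x, f x ∂μ.toMeasure - ∫ x, f x ∂η.toMeasure| ≤ K * (W1 μ η).toReal := by
  have h := enorm_integral_sub_le_W1 μ η hf
  have h2 : (K : ℝ≥0∞) * W1 μ η ≠ ⊤ := ENNReal.mul_ne_top (by simp) (W1_ne_top μ η)
  simpa using ENNReal.toReal_mono h2 h

/-- The underlying element of Mathlib's space of probability measures. -/
def P1.toProb (μ : P1 d) : ProbabilityMeasure (E d) := ⟨μ.toMeasure, μ.isProbabilityMeasure⟩

@[simp] theorem P1.coe_toProb (μ : P1 d) : (μ.toProb : Measure (E d)) = μ.toMeasure := rfl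

theorem P1.toProb_injective : Function.Injective (P1.toProb (d := d)) := fun _ _ h =>
  P1.ext (congrArg Subtype.val h)

/-- Narrow convergence may be tested on bounded Lipschitz functions, whose integrals are controlled
by `W₁`. -/
theorem tendsto_toProb_of_tendsto_W1 {ι : Type*} {l : Filter ι} [l.IsCountablyGenerated]
    {μ : ι → P1 d} {η : P1 d}
    (h : Tendsto (fun i => W1 (μ i) η) l (𝓝 0)) :
    Tendsto (fun i => (μ i).toProb) l (𝓝 η.toProb) := by
  rw [tendsto_iff_forall_lipschitz_integral_tendsto]
  rintro f - ⟨K, hf⟩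
  rw [tendsto_iff_dist_tendsto_zero]
  have h1 : Tendsto (fun i => K * (W1 (μ i) η).toReal) l (𝓝 0) := by
    have := (ENNReal.tendsto_toReal ENNReal.zero_ne_top).comp h
    simpa using this.const_mul (K : ℝ)
  refine squeeze_zero (fun _ => dist_nonneg) (fun i => ?_) h1
  rw [Real.dist_eq]
  exact abs_integral_sub_le_toReal_W1 _ _ hf

theorem W1_self (μ : P1 d) : W1 μ μ = 0 := by
  simpa using W1_le_of_forall_lipschitz μ μ 0 fun f _ => by simp

theorem W1_comm (μ η : P1 d) : W1 μ η = W1 η μ := by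
  have : ∀ μ η : P1 d, W1 μ η ≤ W1 η μ := fun μ η => by
    rw [← ENNReal.ofReal_toReal (W1_ne_top η μ)]
    refine W1_le_of_forall_lipschitz _ _ _ fun f hf => ?_
    have := (abs_le.1 (abs_integral_sub_le_toReal_W1 η μ hf)).1
    rw [NNReal.coe_one, one_mul] at this
    linarith
  exact le_antisymm (this _ _) (this _ _)

/-- By duality the inequality holds for each test function separately, so no gluing of couplings is
needed. -/
theorem W1_triangle (μ η ρ : P1 d) : W1 μ ρ ≤ W1 μ η + W1 η ρ := by
  rw [← ENNReal.ofReal_toReal (W1_ne_top μ η), ← ENNReal.ofReal_toReal (W1_ne_top η ρ),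
    ← ENNReal.ofReal_add ENNReal.toReal_nonneg ENNReal.toReal_nonneg]
  refine W1_le_of_forall_lipschitz _ _ _ fun f hf => ?_
  have h1 := (abs_le.1 (abs_integral_sub_le_toReal_W1 μ η hf)).2
  have h2 := (abs_le.1 (abs_integral_sub_le_toReal_W1 η ρ hf)).2
  rw [NNReal.coe_one, one_mul] at h1 h2
  linarith

/-- The constant sequence `μ` converges narrowly to `η`, and narrow limits are unique. -/
theorem eq_of_W1_eq_zero {μ η : P1 d} (h : W1 μ η = 0) : μ = η := by
  have : Tendsto (fun _ : ℕ => μ.toProb) atTop (𝓝 η.toProb) :=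
    tendsto_toProb_of_tendsto_W1 (by simp [h])
  exact P1.toProb_injective (tendsto_const_nhds_iff.1 this)

/-- The metric `W₁` on `P₁(ℝ^d)`. -/
instance : EMetricSpace (P1 d) where
  edist := W1
  edist_self := W1_self
  edist_comm := W1_comm
  edist_triangle := W1_triangle
  eq_of_edist_eq_zero := eq_of_W1_eq_zero

instance : MetricSpace (P1 d) := EMetricSpace.toMetricSpace W1_ne_top

theorem edist_eq_W1 (μ η : P1 d) : edist μ η = W1 μ η := rfl

theorem dist_eq_W1 (μ η : P1 d) : dist μ η = (W1 μ η).toReal := rfl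

theorem abs_integral_sub_le_dist (μ η : P1 d) {K : ℝ≥0} {f : E d → ℝ} (hf : LipschitzWith K f) :
    |∫ x, f x ∂μ.toMeasure - ∫ x, f x ∂η.toMeasure| ≤ K * dist μ η :=
  abs_integral_sub_le_toReal_W1 μ η hf

theorem dist_le_of_forall_smooth {μ η : P1 d} {c : ℝ}
    (h : ∀ f : E d → ℝ, ContDiff ℝ ∞ f → LipschitzWith 1 f →
      ∫ x, f x ∂μ.toMeasure - ∫ x, f x ∂η.toMeasure ≤ c) : dist μ η ≤ c := by
  have hc : 0 ≤ c := by simpa using h (fun _ => 0) contDiff_const (LipschitzWith.const' _)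
  rw [dist_eq_W1]
  exact ENNReal.toReal_le_of_le_ofReal hc (W1_le_of_forall_smooth μ η c h)

theorem dist_le_of_forall_lipschitz {μ η : P1 d} {c : ℝ}
    (h : ∀ f : E d → ℝ, LipschitzWith 1 f →
      ∫ x, f x ∂μ.toMeasure - ∫ x, f x ∂η.toMeasure ≤ c) : dist μ η ≤ c :=
  dist_le_of_forall_smooth fun f _ hf => h f hf

theorem continuous_toProb : Continuous (P1.toProb (d := d)) := by
  refine continuous_iff_continuousAt.2 fun μ => ?_
  refine tendsto_toProb_of_tendsto_W1 ?_
  have := tendsto_iff_edist_tendsto_0.1 (tendsto_id (x := 𝓝 μ))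
  exact this

theorem continuous_integral_lipschitz {K : ℝ≥0} {f : E d → ℝ} (hf : LipschitzWith K f) :
    Continuous fun μ : P1 d => ∫ x, f x ∂μ.toMeasure :=
  (LipschitzWith.of_dist_le_mul (K := K) fun μ η => by
    rw [Real.dist_eq]; exact abs_integral_sub_le_dist μ η hf).continuous

theorem Curve.continuous (μ : Curve d) : Continuous μ.toFun :=
  continuous_iff_continuousAt.2 fun s => tendsto_iff_edist_tendsto_0.2 (μ.continuous_toFun s)

/-! ### Truncated moments -/

/-- The smooth substitute `⟨x⟩ = √(1 + |x|²)` for `|x|`. -/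
def bracket (x : E d) : ℝ := √(1 + ‖x‖ ^ 2)

/-- The weight `⟨x⟩ / (R + ⟨x⟩)`, which is small for `|x| ≪ R`. -/
def tailWeight (R : ℝ) (x : E d) : ℝ := bracket x / (R + bracket x)

/-- The truncated moment function `⟨x⟩² / (R + ⟨x⟩)`. -/
def tailMoment (R : ℝ) (x : E d) : ℝ := bracket x ^ 2 / (R + bracket x)

theorem one_le_bracket (x : E d) : 1 ≤ bracket x := by
  rw [bracket, Real.one_le_sqrt]
  nlinarith [norm_nonneg x]

theorem bracket_pos (x : E d) : 0 < bracket x := zero_lt_one.trans_le (one_le_bracket x)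

theorem norm_le_bracket (x : E d) : ‖x‖ ≤ bracket x :=
  Real.le_sqrt_of_sq_le (by linarith)

theorem contDiff_bracket : ContDiff ℝ ∞ (bracket (d := d)) :=
  (contDiff_const.add (contDiff_norm_sq ℝ)).sqrt fun x => by positivity

theorem norm_fderiv_bracket_le (x : E d) : ‖fderiv ℝ (bracket (d := d)) x‖ ≤ 1 := by
  have h1 : HasFDerivAt (fun x : E d => 1 + ‖x‖ ^ 2) (2 • innerSL ℝ x) x :=
    (hasStrictFDerivAt_norm_sq x).hasFDerivAt.const_add 1
  have h2 := h1.sqrt (by positivity)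
  have h3 : HasFDerivAt bracket _ x := h2
  rw [h3.fderiv]
  refine ContinuousLinearMap.opNorm_le_bound _ zero_le_one fun v => ?_
  have hb := bracket_pos x
  have : ((1 / (2 * √(1 + ‖x‖ ^ 2))) • (2 • innerSL ℝ x)) v = inner ℝ x v / bracket x := by
    simp only [smul_apply, innerSL_apply_apply, bracket, smul_eq_mul, nsmul_eq_mul]
    field_simp
    norm_num
  rw [this, norm_div, Real.norm_of_nonneg hb.le, div_le_iff₀ hb]
  calc ‖inner ℝ x v‖ ≤ ‖x‖ * ‖v‖ := norm_inner_le_norm x v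
    _ ≤ bracket x * ‖v‖ := by gcongr; exact norm_le_bracket x
    _ = _ := by ring

theorem tailMoment_zero (x : E d) : tailMoment 0 x = bracket x := by
  have := bracket_pos x
  rw [tailMoment, zero_add]; field_simp

theorem tailWeight_nonneg {R : ℝ} (hR : 0 ≤ R) (x : E d) : 0 ≤ tailWeight R x := by
  have := bracket_pos x
  rw [tailWeight]; positivity

theorem tailWeight_le_one {R : ℝ} (hR : 0 ≤ R) (x : E d) : tailWeight R x ≤ 1 := by
  have := bracket_pos x
  rw [tailWeight, div_le_one (by positivity)]; linarith

theorem tailWeight_le_div {R : ℝ} (hR : 0 < R) (x : E d) : tailWeight R x ≤ bracket x / R := by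
  have := bracket_pos x
  rw [tailWeight]; gcongr; linarith

theorem bracket_mul_tailWeight (R : ℝ) (x : E d) : bracket x * tailWeight R x = tailMoment R x := by
  rw [tailWeight, tailMoment]; ring

theorem tailMoment_nonneg {R : ℝ} (hR : 0 ≤ R) (x : E d) : 0 ≤ tailMoment R x := by
  rw [← bracket_mul_tailWeight]
  exact mul_nonneg (bracket_pos x).le (tailWeight_nonneg hR x)

theorem tailMoment_le_bracket {R : ℝ} (hR : 0 ≤ R) (x : E d) : tailMoment R x ≤ bracket x := by
  rw [← bracket_mul_tailWeight]
  exact mul_le_of_le_one_right (bracket_pos x).le (tailWeight_le_one hR x)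

/-- Here `R ≤ ⟨x⟩`, so the denominator `R + ⟨x⟩` is at most `2⟨x⟩`. Thus the truncated moment
dominates the true tail of the first moment. -/
theorem bracket_le_two_mul_tailMoment {R : ℝ} (hR : 0 ≤ R) {x : E d} (hx : R ≤ ‖x‖) :
    bracket x ≤ 2 * tailMoment R x := by
  have := bracket_pos x
  have h2 := norm_le_bracket x
  rw [tailMoment, ← mul_div_assoc, le_div_iff₀ (by positivity)]
  nlinarith

theorem contDiff_tailMoment {R : ℝ} (hR : 0 ≤ R) : ContDiff ℝ ∞ (tailMoment (d := d) R) :=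
  (contDiff_bracket.pow 2).div (contDiff_const.add contDiff_bracket) fun x => by
    have := bracket_pos x
    positivity

/-- The derivative of `r² / (R + r)` is `(r² + 2Rr) / (R + r)²`, at most `2r / (R + r)`. Multiplied
by a velocity of size `⟨x⟩`, the gradient returns twice the truncated moment itself, which is what
lets Gronwall close. -/
theorem norm_fderiv_tailMoment_le {R : ℝ} (hR : 0 ≤ R) (x : E d) :
    ‖fderiv ℝ (tailMoment (d := d) R) x‖ ≤ 2 * tailWeight R x := by
  have hb := bracket_pos x
  have h1 : HasDerivAt (fun r : ℝ => r ^ 2 / (R + r))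
      ((2 * bracket x * (R + bracket x) - bracket x ^ 2 * 1) / (R + bracket x) ^ 2) (bracket x) := by
    have := ((hasDerivAt_id (bracket x)).pow 2).div ((hasDerivAt_id (bracket x)).const_add R)
      (by simp only [id]; positivity)
    simpa using! this
  have h2 : HasFDerivAt (bracket (d := d)) (fderiv ℝ bracket x) x :=
    ((contDiff_bracket (d := d)).differentiable (by simp) x).hasFDerivAt
  have h3 := h1.comp_hasFDerivAt x h2
  have h4 : HasFDerivAt (tailMoment (d := d) R) _ x := h3
  rw [h4.fderiv, norm_smul]
  have h5 : ‖(2 * bracket x * (R + bracket x) - bracket x ^ 2 * 1) / (R + bracket x) ^ 2‖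
      ≤ 2 * tailWeight R x := by
    rw [Real.norm_of_nonneg (div_nonneg (by nlinarith) (by positivity)), tailWeight,
      div_le_iff₀ (by positivity)]
    have : 2 * (bracket x / (R + bracket x)) * (R + bracket x) ^ 2
        = 2 * bracket x * (R + bracket x) := by field_simp
    nlinarith
  calc _ ≤ 2 * tailWeight R x * 1 := by
        gcongr
        · exact mul_nonneg zero_le_two (tailWeight_nonneg hR x)
        · exact norm_fderiv_bracket_le x
    _ = _ := mul_one _

theorem lipschitzWith_tailMoment {R : ℝ} (hR : 0 ≤ R) :
    LipschitzWith 2 (tailMoment (d := d) R) :=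
  lipschitzWith_of_nnnorm_fderiv_le ((contDiff_tailMoment hR).differentiable (by simp)) fun x => by
    rw [← NNReal.coe_le_coe]
    refine (norm_fderiv_tailMoment_le hR x).trans ?_
    have := tailWeight_le_one hR x
    norm_num
    linarith

theorem P1.integrable_tailMoment (μ : P1 d) {R : ℝ} (hR : 0 ≤ R) :
    Integrable (tailMoment R) μ.toMeasure :=
  μ.integrable_lipschitz (lipschitzWith_tailMoment hR)

theorem P1.integrable_bracket (μ : P1 d) : Integrable bracket μ.toMeasure := by
  simpa [funext tailMoment_zero] using μ.integrable_tailMoment le_rfl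

theorem P1.tendsto_integral_tailMoment (μ : P1 d) :
    Tendsto (fun n : ℕ => ∫ x, tailMoment n x ∂μ.toMeasure) atTop (𝓝 0) := by
  have h := tendsto_integral_of_dominated_convergence (μ := μ.toMeasure)
    (F := fun (n : ℕ) x => tailMoment (n : ℝ) x) (f := fun _ => (0 : ℝ)) bracket
    (fun n => (μ.integrable_tailMoment n.cast_nonneg).aestronglyMeasurable) μ.integrable_bracket
    (fun n => ae_of_all _ fun x => by
      rw [Real.norm_of_nonneg (tailMoment_nonneg n.cast_nonneg x)]
      exact tailMoment_le_bracket n.cast_nonneg x)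
    (ae_of_all _ fun x => by
      refine Tendsto.const_div_atTop ?_ _
      exact tendsto_atTop_add_const_right _ _ tendsto_natCast_atTop_atTop)
  simpa using h

/-! ### Compactness in `P₁` -/

/-- A soft finite partition of space bounds `W₁` by finitely many bounded continuous observables
and the tails of the first moments. -/
theorem exists_observables_dist_le (n : ℕ) {ε : ℝ} (hε : 0 < ε) :
    ∃ (t : Finset (E d)) (χ : E d → BoundedContinuousFunction (E d) ℝ), ∀ μ η : P1 d,
      dist μ η ≤ ∑ a ∈ t, ‖a‖ * |∫ x, χ a x ∂μ.toMeasure - ∫ x, χ a x ∂η.toMeasure| + 4 * ε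
        + 2 * ∫ x, tailMoment n x ∂μ.toMeasure + 2 * ∫ x, tailMoment n x ∂η.toMeasure := by
  obtain ⟨s, -, hs, hcov⟩ := finite_cover_balls_of_compact
    (isCompact_closedBall (0 : E d) (n + 1)) hε
  let t := hs.toFinset
  -- Tents of radius `2ε` around an `ε`-net, and `g₀` for the region `|x| > n`. Their sum `S` is
  -- positive everywhere, so division by it gives a continuous partition of unity.
  let g : E d → E d → ℝ := fun a x => max 0 (2 * ε - dist x a)
  let g₀ : E d → ℝ := fun x => max 0 (‖x‖ - n)
  let S : E d → ℝ := fun x => g₀ x + ∑ a ∈ t, g a x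
  have hg : ∀ a x, 0 ≤ g a x := fun a x => le_max_left _ _
  have hg₀ : ∀ x, 0 ≤ g₀ x := fun x => le_max_left _ _
  have hS : ∀ x, 0 < S x := by
    intro x
    by_cases hx : x ∈ Metric.closedBall (0 : E d) (n + 1)
    · have := hcov hx
      simp only [mem_iUnion, Metric.mem_ball] at this
      obtain ⟨a, ha, hxa⟩ := this
      have h1 : 0 < g a x := lt_max_of_lt_right (by linarith)
      have h2 : g a x ≤ ∑ a ∈ t, g a x :=
        Finset.single_le_sum (f := fun a => g a x) (fun a _ => hg a x) (hs.mem_toFinset.2 ha)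
      have := hg₀ x
      simp only [S]; linarith
    · rw [mem_closedBall_zero_iff, not_le] at hx
      have h1 : 0 < g₀ x := lt_max_of_lt_right (by linarith)
      have h2 : 0 ≤ ∑ a ∈ t, g a x := Finset.sum_nonneg fun a _ => hg a x
      simp only [S]; linarith
  have hgc : ∀ a, Continuous (g a) := fun a => by fun_prop
  have hg₀c : Continuous g₀ := by fun_prop
  have hSc : Continuous S := hg₀c.add (continuous_finsetSum _ fun a _ => hgc a)
  -- The bound `g a ≤ S` needs `a ∈ t`. The value `0` elsewhere does not enter the sum.
  let χ : E d → BoundedContinuousFunction (E d) ℝ := fun a =>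
    if ha : a ∈ t then BoundedContinuousFunction.ofNormedAddCommGroup (fun x => g a x / S x)
      ((hgc a).div hSc fun x => (hS x).ne') 1 (fun x => by
        rw [Real.norm_of_nonneg (div_nonneg (hg a x) (hS x).le), div_le_one (hS x)]
        have h2 : g a x ≤ ∑ a ∈ t, g a x :=
          Finset.single_le_sum (f := fun a => g a x) (fun a _ => hg a x) ha
        have := hg₀ x
        simp only [S]; linarith)
    else 0
  have hχ : ∀ a ∈ t, ∀ x, χ a x = g a x / S x := fun a ha x => by simp [χ, ha]
  refine ⟨t, χ, fun μ η => dist_le_of_forall_lipschitz fun f hf => ?_⟩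
  have hf0 : ∀ x, |f x - f 0| ≤ ‖x‖ := fun x => by simpa [Real.dist_eq] using hf.dist_le_mul x 0
  have hpt : ∀ x, |f x - f 0 - ∑ a ∈ t, (f a - f 0) * χ a x| ≤ 2 * ε + 2 * tailMoment n x := by
    intro x
    have hsum : g₀ x / S x + ∑ a ∈ t, g a x / S x = 1 := by
      rw [← Finset.sum_div, ← add_div, div_self (hS x).ne']
    -- The error splits in two: near a node `f` varies by at most `2ε`, and on the support of `g₀`
    -- the bound `|f x - f 0| ≤ ‖x‖` is absorbed by the truncated moment.
    have e1 : f x - f 0 - ∑ a ∈ t, (f a - f 0) * χ a x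
        = g₀ x / S x * (f x - f 0) + ∑ a ∈ t, g a x / S x * (f x - f a) := by
      have e2 : ∑ a ∈ t, (f a - f 0) * χ a x = ∑ a ∈ t, g a x / S x * (f x - f 0)
          - ∑ a ∈ t, g a x / S x * (f x - f a) := by
        rw [← Finset.sum_sub_distrib]
        refine Finset.sum_congr rfl fun a ha => ?_
        rw [hχ a ha]; ring
      rw [e2, ← Finset.sum_mul]
      linear_combination (f 0 - f x) * hsum
    have hq : ∀ a, 0 ≤ g a x / S x := fun a => div_nonneg (hg a x) (hS x).le
    have hq₀ : 0 ≤ g₀ x / S x := div_nonneg (hg₀ x) (hS x).le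
    have hq1 : ∑ a ∈ t, g a x / S x ≤ 1 := by linarith
    rw [e1]
    refine (abs_add_le _ _).trans ?_
    have b1 : |g₀ x / S x * (f x - f 0)| ≤ 2 * tailMoment n x := by
      rw [abs_mul, abs_of_nonneg hq₀]
      by_cases hx : ‖x‖ ≤ n
      · have : g₀ x = 0 := max_eq_left (by linarith)
        rw [this, zero_div, zero_mul]
        exact mul_nonneg zero_le_two (tailMoment_nonneg n.cast_nonneg x)
      · have h1 := bracket_le_two_mul_tailMoment (n.cast_nonneg : (0 : ℝ) ≤ n) (not_le.1 hx).le
        have h2 : g₀ x / S x ≤ 1 := by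
          have : 0 ≤ ∑ a ∈ t, g a x / S x := Finset.sum_nonneg fun a _ => hq a
          linarith
        calc g₀ x / S x * |f x - f 0| ≤ 1 * ‖x‖ := by
              gcongr
              exact hf0 x
          _ ≤ _ := by rw [one_mul]; exact (norm_le_bracket x).trans h1
    have b2 : |∑ a ∈ t, g a x / S x * (f x - f a)| ≤ 2 * ε := by
      calc _ ≤ ∑ a ∈ t, |g a x / S x * (f x - f a)| := Finset.abs_sum_le_sum_abs _ _
        _ ≤ ∑ a ∈ t, g a x / S x * (2 * ε) := by
            refine Finset.sum_le_sum fun a _ => ?_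
            rw [abs_mul, abs_of_nonneg (hq a)]
            by_cases hxa : dist x a ≤ 2 * ε
            · refine mul_le_mul_of_nonneg_left ?_ (hq a)
              have := hf.dist_le_mul x a
              rw [NNReal.coe_one, one_mul, Real.dist_eq] at this
              exact this.trans hxa
            · have : g a x = 0 := max_eq_left (by linarith)
              simp [this]
        _ ≤ 1 * (2 * ε) := by
            rw [← Finset.sum_mul]
            gcongr
        _ = _ := one_mul _
    linarith
  have hint : ∀ ρ : P1 d, |∫ x, f x ∂ρ.toMeasure - f 0
      - ∑ a ∈ t, (f a - f 0) * ∫ x, χ a x ∂ρ.toMeasure|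
      ≤ 2 * ε + 2 * ∫ x, tailMoment n x ∂ρ.toMeasure := by
    intro ρ
    have hi : ∀ a, Integrable (fun x => (f a - f 0) * χ a x) ρ.toMeasure := fun a =>
      ((χ a).integrable _).const_mul _
    have i1 : Integrable (fun x => f x - f 0) ρ.toMeasure :=
      (ρ.integrable_lipschitz hf).sub (integrable_const _)
    have e1 : ∫ x, f x ∂ρ.toMeasure - f 0 - ∑ a ∈ t, (f a - f 0) * ∫ x, χ a x ∂ρ.toMeasure
        = ∫ x, (f x - f 0 - ∑ a ∈ t, (f a - f 0) * χ a x) ∂ρ.toMeasure := by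
      rw [integral_sub i1 (integrable_finsetSum _ fun a _ => hi a),
        integral_sub (ρ.integrable_lipschitz hf) (integrable_const _),
        integral_finsetSum _ fun a _ => hi a]
      simp [integral_const_mul]
    have i2 := (ρ.integrable_tailMoment (R := n) n.cast_nonneg).const_mul 2
    rw [e1]
    calc _ ≤ ∫ x, (2 * ε + 2 * tailMoment n x) ∂ρ.toMeasure := by
          rw [← Real.norm_eq_abs]
          exact norm_integral_le_of_norm_le ((integrable_const _).add i2) (ae_of_all _ hpt)
      _ = _ := by
          rw [integral_add (integrable_const _) i2]
          simp [integral_const_mul]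
  have h1 := (abs_le.1 (hint μ)).2
  have h2 := (abs_le.1 (hint η)).1
  have h3 : ∑ a ∈ t, (f a - f 0) * ∫ x, χ a x ∂μ.toMeasure
      - ∑ a ∈ t, (f a - f 0) * ∫ x, χ a x ∂η.toMeasure
      ≤ ∑ a ∈ t, ‖a‖ * |∫ x, χ a x ∂μ.toMeasure - ∫ x, χ a x ∂η.toMeasure| := by
    rw [← Finset.sum_sub_distrib]
    refine Finset.sum_le_sum fun a _ => ?_
    rw [← mul_sub]
    refine (le_abs_self _).trans ?_
    rw [abs_mul]
    gcongr
    exact hf0 a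
  linarith

/-- Narrow convergence and uniformly small tails of the first moments give convergence in `W₁`. -/
theorem tendsto_of_tendsto_toProb {μ : ℕ → P1 d} {η : P1 d} {b : ℕ → ℝ}
    (hb : Tendsto b atTop (𝓝 0)) (h : Tendsto (fun k => (μ k).toProb) atTop (𝓝 η.toProb))
    (hμ : ∀ k n, ∫ x, tailMoment (n : ℕ) x ∂(μ k).toMeasure ≤ b n)
    (hη : ∀ n, ∫ x, tailMoment (n : ℕ) x ∂η.toMeasure ≤ b n) :
    Tendsto μ atTop (𝓝 η) := by
  rw [Metric.tendsto_nhds]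
  intro ε hε
  obtain ⟨n, hn⟩ := (hb.eventually_lt_const (show 0 < ε / 16 by positivity)).exists
  obtain ⟨t, χ, hχ⟩ := exists_observables_dist_le (d := d) n (show 0 < ε / 16 by positivity)
  have hlim : Tendsto (fun k => ∑ a ∈ t, ‖a‖ *
      |∫ x, χ a x ∂(μ k).toMeasure - ∫ x, χ a x ∂η.toMeasure|) atTop (𝓝 0) := by
    rw [← Finset.sum_const_zero (s := t)]
    refine tendsto_finsetSum _ fun a _ => ?_
    rw [ProbabilityMeasure.tendsto_iff_forall_integral_tendsto] at h
    have := ((h (χ a)).sub_const (∫ x, χ a x ∂η.toMeasure)).abs.const_mul ‖a‖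
    simpa using this
  filter_upwards [hlim.eventually_lt_const (show 0 < ε / 4 by positivity)] with k hk
  have := hχ (μ k) η
  have h1 := hμ k n
  have h2 := hη n
  linarith

/-- Markov's inequality gives tightness, Prokhorov a narrow limit, and lower semicontinuity passes
the tail bounds to that limit. With uniform tails, narrow convergence improves to `W₁`. -/
theorem isCompact_setOf_integral_tailMoment_le {b : ℕ → ℝ} (hb : Tendsto b atTop (𝓝 0)) :
    IsCompact {μ : P1 d | ∀ n : ℕ, ∫ x, tailMoment n x ∂μ.toMeasure ≤ b n} := by
  rw [isCompact_iff_isSeqCompact]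
  intro μ hμ
  have hcomp := isCompact_setOfPred_probabilityMeasure_mass_eq_compl_isCompact_le
    (E := E d) (u := fun n => (2 * b n).toNNReal) (K := fun n => Metric.closedBall 0 n)
    (by simpa using tendsto_real_toNNReal (hb.const_mul 2))
    (fun n => isCompact_closedBall _ _) (Or.inl inferInstance)
  have hmem : ∀ k, (μ k).toProb ∈ {p : ProbabilityMeasure (E d) |
      ∀ n : ℕ, p (Metric.closedBall 0 (n : ℝ))ᶜ ≤ (2 * b n).toNNReal} := by
    intro k n
    have h1 : (μ k).toMeasure.real (Metric.closedBall 0 (n : ℝ))ᶜ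
        ≤ ∫ x, 2 * tailMoment (n : ℝ) x ∂(μ k).toMeasure := by
      rw [← integral_indicator_one Metric.isClosed_closedBall.measurableSet.compl]
      refine integral_mono ((integrable_const (1 : ℝ)).indicator
        Metric.isClosed_closedBall.measurableSet.compl)
        (((μ k).integrable_tailMoment n.cast_nonneg).const_mul 2) fun x => ?_
      by_cases hx : ‖x‖ ≤ n
      · rw [indicator_of_notMem (by simpa using hx)]
        exact mul_nonneg zero_le_two (tailMoment_nonneg n.cast_nonneg x)
      · rw [indicator_of_mem (by simpa using hx)]
        exact (one_le_bracket x).trans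
          (bracket_le_two_mul_tailMoment n.cast_nonneg (not_le.1 hx).le)
    rw [integral_const_mul] at h1
    rw [← NNReal.coe_le_coe]
    refine le_trans ?_ (Real.le_coe_toNNReal _)
    have h2 := hμ k n
    change (μ k).toMeasure.real _ ≤ _
    linarith
  obtain ⟨p, -, φ, hφ, hlim⟩ := hcomp.isSeqCompact hmem
  have hopen : ∀ G, IsOpen G → (p : Measure (E d)) G
      ≤ atTop.liminf fun k => ((μ (φ k)).toProb : Measure (E d)) G := fun G hG =>
    ProbabilityMeasure.le_liminf_measure_open_of_tendsto hlim hG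
  have hlsc : ∀ n : ℕ, ∫⁻ x, ENNReal.ofReal (tailMoment n x) ∂(p : Measure (E d))
      ≤ ENNReal.ofReal (b n) := by
    intro n
    refine (lintegral_le_liminf_lintegral_of_forall_isOpen_measure_le_liminf_measure
      (contDiff_tailMoment n.cast_nonneg).continuous
      (fun x => tailMoment_nonneg n.cast_nonneg x) hopen).trans ?_
    refine Filter.liminf_le_of_le (by isBoundedDefault) fun c hc => ?_
    obtain ⟨k, hk⟩ := hc.exists
    refine hk.trans ?_
    rw [P1.coe_toProb, ← ofReal_integral_eq_lintegral_ofReal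
      ((μ (φ k)).integrable_tailMoment n.cast_nonneg)
      (ae_of_all _ fun x => tailMoment_nonneg n.cast_nonneg x)]
    exact ENNReal.ofReal_le_ofReal (hμ (φ k) n)
  -- At `n = 0` the truncated moment is `⟨x⟩`, so the limit has a finite first moment.
  let η : P1 d := ⟨p, inferInstance, by
    refine lt_of_le_of_lt (lintegral_mono fun x => ?_)
      ((hlsc 0).trans_lt ENNReal.ofReal_lt_top)
    rw [Nat.cast_zero, tailMoment_zero, ← ofReal_norm]
    exact ENNReal.ofReal_le_ofReal (norm_le_bracket x)⟩
  have hη : ∀ n : ℕ, ∫ x, tailMoment n x ∂η.toMeasure ≤ b n := by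
    intro n
    have hbn : 0 ≤ b n := (integral_nonneg fun x => tailMoment_nonneg n.cast_nonneg x).trans (hμ 0 n)
    rw [← ENNReal.ofReal_le_ofReal_iff hbn, ofReal_integral_eq_lintegral_ofReal
      (η.integrable_tailMoment n.cast_nonneg)
      (ae_of_all _ fun x => tailMoment_nonneg n.cast_nonneg x)]
    exact hlsc n
  exact ⟨η, hη, φ, hφ, tendsto_of_tendsto_toProb hb hlim (fun k n => hμ (φ k) n) hη⟩

/-! ### Weak derivatives on an interval -/

/-- A continuous function on `[0,1]` that is orthogonal to the derivatives of all test functions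
is constant. -/
theorem exists_eq_const_of_weak_deriv_eq_zero {f : ℝ → ℝ} (hf : ContinuousOn f (Icc 0 1))
    (h : ∀ θ : ℝ → ℝ, ContDiff ℝ ∞ θ → HasCompactSupport θ → tsupport θ ⊆ Ioo 0 1 →
      ∫ t in (0 : ℝ)..1, deriv θ t * f t = 0) :
    ∃ c, ∀ t ∈ Icc (0 : ℝ) 1, f t = c := by
  let b : ContDiffBump (1 / 2 : ℝ) := ⟨1 / 8, 1 / 4, by norm_num, by norm_num⟩
  let ρ₀ : ℝ → ℝ := b.normed volume
  have hρ₀ : ContDiff ℝ ∞ ρ₀ := b.contDiff_normed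
  have hρ₀c : HasCompactSupport ρ₀ := b.hasCompactSupport_normed
  have hρ₀s : tsupport ρ₀ ⊆ Ioo 0 1 := by
    rw [b.tsupport_normed_eq, Real.closedBall_eq_Icc]
    intro x hx
    exact ⟨by linarith [hx.1, show (b.rOut : ℝ) = 1 / 4 from rfl],
      by linarith [hx.2, show (b.rOut : ℝ) = 1 / 4 from rfl]⟩
  have hρ₀i : ∫ t, ρ₀ t = 1 := b.integral_normed
  let c := ∫ t in (0 : ℝ)..1, ρ₀ t * f t
  refine ⟨c, ?_⟩
  have hfi : ∀ ρ : ℝ → ℝ, Continuous ρ →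
      IntervalIntegrable (fun t => ρ t * f t) volume 0 1 := fun ρ hρ =>
    ContinuousOn.intervalIntegrable (by
      rw [uIcc_of_le zero_le_one]; exact hρ.continuousOn.mul hf)
  have hfull : ∀ ρ : ℝ → ℝ, tsupport ρ ⊆ Ioo 0 1 → ∀ k : ℝ → ℝ,
      ∫ t in (0 : ℝ)..1, ρ t * k t = ∫ t, ρ t * k t := fun ρ hρ k =>
    intervalIntegral.integral_eq_integral_of_support_subset
      (((Function.support_mul_subset_left _ _).trans (subset_tsupport ρ)).trans
        (hρ.trans Ioo_subset_Ioc_self))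
  have key : ∀ ρ : ℝ → ℝ, ContDiff ℝ ∞ ρ → HasCompactSupport ρ → tsupport ρ ⊆ Ioo 0 1 →
      ∫ t in (0 : ℝ)..1, ρ t * f t = (∫ t, ρ t) * c := by
    intro ρ hρ hρc hρs
    -- A multiple of `ρ₀` is subtracted to reach mean zero. The primitive of `ρ₁` then has compact
    -- support and is an admissible test function.
    let ρ₁ : ℝ → ℝ := fun t => ρ t - (∫ t, ρ t) * ρ₀ t
    have hρ₁ : ContDiff ℝ ∞ ρ₁ := hρ.sub (contDiff_const.mul hρ₀)
    have hρ₁i : ∫ t, ρ₁ t = 0 := by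
      rw [integral_sub (hρ.continuous.integrable_of_hasCompactSupport hρc)
        ((hρ₀.continuous.integrable_of_hasCompactSupport hρ₀c).const_mul _), integral_const_mul,
        hρ₀i, mul_one, sub_self]
    -- The point `1/2` only makes the set nonempty, so that it has a least and a greatest element in
    -- `(0,1)`.
    have hcomp : IsCompact (tsupport ρ ∪ tsupport ρ₀ ∪ {1 / 2}) :=
      (hρc.isCompact.union hρ₀c.isCompact).union isCompact_singleton
    obtain ⟨a₀, ha₀, ha₁⟩ := hcomp.exists_isLeast ⟨1 / 2, Or.inr rfl⟩
    obtain ⟨b₀, hb₀, hb₁⟩ := hcomp.exists_isGreatest ⟨1 / 2, Or.inr rfl⟩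
    have hsub : tsupport ρ ∪ tsupport ρ₀ ∪ {1 / 2} ⊆ Ioo (0 : ℝ) 1 :=
      union_subset (union_subset hρs hρ₀s) (by
        rw [singleton_subset_iff]; constructor <;> norm_num)
    have ha := hsub ha₀
    have hb := hsub hb₀
    have hρ₁z : ∀ t, t ∉ Icc a₀ b₀ → ρ₁ t = 0 := by
      intro t ht
      have h1 : t ∉ tsupport ρ := fun h' => ht ⟨ha₁ (Or.inl (Or.inl h')), hb₁ (Or.inl (Or.inl h'))⟩
      have h2 : t ∉ tsupport ρ₀ := fun h' => ht ⟨ha₁ (Or.inl (Or.inr h')), hb₁ (Or.inl (Or.inr h'))⟩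
      simp [ρ₁, image_eq_zero_of_notMem_tsupport h1, image_eq_zero_of_notMem_tsupport h2]
    let θ : ℝ → ℝ := fun t => ∫ s in (0 : ℝ)..t, ρ₁ s
    have hθd : ∀ t, HasDerivAt θ (ρ₁ t) t := fun t =>
      intervalIntegral.integral_hasDerivAt_right (hρ₁.continuous.intervalIntegrable _ _)
        (hρ₁.continuous.stronglyMeasurableAtFilter _ _) hρ₁.continuous.continuousAt
    have hθ' : deriv θ = ρ₁ := funext fun t => (hθd t).deriv
    have hθ : ContDiff ℝ ∞ θ := by
      rw [contDiff_infty_iff_deriv, hθ']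
      exact ⟨fun t => (hθd t).differentiableAt, hρ₁⟩
    have hθz : ∀ t, t ∉ Icc a₀ b₀ → θ t = 0 := by
      intro t ht
      by_cases hta : t < a₀
      · refine (intervalIntegral.integral_congr (g := fun _ => 0) fun s hs => hρ₁z s fun hs' => ?_).trans
          (by simp)
        rcases mem_uIcc.1 hs with h1 | h1
        · linarith [hs'.1, h1.2]
        · linarith [hs'.1, h1.2, ha.1]
      · have htb : b₀ < t := by
          by_contra h'
          exact ht ⟨not_lt.1 hta, not_lt.1 h'⟩
        have : θ t = ∫ s, ρ₁ s := by
          refine intervalIntegral.integral_eq_integral_of_support_subset fun s hs => ?_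
          have : s ∈ Icc a₀ b₀ := by
            by_contra h'
            exact hs (hρ₁z s h')
          exact ⟨by linarith [this.1, ha.1], by linarith [this.2]⟩
        rw [this, hρ₁i]
    have hθs : tsupport θ ⊆ Icc a₀ b₀ := by
      refine closure_minimal (fun t ht => ?_) isClosed_Icc
      by_contra h'
      exact ht (hθz t h')
    have h1 := h θ hθ (HasCompactSupport.intro isCompact_Icc fun t ht => hθz t ht)
      (hθs.trans fun t ht => ⟨ha.1.trans_le ht.1, ht.2.trans_lt hb.2⟩)
    rw [hθ'] at h1
    have h2 : ∫ t in (0 : ℝ)..1, ρ₁ t * f t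
        = (∫ t in (0 : ℝ)..1, ρ t * f t) - (∫ t, ρ t) * c := by
      rw [← intervalIntegral.integral_const_mul, ← intervalIntegral.integral_sub
        (hfi ρ hρ.continuous) ((hfi ρ₀ hρ₀.continuous).const_mul _)]
      refine intervalIntegral.integral_congr fun t _ => ?_
      simp only [ρ₁]; ring
    linarith
  -- Fundamental lemma of the calculus of variations. Continuity then extends the equality to all of
  -- `[0,1]`.
  have hae : ∀ᵐ t : ℝ, t ∈ Ioo (0 : ℝ) 1 → f t - c = 0 := by
    refine isOpen_Ioo.ae_eq_zero_of_integral_contDiff_smul_eq_zero ?_ fun ρ hρ hρc hρs => ?_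
    · exact ((hf.mono Ioo_subset_Icc_self).sub continuousOn_const).locallyIntegrableOn
        measurableSet_Ioo
    · have h1 := key ρ hρ hρc hρs
      simp only [smul_eq_mul]
      rw [← hfull ρ hρs]
      have h2 : ∫ t in (0 : ℝ)..1, ρ t * (f t - c)
          = (∫ t in (0 : ℝ)..1, ρ t * f t) - ∫ t in (0 : ℝ)..1, ρ t * c := by
        have hi : IntervalIntegrable (fun t => ρ t * c) volume 0 1 :=
          (hρ.continuous.mul continuous_const).intervalIntegrable _ _
        rw [← intervalIntegral.integral_sub (hfi ρ hρ.continuous) hi]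
        simp only [mul_sub]
      rw [h2, h1, hfull ρ hρs fun _ => c, integral_mul_const, sub_self]
  have := Measure.eqOn_Icc_of_ae_eq (volume : Measure ℝ) zero_ne_one (f := f) (g := fun _ => c) (by
    rw [Filter.EventuallyEq, ae_restrict_iff' measurableSet_Icc]
    have h0 : ∀ᵐ t : ℝ, t ≠ 0 := by simp [ae_iff]
    have h1 : ∀ᵐ t : ℝ, t ≠ 1 := by simp [ae_iff]
    filter_upwards [hae, h0, h1] with t ht ht0 ht1 htI
    exact sub_eq_zero.1 (ht ⟨lt_of_le_of_ne htI.1 (Ne.symm ht0), lt_of_le_of_ne htI.2 ht1⟩))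
    hf continuousOn_const
  exact this

/-- A continuous function on `[0,1]` with integrable weak derivative `g` is a primitive of `g`. -/
theorem sub_eq_integral_of_weak_deriv {f g : ℝ → ℝ} (hf : ContinuousOn f (Icc 0 1))
    (hg : IntervalIntegrable g volume 0 1)
    (h : ∀ θ : ℝ → ℝ, ContDiff ℝ ∞ θ → HasCompactSupport θ → tsupport θ ⊆ Ioo 0 1 →
      (∫ t in (0 : ℝ)..1, deriv θ t * f t) + ∫ t in (0 : ℝ)..1, θ t * g t = 0)
    {s t : ℝ} (hs : s ∈ Icc (0 : ℝ) 1) (ht : t ∈ Icc (0 : ℝ) 1) :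
    f t - f s = ∫ r in s..t, g r := by
  -- `f - G` has zero weak derivative: integration by parts for the absolutely continuous `G`
  -- supplies the term in `g`.
  let G : ℝ → ℝ := fun t => ∫ r in (0 : ℝ)..t, g r
  have hGac : AbsolutelyContinuousOnInterval G 0 1 :=
    hg.absolutelyContinuousOnInterval_intervalIntegral (by simp)
  have hGc : ContinuousOn G (Icc 0 1) := by
    have := hGac.continuousOn
    rwa [uIcc_of_le zero_le_one] at this
  have hG' : ∀ᵐ t : ℝ, t ∈ uIcc (0 : ℝ) 1 → deriv G t = g t := by
    filter_upwards [hg.ae_hasDerivAt_integral] with t ht htI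
    exact (ht htI 0 (by simp)).deriv
  obtain ⟨c, hc⟩ := exists_eq_const_of_weak_deriv_eq_zero (hf.sub hGc) fun θ hθ hθc hθs => by
    obtain ⟨K, hK⟩ := hθ.lipschitzWith_of_hasCompactSupport hθc (by simp)
    have h1 := (hK.lipschitzOnWith (s := uIcc 0 1)).absolutelyContinuousOnInterval
      |>.integral_mul_deriv_eq_deriv_mul hGac
    have z0 : θ 0 = 0 := image_eq_zero_of_notMem_tsupport fun h' => lt_irrefl _ (hθs h').1
    have z1 : θ 1 = 0 := image_eq_zero_of_notMem_tsupport fun h' => lt_irrefl _ (hθs h').2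
    have h2 : ∫ t in (0 : ℝ)..1, θ t * deriv G t = ∫ t in (0 : ℝ)..1, θ t * g t := by
      refine intervalIntegral.integral_congr_ae ?_
      filter_upwards [hG'] with t ht htI
      rw [ht (uIoc_subset_uIcc htI)]
    have h3 := h θ hθ hθc hθs
    rw [h2, z0, z1] at h1
    have hd : Continuous (deriv θ) := hθ.continuous_deriv (by simp)
    have hi : ∀ k : ℝ → ℝ, ContinuousOn k (Icc 0 1) →
        IntervalIntegrable (fun t => deriv θ t * k t) volume 0 1 := fun k hk =>
      ContinuousOn.intervalIntegrable (by
        rw [uIcc_of_le zero_le_one]; exact hd.continuousOn.mul hk)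
    have h4 : ∫ t in (0 : ℝ)..1, deriv θ t * (f - G) t = (∫ t in (0 : ℝ)..1, deriv θ t * f t)
        - ∫ t in (0 : ℝ)..1, deriv θ t * G t := by
      rw [← intervalIntegral.integral_sub (hi f hf) (hi G hGc)]
      refine intervalIntegral.integral_congr fun t _ => ?_
      simp only [Pi.sub_apply]; ring
    rw [h4]
    linarith
  have e1 := hc t ht
  have e2 := hc s hs
  simp only [Pi.sub_apply] at e1 e2
  have hgi : ∀ x ∈ Icc (0 : ℝ) 1, IntervalIntegrable g volume 0 x := fun x hx =>
    hg.mono_set (by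
      rw [uIcc_of_le hx.1, uIcc_of_le zero_le_one]; exact Icc_subset_Icc_right hx.2)
  rw [← intervalIntegral.integral_interval_sub_left (hgi t ht) (hgi s hs)]
  simp only [G] at e1 e2
  linarith

/-! ### Integration against a vector measure with density -/

/-- The variation of `u m` is `|u| m`, so the formula is checked on indicators and extended by
linearity and density in `L¹(|u| m)`. Both sides are continuous there. -/
theorem integral_withDensityᵥ {X F G : Type*} {mX : MeasurableSpace X}
    [NormedAddCommGroup F] [NormedSpace ℝ F] [CompleteSpace F]
    [NormedAddCommGroup G] [NormedSpace ℝ G] (m : Measure X) (B : G →L[ℝ] F →L[ℝ] ℝ)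
    {u : X → F} (hu : Integrable u m) {f : X → G}
    (hf : Integrable f (m.withDensity fun x => ‖u x‖ₑ)) :
    (m.withDensityᵥ u).integral f B = ∫ x, B (f x) (u x) ∂m := by
  have hV := Measure.variation_withDensityᵥ hu
  have hum : AEMeasurable (fun x => ‖u x‖ₑ) m := hu.aestronglyMeasurable.enorm
  have hfin : IsFiniteMeasure (m.withDensity fun x => ‖u x‖ₑ) := ⟨by simpa using! hu.2⟩
  have hsm : ∀ g : X → G, Integrable g (m.withDensity fun x => ‖u x‖ₑ) ↔
      Integrable (fun x => ‖u x‖ • g x) m := by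
    intro g
    rw [integrable_withDensity_iff_integrable_smul₀' hum (ae_of_all _ fun x => by simp)]
    simp only [toReal_enorm]
  have hint : ∀ g : X → G, Integrable g (m.withDensity fun x => ‖u x‖ₑ) →
      Integrable (fun x => B (g x) (u x)) m := by
    intro g hg
    have h1 := (hsm g).1 hg
    -- `g` is measurable only with respect to `|u| m`, so nothing is known where `u = 0`. Moving
    -- `‖u‖` onto `g` gives a function measurable for `m`.
    have h2 : (fun x => B (g x) (u x)) = fun x => B (‖u x‖ • g x) (‖u x‖⁻¹ • u x) := by
      ext x
      rcases eq_or_ne (u x) 0 with h | h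
      · simp [h]
      · simp [h]
    rw [h2]
    refine Integrable.mono' (h1.norm.const_mul ‖B‖) ?_ (ae_of_all _ fun x => ?_)
    · exact B.aestronglyMeasurable_comp₂ h1.aestronglyMeasurable
        (hu.aestronglyMeasurable.norm.aemeasurable.inv.aestronglyMeasurable.smul
          hu.aestronglyMeasurable)
    · refine (B.le_opNorm₂ _ _).trans (mul_le_of_le_one_right (by positivity) ?_)
      rw [norm_smul, norm_inv, norm_norm]
      exact inv_mul_le_one
  refine Integrable.induction (μ := m.withDensity fun x => ‖u x‖ₑ)
    (fun f => (m.withDensityᵥ u).integral f B = ∫ x, B (f x) (u x) ∂m) ?_ ?_ ?_ ?_ hf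
  · intro c s hs _
    have : IsFiniteMeasure ((m.withDensityᵥ u).variation.restrict s) := by rw [hV]; infer_instance
    rw [VectorMeasure.integral_indicator hs, VectorMeasure.setIntegral_const,
      withDensityᵥ_apply hu hs]
    have : (fun x => B (s.indicator (fun _ => c) x) (u x)) = s.indicator fun x => B c (u x) := by
      ext x
      by_cases hx : x ∈ s <;> simp [hx]
    rw [this, integral_indicator hs, (B c).integral_comp_comm hu.integrableOn]
  · intro f g _ hf hg hf' hg'
    have h1 : (m.withDensityᵥ u).Integrable f := by rw [VectorMeasure.Integrable, hV]; exact hf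
    have h2 : (m.withDensityᵥ u).Integrable g := by rw [VectorMeasure.Integrable, hV]; exact hg
    rw [VectorMeasure.integral_add h1 h2, hf', hg', ← integral_add (hint f hf) (hint g hg)]
    simp
  · refine isClosed_eq ?_ ?_
    · have := VectorMeasure.continuous_integral (μ := m.withDensityᵥ u) (B := B)
      rw [hV] at this
      exact this
    · refine (LipschitzWith.of_dist_le_mul (K := ‖B‖₊) fun f g => ?_).continuous
      have hf := L1.integrable_coeFn f
      have hg := L1.integrable_coeFn g
      rw [Real.dist_eq, ← integral_sub (hint _ hf) (hint _ hg), L1.dist_eq_integral_dist,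
        integral_withDensity_eq_integral_toReal_smul₀ hum (ae_of_all _ fun x => by simp),
        ← integral_const_mul, ← Real.norm_eq_abs]
      refine norm_integral_le_of_norm_le ?_ (ae_of_all _ fun x => ?_)
      · have := ((hsm _).1 (hf.sub hg)).norm.const_mul ‖B‖
        refine this.congr (ae_of_all _ fun x => ?_)
        simp [norm_smul, dist_eq_norm]
      · have h1 := B.le_opNorm₂ (f x - g x) (u x)
        simp only [map_sub, sub_apply] at h1
        simpa [dist_eq_norm, mul_comm, mul_assoc, mul_left_comm] using h1
  · intro f g hfg hf hf'
    rw [← hV] at hfg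
    rw [← VectorMeasure.integral_congr_ae hfg, hf']
    rw [hV, Filter.EventuallyEq, ae_withDensity_iff' hum] at hfg
    refine integral_congr_ae ?_
    filter_upwards [hfg] with x hx
    rcases eq_or_ne (u x) 0 with h | h
    · simp [h]
    · rw [hx (by simpa using h)]

/-- The pairing of a bounded vector field with a momentum with density. -/
theorem Momentum.pair_withDensityᵥ {U : Submodule ℝ (E d)} {m : Measure (E d × I)}
    {u : E d × I → U} (hu : Integrable u m) {f : E d × I → E d} (hf : Measurable f) {C : ℝ}
    (hC : ∀ x, ‖f x‖ ≤ C) :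
    Momentum.pair f (m.withDensityᵥ u) = ∫ x, inner ℝ (f x) (u x : E d) ∂m := by
  have hfin : IsFiniteMeasure (m.withDensity fun x => ‖u x‖ₑ) := ⟨by simpa using! hu.2⟩
  have := integral_withDensityᵥ m (dot U) hu
    (Integrable.of_bound hf.aestronglyMeasurable C (ae_of_all _ hC))
  simpa [Momentum.pair, dot, ContinuousLinearMap.bilinearComp_apply] using! this

/-! ### The space-time measure of a curve -/

/-- Closed sets form a generating π-system, and by the portmanteau theorem their mass is upper
semicontinuous along a continuous curve. -/
theorem P1.measurable_toMeasure_comp {ι : Type*} [MeasurableSpace ι] [TopologicalSpace ι]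
    [OpensMeasurableSpace ι] {μ : ι → P1 d} (hμ : Continuous μ) :
    Measurable fun t => (μ t).toMeasure := by
  refine Measurable.measure_of_isPiSystem_of_isProbabilityMeasure
    (S := {s : Set (E d) | IsClosed s}) ?_ isPiSystem_isClosed fun s hs => ?_
  · rw [BorelSpace.measurable_eq (α := E d), borel_eq_generateFrom_isClosed]
  · refine UpperSemicontinuous.measurable fun t c hc => ?_
    have := ProbabilityMeasure.limsup_measure_closed_le_of_tendsto
      ((continuous_toProb.comp hμ).tendsto t) hs
    exact Filter.eventually_lt_of_limsup_lt (this.trans_lt hc)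

/-- A curve in `P₁(ℝ^d)` as a Markov kernel. -/
def Curve.kernel (μ : Curve d) : ProbabilityTheory.Kernel I (E d) :=
  ⟨fun t => (μ t).toMeasure, P1.measurable_toMeasure_comp μ.continuous⟩

instance (μ : Curve d) : ProbabilityTheory.IsMarkovKernel μ.kernel :=
  ⟨fun t => (μ t).isProbabilityMeasure⟩

/-- This form gives access to Fubini for Markov kernels. The swap is there because time is the first
factor of a composition-product. -/
theorem Curve.spaceTime_eq (μ : Curve d) :
    μ.spaceTime = ((volume : Measure I).compProd μ.kernel).map Prod.swap := by
  have hm : Measurable fun t => (μ t).toMeasure.map fun y => (y, t) := by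
    refine Measure.measurable_of_measurable_coe _ fun s hs => ?_
    have : (fun t => ((μ t).toMeasure.map fun y => (y, t)) s)
        = fun t => μ.kernel t (Prod.mk t ⁻¹' (Prod.swap ⁻¹' s)) := by
      ext t
      rw [Measure.map_apply (by fun_prop) hs]
      rfl
    rw [this]
    exact ProbabilityTheory.Kernel.measurable_kernel_prodMk_left (measurable_swap hs)
  ext s hs
  rw [Curve.spaceTime, Measure.bind_apply hs hm.aemeasurable, Measure.map_apply measurable_swap hs,
    Measure.compProd_apply (measurable_swap hs)]
  refine lintegral_congr fun t => ?_
  rw [Measure.map_apply (by fun_prop) hs]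
  rfl

instance (μ : Curve d) : IsProbabilityMeasure μ.spaceTime := by
  rw [μ.spaceTime_eq]
  exact Measure.isProbabilityMeasure_map measurable_swap.aemeasurable

theorem Curve.lintegral_spaceTime (μ : Curve d) {f : E d × I → ℝ≥0∞} (hf : Measurable f) :
    ∫⁻ p, f p ∂μ.spaceTime = ∫⁻ t, ∫⁻ y, f (y, t) ∂(μ t).toMeasure := by
  rw [μ.spaceTime_eq, lintegral_map hf measurable_swap]
  exact Measure.lintegral_compProd (hf.comp measurable_swap)

theorem Curve.integrable_swap (μ : Curve d) {F : Type*} [NormedAddCommGroup F] {f : E d × I → F}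
    (hf : Integrable f μ.spaceTime) :
    Integrable (f ∘ Prod.swap) ((volume : Measure I).compProd μ.kernel) := by
  rw [μ.spaceTime_eq] at hf
  exact hf.comp_measurable measurable_swap

theorem Curve.integral_spaceTime (μ : Curve d) {f : E d × I → ℝ}
    (hf : Integrable f μ.spaceTime) :
    ∫ p, f p ∂μ.spaceTime = ∫ t, ∫ y, f (y, t) ∂(μ t).toMeasure := by
  have h1 := μ.integrable_swap hf
  rw [μ.spaceTime_eq] at hf ⊢
  rw [integral_map measurable_swap.aemeasurable hf.aestronglyMeasurable]
  exact Measure.integral_compProd h1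

theorem Curve.integrable_integral (μ : Curve d) {f : E d × I → ℝ}
    (hf : Integrable f μ.spaceTime) :
    Integrable fun t => ∫ y, f (y, t) ∂(μ t).toMeasure := by
  simpa using! MeasureTheory.Integrable.integral_compProd (μ.integrable_swap hf)

theorem Curve.ae_integrable (μ : Curve d) {F : Type*} [NormedAddCommGroup F] {f : E d × I → F}
    (hf : Integrable f μ.spaceTime) :
    ∀ᵐ t : I, Integrable (fun y => f (y, t)) (μ t).toMeasure :=
  ((Measure.integrable_compProd_iff (μ.integrable_swap hf).aestronglyMeasurable).1
    (μ.integrable_swap hf)).1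

/-! ### Integrals over the unit interval -/

theorem integral_IccExtend (h : I → ℝ) :
    ∫ r in (0 : ℝ)..1, IccExtend zero_le_one h r = ∫ t, h t := by
  have := unitInterval.measurePreserving_coe.integral_comp unitInterval.measurableEmbedding_coe
    (IccExtend zero_le_one h)
  simp only [IccExtend_val] at this
  rw [this, intervalIntegral.integral_of_le zero_le_one, integral_Icc_eq_integral_Ioc]

theorem intervalIntegrable_IccExtend {h : I → ℝ} (hh : Integrable h) :
    IntervalIntegrable (IccExtend zero_le_one h) volume 0 1 := by
  rw [intervalIntegrable_iff_integrableOn_Icc_of_le zero_le_one]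
  refine (unitInterval.measurePreserving_coe.integrable_comp_emb
    unitInterval.measurableEmbedding_coe).1 ?_
  refine hh.congr (ae_of_all _ fun t => ?_)
  simp

theorem intervalIntegrable_IccExtend' {h : I → ℝ} (hh : Integrable h) (s t : I) :
    IntervalIntegrable (IccExtend zero_le_one h) volume s t :=
  (intervalIntegrable_IccExtend hh).mono_set (by
    rw [uIcc_of_le zero_le_one]
    exact uIcc_subset_Icc s.2 t.2)

theorem ae_IccExtend {p : I → ℝ → Prop} (h : ∀ᵐ t : I, p t t) :
    ∀ᵐ r : ℝ, r ∈ Icc (0 : ℝ) 1 → p (projIcc 0 1 zero_le_one r) r := by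
  have h1 : ∀ᵐ r ∂((volume : Measure ℝ).restrict I), p (projIcc 0 1 zero_le_one r) r := by
    rw [← unitInterval.measurePreserving_coe.map_eq,
      unitInterval.measurableEmbedding_coe.ae_map_iff]
    filter_upwards [h] with t ht
    simpa using ht
  exact (ae_restrict_iff' measurableSet_Icc).1 h1

theorem integral_IccExtend_mono {f g : I → ℝ} (hf : Integrable f) (hg : Integrable g)
    (h : ∀ᵐ t, f t ≤ g t) {s t : I} (hst : s ≤ t) :
    ∫ r in (s : ℝ)..t, IccExtend zero_le_one f r ≤ ∫ r in (s : ℝ)..t, IccExtend zero_le_one g r := by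
  refine intervalIntegral.integral_mono_ae_restrict hst (intervalIntegrable_IccExtend' hf s t)
    (intervalIntegrable_IccExtend' hg s t) ?_
  rw [Filter.EventuallyLE, ae_restrict_iff' measurableSet_Icc]
  filter_upwards [ae_IccExtend (p := fun t _ => f t ≤ g t) h] with r hr hrI
  exact hr ⟨s.2.1.trans hrI.1, hrI.2.trans t.2.2⟩

theorem integral_IccExtend_le {f : I → ℝ} (hf : Integrable f) (h : ∀ᵐ t, 0 ≤ f t) {s t : I}
    (hst : s ≤ t) : ∫ r in (s : ℝ)..t, IccExtend zero_le_one f r ≤ ∫ t, f t := by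
  rw [← integral_IccExtend]
  refine intervalIntegral.integral_mono_interval s.2.1 hst t.2.2 ?_
    (intervalIntegrable_IccExtend hf)
  rw [Filter.EventuallyLE, ae_restrict_iff' measurableSet_Ioc]
  filter_upwards [ae_IccExtend (p := fun t _ => 0 ≤ f t) h] with r hr hrI
  exact hr ⟨hrI.1.le, hrI.2⟩

/-! ### The vector field along a curve -/

theorem IsAdmissibleField.uniformContinuous {F : E d → P1 d → E d} (hF : IsAdmissibleField F) :
    UniformContinuous fun p : E d × P1 d => F p.1 p.2 := by
  rw [Metric.uniformContinuous_iff]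
  intro ε hε
  obtain ⟨δ, hδ, h⟩ := hF.1 ε hε
  refine ⟨δ, hδ, fun a b hab => h _ _ _ _ ?_ ?_⟩
  · exact (le_max_left _ _).trans_lt hab
  · rw [← edist_eq_W1, edist_lt_ofReal]
    exact (le_max_right _ _).trans_lt hab

/-- A bound on the moment turns linear growth into a multiple of `⟨y⟩` alone, with a constant
uniform over such measures. -/
theorem IsAdmissibleField.exists_growth {F : E d → P1 d → E d} (hF : IsAdmissibleField F) (M : ℝ) :
    ∃ D, 0 ≤ D ∧ ∀ (μ : P1 d), ∫ x, bracket x ∂μ.toMeasure ≤ M →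
      ∀ y, ‖F y μ‖ ≤ D * bracket y := by
  obtain ⟨-, C, C', hC, hC', h⟩ := hF
  refine ⟨C + C' * (1 + |M|), by positivity, fun μ hμ y => (h y μ).trans ?_⟩
  have h1 : ∫ z, ‖z‖ ∂μ.toMeasure ≤ |M| :=
    (integral_mono μ.integrable_norm μ.integrable_bracket norm_le_bracket).trans
      (hμ.trans (le_abs_self M))
  have h2 := norm_le_bracket y
  have h3 := one_le_bracket y
  have h4 : |M| ≤ |M| * bracket y := le_mul_of_one_le_right (abs_nonneg _) h3
  calc C + C' * (‖y‖ + ∫ z, ‖z‖ ∂μ.toMeasure)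
      ≤ C * bracket y + C' * (bracket y + |M| * bracket y) := by
        gcongr
        · exact le_mul_of_one_le_right hC h3
        · exact h1.trans h4
    _ = _ := by ring

theorem Curve.continuous_integral (μ : Curve d) {K : ℝ≥0} {f : E d → ℝ} (hf : LipschitzWith K f) :
    Continuous fun t => ∫ x, f x ∂(μ t).toMeasure :=
  (continuous_integral_lipschitz hf).comp μ.continuous

theorem lipschitzWith_bracket : LipschitzWith 2 (bracket (d := d)) := by
  simpa [funext tailMoment_zero] using lipschitzWith_tailMoment (d := d) le_rfl

theorem Curve.exists_bracket_le (μ : Curve d) :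
    ∃ M, ∀ t, ∫ x, bracket x ∂(μ t).toMeasure ≤ M := by
  obtain ⟨M, hM⟩ := isCompact_univ.exists_bound_of_continuousOn
    (μ.continuous_integral lipschitzWith_bracket).continuousOn
  exact ⟨M, fun t => (le_abs_self _).trans (hM t (mem_univ t))⟩

theorem Curve.integrable_of_le_bracket (μ : Curve d) {f : E d × I → ℝ}
    (hf : AEStronglyMeasurable f μ.spaceTime) {C : ℝ} (h : ∀ p, ‖f p‖ ≤ C * bracket p.1) :
    Integrable f μ.spaceTime := by
  refine Integrable.mono' (g := fun p => C * bracket p.1) (Integrable.const_mul ?_ _) hf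
    (ae_of_all _ h)
  obtain ⟨M, hM⟩ := μ.exists_bracket_le
  have hc : Continuous fun p : E d × I => bracket p.1 := contDiff_bracket.continuous.comp continuous_fst
  refine ⟨hc.aestronglyMeasurable, ?_⟩
  rw [hasFiniteIntegral_iff_ofReal (ae_of_all _ fun p => (bracket_pos _).le),
    μ.lintegral_spaceTime hc.measurable.ennreal_ofReal]
  calc ∫⁻ t : I, ∫⁻ y, ENNReal.ofReal (bracket y) ∂(μ t).toMeasure
      ≤ ∫⁻ _ : I, ENNReal.ofReal M := by
        refine lintegral_mono fun t => ?_
        rw [← ofReal_integral_eq_lintegral_ofReal (μ t).integrable_bracket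
          (ae_of_all _ fun p => (bracket_pos _).le)]
        exact ENNReal.ofReal_le_ofReal (hM t)
    _ < ⊤ := by simp

theorem Curve.integrable_fst_lipschitz (μ : Curve d) {K : ℝ≥0} {f : E d → ℝ}
    (hf : LipschitzWith K f) : Integrable (fun p => f p.1) μ.spaceTime := by
  refine μ.integrable_of_le_bracket (hf.continuous.comp continuous_fst).aestronglyMeasurable
    (C := |f 0| + K) fun p => ?_
  have h1 := hf.dist_le_mul p.1 0
  rw [dist_zero_right, Real.dist_eq] at h1
  have h2 := abs_sub_abs_le_abs_sub (f p.1) (f 0)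
  have h3 := mul_le_mul_of_nonneg_left (norm_le_bracket p.1) K.2
  have h4 := le_mul_of_one_le_right (abs_nonneg (f 0)) (one_le_bracket p.1)
  rw [Real.norm_eq_abs, add_mul]
  simp only [NNReal.val_eq_coe] at h3
  linarith

namespace Problem

variable (P : Problem d)

/-- The velocity `F(y, μ_t) + u(y, t)` of the controlled dynamics. -/
def velocity (μ : Curve d) (u : E d × I → P.U) (p : E d × I) : E d := P.F p.1 (μ p.2) + u p

variable {P}

theorem continuous_field (hF : IsAdmissibleField P.F) (μ : Curve d) :
    Continuous fun p : E d × I => P.F p.1 (μ p.2) :=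
  hF.uniformContinuous.continuous.comp
    (continuous_fst.prodMk (μ.continuous.comp continuous_snd))

theorem integrable_velocity (hF : IsAdmissibleField P.F) {μ : Curve d} {u : E d × I → P.U}
    (hu : Integrable u μ.spaceTime) : Integrable (P.velocity μ u) μ.spaceTime := by
  refine Integrable.add ?_ (P.U.subtypeL.integrable_comp hu)
  obtain ⟨M, hM⟩ := μ.exists_bracket_le
  obtain ⟨D, -, hD⟩ := hF.exists_growth M
  have hc := continuous_field hF μ
  rw [← integrable_norm_iff hc.aestronglyMeasurable]
  exact μ.integrable_of_le_bracket hc.norm.aestronglyMeasurable fun p => by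
    rw [norm_norm]
    exact hD _ (hM p.2) p.1

/-! ### Testing the continuity equation: from compactly supported to Lipschitz functions -/

theorem _root_.MeanFieldControl.integrable_fderiv_apply {m : Measure (E d × I)} {w : E d × I → E d}
    (hw : Integrable w m) {ζ : E d → ℝ} (hζ : ContDiff ℝ ∞ ζ) {K : ℝ≥0} (hL : LipschitzWith K ζ) :
    Integrable (fun p => fderiv ℝ ζ p.1 (w p)) m := by
  have hc : Continuous fun p : E d × I => fderiv ℝ ζ p.1 :=
    (hζ.continuous_fderiv (by simp)).comp continuous_fst
  refine Integrable.mono' (hw.norm.const_mul K)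
    ((ContinuousLinearMap.id ℝ (E d →L[ℝ] ℝ)).aestronglyMeasurable_comp₂
      hc.aestronglyMeasurable hw.aestronglyMeasurable) (ae_of_all _ fun p => ?_)
  exact (ContinuousLinearMap.le_opNorm _ _).trans
    (by gcongr; exact norm_fderiv_le_of_lipschitz ℝ hL)

/-- The continuity equation tested against a product of compactly supported functions. -/
theorem ContinuityEquation.integral_prod_eq_zero (hF : IsAdmissibleField P.F) {μ : Curve d}
    {u : E d × I → P.U} (hu : Integrable u μ.spaceTime)
    (h : P.ContinuityEquation μ (μ.spaceTime.withDensityᵥ u))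
    {ζ : E d → ℝ} (hζ : ContDiff ℝ ∞ ζ) (hζc : HasCompactSupport ζ)
    {θ : ℝ → ℝ} (hθ : ContDiff ℝ ∞ θ) (hθc : HasCompactSupport θ) (hθs : tsupport θ ⊆ Ioo 0 1) :
    ∫ p, (deriv θ p.2 * ζ p.1 + θ p.2 * fderiv ℝ ζ p.1 (P.velocity μ u p)) ∂μ.spaceTime = 0 := by
  let φ : E d × ℝ → ℝ := fun p => ζ p.1 * θ p.2
  have hφ : ContDiff ℝ ∞ φ := (hζ.comp contDiff_fst).mul (hθ.comp contDiff_snd)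
  have hsupp : tsupport φ ⊆ tsupport ζ ×ˢ tsupport θ := by
    refine closure_minimal (fun p hp => ?_) ((isClosed_tsupport ζ).prod (isClosed_tsupport θ))
    have hp' : ζ p.1 * θ p.2 ≠ 0 := hp
    exact ⟨subset_tsupport ζ (left_ne_zero_of_mul hp'), subset_tsupport θ (right_ne_zero_of_mul hp')⟩
  have hφc : HasCompactSupport φ :=
    (hζc.isCompact.prod hθc.isCompact).of_isClosed_subset (isClosed_tsupport φ) hsupp
  have hCE := h φ hφ hφc (fun p hp => hθs (hsupp hp).2)
  have hgrad : ∀ (t : ℝ) y, gradient (fun z : E d => φ (z, t)) y = θ t • gradient ζ y := by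
    intro t y
    refine HasGradientAt.gradient ?_
    have h1 : HasFDerivAt ζ (fderiv ℝ ζ y) y := (hζ.differentiable (by simp) y).hasFDerivAt
    have h2 := h1.mul_const (θ t)
    rw [hasGradientAt_iff_hasFDerivAt]
    convert! h2 using 1
    ext v
    simp
  have hderiv : ∀ (t : ℝ) y, deriv (fun s : ℝ => φ (y, s)) t = deriv θ t * ζ y := by
    intro t y
    simp only [φ]
    rw [deriv_const_mul _ (hθ.differentiable (by simp) t)]
    ring
  obtain ⟨K, hL⟩ := hζ.lipschitzWith_of_hasCompactSupport hζc (by simp)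
  obtain ⟨Cθ, hCθ⟩ := hθc.exists_bound_of_continuous hθ.continuous
  have hθ'c : Continuous (deriv θ) := hθ.continuous_deriv (by simp)
  obtain ⟨Cθ', hCθ'⟩ := hθc.deriv.exists_bound_of_continuous hθ'c
  have hgc : Continuous (gradient ζ) := by
    have : gradient ζ = fun x => (InnerProductSpace.toDual ℝ (E d)).symm (fderiv ℝ ζ x) := rfl
    rw [this]
    exact (LinearIsometryEquiv.continuous _).comp (hζ.continuous_fderiv (by simp))
  have hgK : ∀ y, ‖gradient ζ y‖ ≤ K := fun y => by
    have : ‖gradient ζ y‖ = ‖fderiv ℝ ζ y‖ := LinearIsometryEquiv.norm_map _ _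
    rw [this]
    exact norm_fderiv_le_of_lipschitz ℝ hL
  have hCθ0 : 0 ≤ Cθ := (norm_nonneg _).trans (hCθ 0)
  have hpair : Momentum.pair (fun x => gradient (fun z : E d => φ (z, (x.2 : ℝ))) x.1)
      (μ.spaceTime.withDensityᵥ u)
      = ∫ p, θ p.2 * fderiv ℝ ζ p.1 (u p) ∂μ.spaceTime := by
    simp only [hgrad]
    rw [Momentum.pair_withDensityᵥ hu (C := Cθ * K)]
    · refine integral_congr_ae (ae_of_all _ fun p => ?_)
      simp [inner_smul_left, inner_gradient_left]
    · have : Continuous fun x : E d × I => θ x.2 • gradient ζ x.1 :=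
        (hθ.continuous.comp (continuous_subtype_val.comp continuous_snd)).smul
          (hgc.comp continuous_fst)
      exact this.measurable
    · intro p
      rw [norm_smul]
      exact mul_le_mul (hCθ _) (hgK _) (norm_nonneg _) hCθ0
  have hu' : Integrable (fun p => (u p : E d)) μ.spaceTime := P.U.subtypeL.integrable_comp hu
  have hθm : Continuous fun p : E d × I => θ p.2 :=
    hθ.continuous.comp (continuous_subtype_val.comp continuous_snd)
  have hθ'm : Continuous fun p : E d × I => deriv θ p.2 :=
    hθ'c.comp (continuous_subtype_val.comp continuous_snd)
  have i1 : Integrable (fun p => deriv θ p.2 * ζ p.1) μ.spaceTime :=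
    (μ.integrable_fst_lipschitz hL).bdd_mul hθ'm.aestronglyMeasurable
      (ae_of_all _ fun p => hCθ' _)
  have i2 : Integrable (fun p => θ p.2 * fderiv ℝ ζ p.1 (P.F p.1 (μ p.2))) μ.spaceTime := by
    have := integrable_fderiv_apply (integrable_velocity (P := P) (u := 0) hF
      (integrable_zero _ _ μ.spaceTime)) hζ hL
    simp only [velocity, Pi.zero_apply, ZeroMemClass.coe_zero, add_zero] at this
    exact this.bdd_mul hθm.aestronglyMeasurable (ae_of_all _ fun p => hCθ _)
  have i3 : Integrable (fun p => θ p.2 * fderiv ℝ ζ p.1 (u p)) μ.spaceTime := by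
    exact (integrable_fderiv_apply hu' hζ hL).bdd_mul hθm.aestronglyMeasurable (ae_of_all _ fun p => hCθ _)
  rw [hpair] at hCE
  simp only [hderiv, hgrad, inner_smul_left, inner_gradient_left] at hCE
  have i12 : Integrable (fun p : E d × I => deriv θ p.2 * ζ p.1
      + θ p.2 * fderiv ℝ ζ p.1 (P.F p.1 (μ p.2))) μ.spaceTime := i1.add i2
  have h3 := μ.integral_spaceTime i12
  simp only [conj_trivial] at hCE
  rw [← h3, ← integral_add i12 i3] at hCE
  rw [← hCE]
  refine integral_congr_ae (ae_of_all _ fun p => ?_)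
  simp only [velocity, map_add]
  ring

/-- Cutoff functions whose product with a given Lipschitz function is uniformly Lipschitz. -/
theorem _root_.MeanFieldControl.exists_cutoff {ζ : E d → ℝ} (hζ : ContDiff ℝ ∞ ζ) {K : ℝ≥0}
    (hL : LipschitzWith K ζ) :
    ∃ (χ : ℕ → E d → ℝ) (C : ℝ), (∀ n, ContDiff ℝ ∞ (χ n)) ∧ (∀ n, HasCompactSupport (χ n)) ∧
      (∀ n y, ‖χ n y‖ ≤ 1) ∧ (∀ n y, ‖fderiv ℝ (χ n * ζ) y‖ ≤ C) ∧
      ∀ y, ∀ᶠ n in atTop, χ n =ᶠ[𝓝 y] 1 := by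
  obtain ⟨b, hb, hbc, hb1, hball⟩ : ∃ b : E d → ℝ, ContDiff ℝ ∞ b ∧ HasCompactSupport b ∧
      (∀ z, ‖b z‖ ≤ 1) ∧ ∀ z, ‖z‖ < 1 → b =ᶠ[𝓝 z] 1 := by
    let b : ContDiffBump (0 : E d) := ⟨1, 2, by norm_num, by norm_num⟩
    refine ⟨b, b.contDiff, b.hasCompactSupport, fun z => ?_, fun z hz => ?_⟩
    · rw [Real.norm_of_nonneg b.nonneg]; exact b.le_one
    · exact b.eventuallyEq_one_of_mem_ball (mem_ball_zero_iff.2 hz)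
  have hb'c : Continuous (fderiv ℝ b) := hb.continuous_fderiv (by simp)
  obtain ⟨Cb, hCb⟩ : ∃ C, ∀ z, ‖(1 + ‖z‖) * ‖fderiv ℝ b z‖‖ ≤ C := by
    have hs : HasCompactSupport fun z => ‖fderiv ℝ b z‖ := (hbc.fderiv ℝ).norm
    have hs' : HasCompactSupport fun z => (1 + ‖z‖) * ‖fderiv ℝ b z‖ := hs.mul_left
    exact hs'.exists_bound_of_continuous
      ((continuous_const.add continuous_norm).mul hb'c.norm)
  -- Dilations of one bump. The gradient of `χ n` is of order `1/(n+1)` and lives where `|y|` is of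
  -- order `n+1`, which compensates the linear growth of `ζ`. The constant `Cb` records this.
  let χ : ℕ → E d → ℝ := fun n y => b ((n + 1 : ℝ)⁻¹ • y)
  have hn : ∀ n : ℕ, (0 : ℝ) < (n : ℝ) + 1 := fun n => by positivity
  have hχ : ∀ n, ContDiff ℝ ∞ (χ n) := fun n => hb.comp (contDiff_const_smul _)
  have hχc : ∀ n, HasCompactSupport (χ n) := fun n => hbc.comp_smul (inv_ne_zero (hn n).ne')
  have hχ' : ∀ n y, fderiv ℝ (χ n) y = (n + 1 : ℝ)⁻¹ • fderiv ℝ b ((n + 1 : ℝ)⁻¹ • y) := by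
    intro n y
    exact fderiv_comp_smul _
  have hζn' : ∀ n y, fderiv ℝ (χ n * ζ) y = χ n y • fderiv ℝ ζ y + ζ y • fderiv ℝ (χ n) y :=
    fun n y => fderiv_mul ((hχ n).differentiable (by simp) y) (hζ.differentiable (by simp) y)
  have hbd : ∀ n y, ‖fderiv ℝ (χ n * ζ) y‖ ≤ K + (|ζ 0| + K) * Cb := by
    intro n y
    rw [hζn']
    refine (norm_add_le _ _).trans (add_le_add ?_ ?_)
    · rw [norm_smul]
      exact (mul_le_mul (hb1 _) (norm_fderiv_le_of_lipschitz ℝ hL) (norm_nonneg _)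
        zero_le_one).trans_eq (one_mul _)
    · set z := (n + 1 : ℝ)⁻¹ • y with hz
      have hy : ‖y‖ = (n + 1) * ‖z‖ := by
        rw [hz, norm_smul, norm_inv, Real.norm_of_nonneg (hn n).le,
          mul_inv_cancel_left₀ (hn n).ne']
      have h1 : |ζ y| ≤ (|ζ 0| + K) * ((n + 1) * (1 + ‖z‖)) := by
        have h2 := hL.dist_le_mul y 0
        rw [dist_zero_right, Real.dist_eq, hy] at h2
        have h3 := abs_sub_abs_le_abs_sub (ζ y) (ζ 0)
        have h4 : 1 ≤ ((n : ℝ) + 1) * (1 + ‖z‖) := by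
          nlinarith [norm_nonneg z, hn n, (Nat.cast_nonneg n : (0 : ℝ) ≤ n)]
        have h5 := le_mul_of_one_le_right (abs_nonneg (ζ 0)) h4
        have h6 : (K : ℝ) * ((n + 1) * ‖z‖) ≤ K * ((n + 1) * (1 + ‖z‖)) := by
          gcongr; linarith
        rw [add_mul]
        linarith
      have h7 := hCb z
      rw [Real.norm_of_nonneg (by positivity)] at h7
      rw [norm_smul, hχ', norm_smul, norm_inv, Real.norm_of_nonneg (hn n).le, Real.norm_eq_abs,
        ← hz]
      calc |ζ y| * (((n : ℝ) + 1)⁻¹ * ‖fderiv ℝ b z‖)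
          ≤ (|ζ 0| + K) * ((n + 1) * (1 + ‖z‖)) * (((n : ℝ) + 1)⁻¹ * ‖fderiv ℝ b z‖) := by
            gcongr
        _ = (|ζ 0| + K) * ((1 + ‖z‖) * ‖fderiv ℝ b z‖) := by
            have := (hn n).ne'
            field_simp
        _ ≤ _ := by gcongr
  have hev : ∀ y, ∀ᶠ n in atTop, χ n =ᶠ[𝓝 y] 1 := by
    intro y
    have : ∀ᶠ n : ℕ in atTop, ‖y‖ < n := tendsto_natCast_atTop_atTop.eventually_gt_atTop _
    filter_upwards [this] with n hn'
    have hmem : ‖(n + 1 : ℝ)⁻¹ • y‖ < 1 := by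
      rw [norm_smul, norm_inv, Real.norm_of_nonneg (hn n).le, inv_mul_lt_iff₀ (hn n)]
      linarith
    exact (continuous_const_smul ((n + 1 : ℝ)⁻¹)).continuousAt.eventually (hball _ hmem)
  exact ⟨χ, _, hχ, hχc, fun n y => hb1 _, hbd, hev⟩

/-- Cutoff: the continuity equation may be tested against Lipschitz functions of space. -/
theorem ContinuityEquation.integral_prod_eq_zero' (hF : IsAdmissibleField P.F) {μ : Curve d}
    {u : E d × I → P.U} (hu : Integrable u μ.spaceTime)
    (h : P.ContinuityEquation μ (μ.spaceTime.withDensityᵥ u))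
    {ζ : E d → ℝ} (hζ : ContDiff ℝ ∞ ζ) {K : ℝ≥0} (hL : LipschitzWith K ζ)
    {θ : ℝ → ℝ} (hθ : ContDiff ℝ ∞ θ) (hθc : HasCompactSupport θ) (hθs : tsupport θ ⊆ Ioo 0 1) :
    ∫ p, (deriv θ p.2 * ζ p.1 + θ p.2 * fderiv ℝ ζ p.1 (P.velocity μ u p)) ∂μ.spaceTime = 0 := by
  obtain ⟨χ, C, hχ, hχc, hχ1, hbd, hev⟩ := exists_cutoff hζ hL
  have hζn : ∀ n, ContDiff ℝ ∞ (χ n * ζ) := fun n => (hχ n).mul hζ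
  obtain ⟨Cθ, hCθ⟩ := hθc.exists_bound_of_continuous hθ.continuous
  have hθ'c : Continuous (deriv θ) := hθ.continuous_deriv (by simp)
  obtain ⟨Cθ', hCθ'⟩ := hθc.deriv.exists_bound_of_continuous hθ'c
  have hv := integrable_velocity hF hu
  have hCθ0 : 0 ≤ Cθ := (norm_nonneg _).trans (hCθ 0)
  have hCθ'0 : 0 ≤ Cθ' := (norm_nonneg _).trans (hCθ' 0)
  -- The uniform bound on the gradients of `χ n * ζ` gives a majorant linear in the velocity. At
  -- each point the integrand is eventually constant in `n`.
  have hlim := tendsto_integral_of_dominated_convergence (μ := μ.spaceTime)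
    (F := fun (n : ℕ) (p : E d × I) => deriv θ p.2 * (χ n * ζ) p.1
      + θ p.2 * fderiv ℝ (χ n * ζ) p.1 (P.velocity μ u p))
    (f := fun p => deriv θ p.2 * ζ p.1 + θ p.2 * fderiv ℝ ζ p.1 (P.velocity μ u p))
    (fun p => Cθ' * |ζ p.1| + Cθ * (C * ‖P.velocity μ u p‖))
    (fun n => by
      have h1 : Continuous fun p : E d × I => fderiv ℝ (χ n * ζ) p.1 :=
        ((hζn n).continuous_fderiv (by simp)).comp continuous_fst
      have h2 := (ContinuousLinearMap.id ℝ (E d →L[ℝ] ℝ)).aestronglyMeasurable_comp₂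
        h1.aestronglyMeasurable hv.aestronglyMeasurable
      have h3 : Continuous fun p : E d × I => deriv θ p.2 * (χ n * ζ) p.1 :=
        (hθ'c.comp (continuous_subtype_val.comp continuous_snd)).mul
          ((hζn n).continuous.comp continuous_fst)
      have h4 : Continuous fun p : E d × I => θ p.2 :=
        hθ.continuous.comp (continuous_subtype_val.comp continuous_snd)
      exact h3.aestronglyMeasurable.add (h4.aestronglyMeasurable.mul h2))
    (((μ.integrable_fst_lipschitz hL).abs.const_mul _).add ((hv.norm.const_mul _).const_mul _))
    (fun n => ae_of_all _ fun p => by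
      refine (norm_add_le _ _).trans (add_le_add ?_ ?_)
      · rw [norm_mul]
        refine mul_le_mul (hCθ' _) ?_ (norm_nonneg _) hCθ'0
        rw [Pi.mul_apply, norm_mul, Real.norm_eq_abs (ζ p.1)]
        exact mul_le_of_le_one_left (abs_nonneg _) (hχ1 _ _)
      · rw [norm_mul]
        refine mul_le_mul (hCθ _) ?_ (norm_nonneg _) hCθ0
        exact (ContinuousLinearMap.le_opNorm _ _).trans (by gcongr; exact hbd n p.1))
    (ae_of_all _ fun p => by
      refine tendsto_const_nhds.congr' ?_
      filter_upwards [hev p.1] with n hn'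
      have h1 : χ n * ζ =ᶠ[𝓝 p.1] ζ := by
        filter_upwards [hn'] with y hy
        simp [hy]
      rw [h1.fderiv_eq, h1.eq_of_nhds])
  refine tendsto_nhds_unique hlim ?_
  refine tendsto_const_nhds.congr fun n => ?_
  exact (ContinuityEquation.integral_prod_eq_zero hF hu h (hζn n) (hχc n).mul_right hθ hθc hθs).symm

/-- Along a solution of the continuity equation, the observable `∫ ζ dμ_t` is absolutely
continuous with the expected derivative. -/
theorem ContinuityEquation.integral_sub_integral (hF : IsAdmissibleField P.F) {μ : Curve d}
    {u : E d × I → P.U} (hu : Integrable u μ.spaceTime)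
    (h : P.ContinuityEquation μ (μ.spaceTime.withDensityᵥ u))
    {ζ : E d → ℝ} (hζ : ContDiff ℝ ∞ ζ) {K : ℝ≥0} (hL : LipschitzWith K ζ) (s t : I) :
    ∫ y, ζ y ∂(μ t).toMeasure - ∫ y, ζ y ∂(μ s).toMeasure
      = ∫ r in (s : ℝ)..t, IccExtend zero_le_one
          (fun r => ∫ y, fderiv ℝ ζ y (P.velocity μ u (y, r)) ∂(μ r).toMeasure) r := by
  have hv := integrable_velocity hF hu
  have hi := integrable_fderiv_apply hv hζ hL
  have hc := μ.continuous_integral hL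
  have key := sub_eq_integral_of_weak_deriv (f := IccExtend zero_le_one
    fun t => ∫ y, ζ y ∂(μ t).toMeasure) (g := IccExtend zero_le_one
    (fun r => ∫ y, fderiv ℝ ζ y (P.velocity μ u (y, r)) ∂(μ r).toMeasure))
    (hc.Icc_extend' (h := zero_le_one)).continuousOn
    (intervalIntegrable_IccExtend (μ.integrable_integral hi))
    (fun θ hθ hθc hθs => by
      obtain ⟨Cθ, hCθ⟩ := hθc.exists_bound_of_continuous hθ.continuous
      have hθ'c : Continuous (deriv θ) := hθ.continuous_deriv (by simp)
      obtain ⟨Cθ', hCθ'⟩ := hθc.deriv.exists_bound_of_continuous hθ'c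
      have hθm : Continuous fun p : E d × I => θ p.2 :=
        hθ.continuous.comp (continuous_subtype_val.comp continuous_snd)
      have hθ'm : Continuous fun p : E d × I => deriv θ p.2 :=
        hθ'c.comp (continuous_subtype_val.comp continuous_snd)
      have i1 : Integrable (fun p => deriv θ p.2 * ζ p.1) μ.spaceTime :=
        (μ.integrable_fst_lipschitz hL).bdd_mul hθ'm.aestronglyMeasurable
          (ae_of_all _ fun p => hCθ' _)
      have i2 : Integrable (fun p => θ p.2 * fderiv ℝ ζ p.1 (P.velocity μ u p)) μ.spaceTime :=
        hi.bdd_mul hθm.aestronglyMeasurable (ae_of_all _ fun p => hCθ _)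
      have e0 := ContinuityEquation.integral_prod_eq_zero' hF hu h hζ hL hθ hθc hθs
      rw [integral_add i1 i2, μ.integral_spaceTime i1, μ.integral_spaceTime i2] at e0
      simp only [integral_const_mul] at e0
      rw [← integral_IccExtend, ← integral_IccExtend] at e0
      refine Eq.trans (congrArg₂ (· + ·) ?_ ?_) e0
      · refine intervalIntegral.integral_congr fun r hr => ?_
        rw [uIcc_of_le zero_le_one] at hr
        simp only [IccExtend_of_mem _ _ hr]
      · refine intervalIntegral.integral_congr fun r hr => ?_
        rw [uIcc_of_le zero_le_one] at hr
        simp only [IccExtend_of_mem _ _ hr]) s.2 t.2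
  simpa only [IccExtend_val] using key

/-- The `W₁` speed of a solution of the continuity equation is bounded by the mean speed. -/
theorem ContinuityEquation.dist_le (hF : IsAdmissibleField P.F) {μ : Curve d}
    {u : E d × I → P.U} (hu : Integrable u μ.spaceTime)
    (h : P.ContinuityEquation μ (μ.spaceTime.withDensityᵥ u)) {s t : I} (hst : s ≤ t) :
    dist (μ s) (μ t) ≤ ∫ r in (s : ℝ)..t, IccExtend zero_le_one
      (fun r => ∫ y, ‖P.velocity μ u (y, r)‖ ∂(μ r).toMeasure) r := by
  rw [dist_comm]
  refine dist_le_of_forall_smooth fun ζ hζ hL => ?_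
  have hv := integrable_velocity hF hu
  have hi := integrable_fderiv_apply hv hζ hL
  rw [ContinuityEquation.integral_sub_integral hF hu h hζ hL s t]
  refine integral_IccExtend_mono (μ.integrable_integral hi) (μ.integrable_integral hv.norm) ?_ hst
  filter_upwards [μ.ae_integrable hi, μ.ae_integrable hv] with r hr hr'
  refine integral_mono hr hr'.norm fun y => ?_
  refine (Real.le_norm_self _).trans ((ContinuousLinearMap.le_opNorm _ _).trans ?_)
  have := norm_fderiv_le_of_lipschitz ℝ hL (x₀ := y)
  exact mul_le_of_le_one_left (norm_nonneg _) (by simpa using this)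

theorem ContinuityEquation.isAC (hF : IsAdmissibleField P.F) {μ : Curve d}
    {u : E d × I → P.U} (hu : Integrable u μ.spaceTime)
    (h : P.ContinuityEquation μ (μ.spaceTime.withDensityᵥ u)) : μ.IsAC := by
  refine ⟨_, intervalIntegrable_IccExtend (μ.integrable_integral (integrable_velocity hF hu).norm),
    fun s t hst => ?_⟩
  have h1 := ContinuityEquation.dist_le hF hu h hst
  rw [← edist_eq_W1, edist_dist]
  exact ENNReal.ofReal_le_ofReal h1

end Problem

/-! ### Control costs -/

theorem IsControlCost.continuous {U : Submodule ℝ (E d)} {ψ : U → ℝ} (hψ : IsControlCost ψ) :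
    Continuous ψ :=
  continuousOn_univ.1 (hψ.convex.continuousOn isOpen_univ)

/-- Superlinearity gives `φ(s) ≥ s/δ` beyond some radius `r`, and `φ ≤ ψ + 1` along norms, so `A = r
+ δ` works. A bound on the cost thus makes the controls uniformly integrable. -/
theorem IsControlCost.exists_norm_le {U : Submodule ℝ (E d)} {ψ : U → ℝ} (hψ : IsControlCost ψ)
    {δ : ℝ} (hδ : 0 < δ) : ∃ A, 0 ≤ A ∧ ∀ u, ‖u‖ ≤ A + δ * ψ u := by
  obtain ⟨φ, -, -, -, -, -, hlim, -, C, -, hC⟩ := hψ.exists_moderating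
  obtain ⟨r, hr, h⟩ := ((hlim.eventually_ge_atTop δ⁻¹).and (eventually_gt_atTop 0)).exists_forall_of_atTop
    |>.imp fun r h => (⟨(h r le_rfl).2, fun s hs => (h s hs).1⟩ : 0 < r ∧ ∀ s ≥ r, δ⁻¹ ≤ φ s / s)
  refine ⟨r + δ, by positivity, fun u => ?_⟩
  have h0 := mul_nonneg hδ.le (hψ.nonneg u)
  rcases le_total ‖u‖ r with hu | hu
  · linarith
  · have h1 := h _ hu
    have h2 : 0 < ‖u‖ := hr.trans_le hu
    rw [inv_eq_one_div, div_le_div_iff₀ hδ h2] at h1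
    have h3 := mul_le_mul_of_nonneg_left (hC u).1 hδ.le
    nlinarith

/-! ### A priori estimates for controlled curves -/

/-- Gronwall in differential form, applied to the primitive `∫₀ᵗ H`, which vanishes at `0` and has
derivative at most `a + B` times itself. -/
theorem le_exp_mul_of_le_add_integral {H : I → ℝ} (hH : Continuous H) (hH0 : ∀ t, 0 ≤ H t)
    {a B : ℝ} (ha : 0 ≤ a) (hB : 0 < B)
    (h : ∀ t : I, H t ≤ a + B * ∫ r in (0 : ℝ)..t, IccExtend zero_le_one H r) (t : I) :
    H t ≤ Real.exp B * a := by
  have hc : Continuous (IccExtend zero_le_one H) := hH.Icc_extend'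
  have h0 : ∀ r, 0 ≤ IccExtend zero_le_one H r := fun r => hH0 _
  have hd : ∀ x, HasDerivAt (fun t : ℝ => ∫ r in (0 : ℝ)..t, IccExtend zero_le_one H r)
      (IccExtend zero_le_one H x) x := fun x =>
    intervalIntegral.integral_hasDerivAt_right (hc.intervalIntegrable _ _)
      hc.stronglyMeasurable.stronglyMeasurableAtFilter hc.continuousAt
  have key := norm_le_gronwallBound_of_norm_deriv_right_le (a := 0) (b := 1) (δ := 0) (K := B)
    (ε := a) (fun x _ => (hd x).continuousAt.continuousWithinAt)
    (fun x _ => (hd x).hasDerivWithinAt) (by simp) (fun x hx => by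
      have := h ⟨x, hx.1, hx.2.le⟩
      rw [IccExtend_of_mem _ _ ⟨hx.1, hx.2.le⟩, Real.norm_of_nonneg (hH0 _), add_comm]
      refine this.trans (by gcongr; exact Real.le_norm_self _)) t t.2
  have h1 := (Real.le_norm_self _).trans key
  simp only [gronwallBound_of_K_ne_0 hB.ne', zero_mul, zero_add, sub_zero] at h1
  calc H t ≤ a + B * (a / B * (Real.exp (B * t) - 1)) := (h t).trans (by gcongr)
    _ = Real.exp (B * t) * a := by field_simp; ring
    _ ≤ Real.exp B * a := by
      gcongr
      exact mul_le_of_le_one_right hB.le t.2.2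

namespace Problem

variable (P : Problem d)

/-- `u` is the control field of a solution of the continuity equation starting from `m₀`, with
control cost at most `c`. -/
structure Controlled (c : ℝ) (μ : Curve d) (u : E d × I → P.U) : Prop where
  integrable : Integrable u μ.spaceTime
  equation : P.ContinuityEquation μ (μ.spaceTime.withDensityᵥ u)
  integrable_cost : Integrable (fun p => P.ψ (u p)) μ.spaceTime
  cost_le : ∫ p, P.ψ (u p) ∂μ.spaceTime ≤ c
  initial : μ 0 = P.m₀

variable {P}

/-- The common Gronwall step of the moment and tail estimates. The derivative of `∫ ζ dμ_t` is
bounded by a multiple of itself plus a source whose total integral is controlled. -/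
theorem ContinuityEquation.integral_le_exp (hF : IsAdmissibleField P.F) {μ : Curve d}
    {u : E d × I → P.U} (hu : Integrable u μ.spaceTime)
    (h : P.ContinuityEquation μ (μ.spaceTime.withDensityᵥ u))
    {ζ : E d → ℝ} (hζ : ContDiff ℝ ∞ ζ) {K : ℝ≥0} (hL : LipschitzWith K ζ) (hζ0 : ∀ y, 0 ≤ ζ y)
    {g : E d × I → ℝ} (hg : Integrable g μ.spaceTime) (hg0 : ∀ p, 0 ≤ g p) {B : ℝ} (hB : 0 < B)
    (hle : ∀ᵐ r : I, ∫ y, fderiv ℝ ζ y (P.velocity μ u (y, r)) ∂(μ r).toMeasure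
      ≤ B * ∫ y, ζ y ∂(μ r).toMeasure + ∫ y, g (y, r) ∂(μ r).toMeasure) (t : I) :
    ∫ y, ζ y ∂(μ t).toMeasure
      ≤ Real.exp B * (∫ y, ζ y ∂(μ 0).toMeasure + ∫ p, g p ∂μ.spaceTime) := by
  have hi := integrable_fderiv_apply (integrable_velocity hF hu) hζ hL
  have hc := μ.continuous_integral hL
  have hci : Integrable fun r : I => ∫ y, ζ y ∂(μ r).toMeasure :=
    hc.integrable_of_hasCompactSupport (HasCompactSupport.of_compactSpace _)
  have hgi := μ.integrable_integral hg
  refine le_exp_mul_of_le_add_integral (H := fun t => ∫ y, ζ y ∂(μ t).toMeasure) hc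
    (fun t => integral_nonneg hζ0)
    (add_nonneg (integral_nonneg hζ0) (integral_nonneg hg0)) hB (fun t => ?_) t
  have h1 := ContinuityEquation.integral_sub_integral hF hu h hζ hL 0 t
  have h2 := integral_IccExtend_mono (μ.integrable_integral hi)
    ((hci.const_mul B).add hgi) hle (s := 0) (t := t) t.2.1
  have h3 : ∫ r in ((0 : I) : ℝ)..t, IccExtend zero_le_one
      ((fun r : I => B * ∫ y, ζ y ∂(μ r).toMeasure) + fun r : I => ∫ y, g (y, r) ∂(μ r).toMeasure) r
      = B * (∫ r in ((0 : I) : ℝ)..t, IccExtend zero_le_one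
          (fun r : I => ∫ y, ζ y ∂(μ r).toMeasure) r)
        + ∫ r in ((0 : I) : ℝ)..t, IccExtend zero_le_one
          (fun r : I => ∫ y, g (y, r) ∂(μ r).toMeasure) r := by
    rw [← intervalIntegral.integral_const_mul, ← intervalIntegral.integral_add]
    · rfl
    · exact (intervalIntegrable_IccExtend' hci 0 t).const_mul B
    · exact intervalIntegrable_IccExtend' hgi 0 t
  have h4 := integral_IccExtend_le hgi
    (ae_of_all _ fun r : I => integral_nonneg fun y => hg0 (y, r)) (s := 0) (t := t) t.2.1
  rw [← μ.integral_spaceTime hg] at h4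
  change _ ≤ _ + B * ∫ r in ((0 : I) : ℝ)..t,
    IccExtend zero_le_one (fun r : I => ∫ y, ζ y ∂(μ r).toMeasure) r
  linarith

theorem Controlled.integral_norm_le {A δ c : ℝ}
    (hA : ∀ u, ‖u‖ ≤ A + δ * P.ψ u) (hδ : 0 < δ) {μ : Curve d} {u : E d × I → P.U}
    (h : P.Controlled c μ u) : ∫ p, ‖u p‖ ∂μ.spaceTime ≤ A + δ * c := by
  calc ∫ p, ‖u p‖ ∂μ.spaceTime ≤ ∫ p, (A + δ * P.ψ (u p)) ∂μ.spaceTime :=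
        integral_mono h.integrable.norm ((integrable_const _).add (h.integrable_cost.const_mul _))
          fun p => hA _
    _ = A + δ * ∫ p, P.ψ (u p) ∂μ.spaceTime := by
        rw [integral_add (integrable_const _) (h.integrable_cost.const_mul _), integral_const_mul]
        simp
    _ ≤ _ := by gcongr; exact h.cost_le

/-- Testing with `⟨y⟩`, whose gradient is at most `1`, bounds the growth of the moment by the mean
speed. The field contributes linearly in the moment and the control contributes an integrable
source. -/
theorem exists_moment_bound (hF : IsAdmissibleField P.F) (hψ : IsControlCost P.ψ) (c : ℝ) :
    ∃ M, 0 ≤ M ∧ ∀ μ u, P.Controlled c μ u → ∀ t, ∫ y, bracket y ∂(μ t).toMeasure ≤ M := by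
  obtain ⟨C, C', hC, hC', hg⟩ := hF.2
  obtain ⟨A, hA0, hA⟩ := hψ.exists_norm_le one_pos
  refine ⟨|Real.exp (C + 2 * C' + 1) * (∫ y, bracket y ∂P.m₀.toMeasure + (A + 1 * c))|,
    abs_nonneg _, fun μ u h t => (le_trans ?_ (le_abs_self _))⟩
  have hu' := h.integrable.norm
  -- In `B`, the term `C` uses that the mean of `⟨y⟩` is at least `1`, the two `C'` come from `|y|`
  -- and from its mean, and the final `1` ensures positivity.
  have key := ContinuityEquation.integral_le_exp hF h.integrable h.equation contDiff_bracket
    lipschitzWith_bracket (fun y => (bracket_pos y).le) hu' (fun p => norm_nonneg _)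
    (B := C + 2 * C' + 1) (by positivity) ?_ t
  · refine key.trans ?_
    rw [h.initial]
    gcongr
    exact h.integral_norm_le hA one_pos
  · have hv := integrable_velocity hF h.integrable
    filter_upwards [μ.ae_integrable (integrable_fderiv_apply hv contDiff_bracket
      lipschitzWith_bracket), μ.ae_integrable hu'] with r h1 h2
    have hn := (μ r).integrable_norm
    have hb := (μ r).integrable_bracket
    set S := ∫ z, ‖z‖ ∂(μ r).toMeasure
    have hS : S ≤ ∫ y, bracket y ∂(μ r).toMeasure := integral_mono hn hb norm_le_bracket
    have hb1 : 1 ≤ ∫ y, bracket y ∂(μ r).toMeasure := by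
      have := integral_mono (integrable_const (1 : ℝ)) hb one_le_bracket
      simpa using this
    have i0 : Integrable (fun y : E d => ‖y‖ + S) (μ r).toMeasure := hn.add (integrable_const _)
    have i1 : Integrable (fun y : E d => C + C' * (‖y‖ + S)) (μ r).toMeasure :=
      (integrable_const _).add (i0.const_mul _)
    calc ∫ y, fderiv ℝ bracket y (P.velocity μ u (y, r)) ∂(μ r).toMeasure
        ≤ ∫ y, ((C + C' * (‖y‖ + S)) + ‖u (y, r)‖) ∂(μ r).toMeasure := by
          refine integral_mono h1 (i1.add h2) fun y => ?_
          refine (Real.le_norm_self _).trans ((ContinuousLinearMap.le_opNorm _ _).trans ?_)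
          refine (mul_le_of_le_one_left (norm_nonneg _) (norm_fderiv_bracket_le y)).trans ?_
          exact (norm_add_le _ _).trans (add_le_add (hg _ _) le_rfl)
      _ = (C + C' * (S + S)) + ∫ y, ‖u (y, r)‖ ∂(μ r).toMeasure := by
          rw [integral_add i1 h2, integral_add (integrable_const _) (i0.const_mul _), integral_const_mul,
            integral_add hn (integrable_const _)]
          simp [S]
      _ ≤ _ := by
          gcongr
          nlinarith

/-- With `‖u‖ ≤ A + δ ψ(u)`, the part `A` meets the tail weight and is at most `A⟨y⟩/R`, which
vanishes as `R → ∞` for fixed `δ`. The remainder is of order `δ c`, and `δ` is arbitrary. -/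
theorem exists_tailMoment_bound (hF : IsAdmissibleField P.F) (hψ : IsControlCost P.ψ) {c : ℝ}
    (hc : 0 ≤ c) : ∃ b : ℕ → ℝ, Tendsto b atTop (𝓝 0) ∧
      ∀ μ u, P.Controlled c μ u → ∀ t (n : ℕ), ∫ y, tailMoment n y ∂(μ t).toMeasure ≤ b n := by
  obtain ⟨M, hM0, hM⟩ := exists_moment_bound hF hψ c
  obtain ⟨D, hD0, hD⟩ := hF.exists_growth M
  have key : ∀ δ A : ℝ, 0 < δ → 0 ≤ A → (∀ u, ‖u‖ ≤ A + δ * P.ψ u) → ∀ R : ℝ, 0 < R →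
      ∀ μ u, P.Controlled c μ u → ∀ t, ∫ y, tailMoment R y ∂(μ t).toMeasure
        ≤ Real.exp (2 * D + 1) * (∫ y, tailMoment R y ∂P.m₀.toMeasure
          + (2 * (A / R) * M + 2 * δ * c)) := by
    intro δ A hδ hA0 hA R hR μ u h t
    have ib : Integrable (fun p : E d × I => bracket p.1) μ.spaceTime :=
      μ.integrable_fst_lipschitz lipschitzWith_bracket
    have hgi : Integrable (fun p : E d × I => 2 * (A / R) * bracket p.1 + 2 * δ * P.ψ (u p))
        μ.spaceTime := (ib.const_mul _).add (h.integrable_cost.const_mul _)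
    have hle := ContinuityEquation.integral_le_exp hF h.integrable h.equation
      (contDiff_tailMoment hR.le) (lipschitzWith_tailMoment hR.le)
      (fun y => tailMoment_nonneg hR.le y) hgi
      (fun p => add_nonneg (mul_nonneg (by positivity) (bracket_pos _).le)
        (mul_nonneg (by positivity) (hψ.nonneg _))) (B := 2 * D + 1) (by positivity) ?_ t
    · refine hle.trans ?_
      rw [h.initial, integral_add (ib.const_mul _) (h.integrable_cost.const_mul _),
        integral_const_mul, integral_const_mul]
      gcongr
      · rw [μ.integral_spaceTime ib]
        calc ∫ t, ∫ y, bracket y ∂(μ t).toMeasure ≤ ∫ _ : I, M :=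
              integral_mono (μ.integrable_integral ib) (integrable_const _) (hM μ u h)
          _ = M := by simp
      · exact h.cost_le
    · have hv := integrable_velocity hF h.integrable
      filter_upwards [μ.ae_integrable (integrable_fderiv_apply hv (contDiff_tailMoment hR.le)
        (lipschitzWith_tailMoment hR.le)), μ.ae_integrable hgi] with r h1 h2
      have ht := (μ r).integrable_tailMoment hR.le
      have ht0 : 0 ≤ ∫ y, tailMoment R y ∂(μ r).toMeasure :=
        integral_nonneg fun y => tailMoment_nonneg hR.le y
      calc ∫ y, fderiv ℝ (tailMoment R) y (P.velocity μ u (y, r)) ∂(μ r).toMeasure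
          ≤ ∫ y, (2 * D * tailMoment R y + (2 * (A / R) * bracket y + 2 * δ * P.ψ (u (y, r))))
              ∂(μ r).toMeasure := by
            refine integral_mono h1 ((ht.const_mul _).add h2) fun y => ?_
            refine (Real.le_norm_self _).trans ((ContinuousLinearMap.le_opNorm _ _).trans ?_)
            have hw0 := tailWeight_nonneg hR.le y
            have hF' := hD (μ r) (hM μ u h r) y
            have hvel : ‖P.velocity μ u (y, r)‖
                ≤ D * bracket y + (A + δ * P.ψ (u (y, r))) :=
              (norm_add_le _ _).trans (add_le_add hF' (hA _))
            have hψ0 := hψ.nonneg (u (y, r))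
            calc ‖fderiv ℝ (tailMoment R) y‖ * ‖P.velocity μ u (y, r)‖
                ≤ (2 * tailWeight R y) * (D * bracket y + (A + δ * P.ψ (u (y, r)))) :=
                  mul_le_mul (norm_fderiv_tailMoment_le hR.le y) hvel (norm_nonneg _)
                    (by positivity)
              _ = 2 * D * (bracket y * tailWeight R y) + (2 * A * tailWeight R y
                    + 2 * δ * P.ψ (u (y, r)) * tailWeight R y) := by ring
              _ ≤ 2 * D * tailMoment R y + (2 * A * (bracket y / R)
                    + 2 * δ * P.ψ (u (y, r)) * 1) := by
                  rw [bracket_mul_tailWeight]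
                  gcongr
                  · exact tailWeight_le_div hR y
                  · exact tailWeight_le_one hR.le y
              _ = _ := by ring
        _ = 2 * D * ∫ y, tailMoment R y ∂(μ r).toMeasure
            + ∫ y, (2 * (A / R) * bracket y + 2 * δ * P.ψ (u (y, r))) ∂(μ r).toMeasure := by
            rw [integral_add (ht.const_mul _) h2, integral_const_mul]
        _ ≤ _ := by gcongr; linarith
  -- The bound in `key` depends on `δ`, so the sequence `b` is taken as the exact supremum over
  -- controlled curves, and `δ` is chosen only when proving convergence.
  let S : ℕ → Set ℝ := fun n => {x | ∃ μ u t, P.Controlled c μ u ∧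
    x = ∫ y, tailMoment n y ∂(μ t).toMeasure}
  have hbdd : ∀ n, BddAbove (S n) := fun n => ⟨M, by
    rintro x ⟨μ, u, t, h, rfl⟩
    exact (integral_mono ((μ t).integrable_tailMoment n.cast_nonneg) (μ t).integrable_bracket
      (tailMoment_le_bracket n.cast_nonneg)).trans (hM μ u h t)⟩
  refine ⟨fun n => sSup (S n), ?_, fun μ u h t n => le_csSup (hbdd n) ⟨μ, u, t, h, rfl⟩⟩
  rw [Metric.tendsto_atTop]
  intro ε hε
  have hE := Real.exp_pos (2 * D + 1)
  -- Makes the limiting bound equal to `ε c / (c + 1)`, which is less than `ε`.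
  set δ := ε / (Real.exp (2 * D + 1) * 2 * (c + 1)) with hδ
  have hδ0 : 0 < δ := by positivity
  obtain ⟨A, hA0, hA⟩ := hψ.exists_norm_le hδ0
  have hlim : Tendsto (fun n : ℕ => Real.exp (2 * D + 1) * (∫ y, tailMoment n y ∂P.m₀.toMeasure
      + (2 * (A / n) * M + 2 * δ * c))) atTop
      (𝓝 (Real.exp (2 * D + 1) * (0 + (2 * 0 * M + 2 * δ * c)))) :=
    ((P.m₀.tendsto_integral_tailMoment).add ((((tendsto_const_div_atTop_nhds_zero_nat A).const_mul
      2).mul_const M).add_const _)).const_mul _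
  have hlt : Real.exp (2 * D + 1) * (0 + (2 * 0 * M + 2 * δ * c)) < ε := by
    have : Real.exp (2 * D + 1) * (0 + (2 * 0 * M + 2 * δ * c)) = ε * (c / (c + 1)) := by
      rw [hδ]; field_simp; ring
    rw [this]
    refine mul_lt_of_lt_one_right hε ?_
    rw [div_lt_one (by positivity)]
    linarith
  obtain ⟨N, hN⟩ := eventually_atTop.1 ((hlim.eventually_lt_const hlt).and (eventually_gt_atTop 0))
  refine ⟨N, fun n hn => ?_⟩
  obtain ⟨h1, h2⟩ := hN n hn
  have h0 : 0 ≤ sSup (S n) := Real.sSup_nonneg (by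
    rintro x ⟨μ, u, t, h, rfl⟩
    exact integral_nonneg fun y => tailMoment_nonneg n.cast_nonneg y)
  rw [Real.dist_eq, sub_zero, abs_of_nonneg h0]
  refine lt_of_le_of_lt (Real.sSup_le ?_ ?_) h1
  · rintro x ⟨μ, u, t, h, rfl⟩
    exact key δ A hδ0 hA0 hA n (by exact_mod_cast h2) μ u h t
  · have h3 : 0 ≤ ∫ y, tailMoment n y ∂P.m₀.toMeasure :=
      integral_nonneg fun y => tailMoment_nonneg n.cast_nonneg y
    positivity

/-- The velocity has mean at most `D M + A` plus `δ` times the mean cost. The first part is small on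
short intervals, the second by the choice of `δ`. -/
theorem exists_modulus (hF : IsAdmissibleField P.F) (hψ : IsControlCost P.ψ) {c : ℝ}
    (hc : 0 ≤ c) {ε : ℝ} (hε : 0 < ε) : ∃ η > 0, ∀ μ u, P.Controlled c μ u →
      ∀ s t : I, dist s t < η → dist (μ s) (μ t) < ε := by
  obtain ⟨M, hM0, hM⟩ := exists_moment_bound hF hψ c
  obtain ⟨D, hD0, hD⟩ := hF.exists_growth M
  set δ := ε / (2 * (c + 1)) with hδ
  have hδ0 : 0 < δ := by positivity
  obtain ⟨A, hA0, hA⟩ := hψ.exists_norm_le hδ0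
  refine ⟨ε / (2 * (D * M + A + 1)), by positivity, fun μ u h => ?_⟩
  have key : ∀ s t : I, s ≤ t → dist s t < ε / (2 * (D * M + A + 1)) → dist (μ s) (μ t) < ε := by
    intro s t hst hd
    have hv := integrable_velocity hF h.integrable
    have hi := μ.integrable_integral h.integrable_cost
    have h1 := ContinuityEquation.dist_le hF h.integrable h.equation hst
    have h2 := integral_IccExtend_mono (μ.integrable_integral hv.norm)
      ((integrable_const (D * M + A)).add (hi.const_mul δ)) (by
        filter_upwards [μ.ae_integrable hv, μ.ae_integrable h.integrable_cost] with r hr hr'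
        have hb := (μ r).integrable_bracket
        have i1 : Integrable (fun y => A + δ * P.ψ (u (y, r))) (μ r).toMeasure :=
          (integrable_const _).add (hr'.const_mul δ)
        calc ∫ y, ‖P.velocity μ u (y, r)‖ ∂(μ r).toMeasure
            ≤ ∫ y, (D * bracket y + (A + δ * P.ψ (u (y, r)))) ∂(μ r).toMeasure :=
              integral_mono hr.norm
                ((hb.const_mul D).add i1) fun y =>
                  (norm_add_le _ _).trans (add_le_add (hD _ (hM μ u h r) y) (hA _))
          _ = D * ∫ y, bracket y ∂(μ r).toMeasure
              + (A + δ * ∫ y, P.ψ (u (y, r)) ∂(μ r).toMeasure) := by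
              rw [integral_add (hb.const_mul D) i1,
                integral_add (integrable_const _) (hr'.const_mul δ), integral_const_mul,
                integral_const_mul]
              simp
          _ ≤ D * M + (A + δ * ∫ y, P.ψ (u (y, r)) ∂(μ r).toMeasure) := by
              gcongr; exact hM μ u h r
          _ = _ := by simp; ring) hst
    have h3 : ∫ r in (s : ℝ)..t, IccExtend zero_le_one ((fun _ : I => D * M + A)
        + fun r : I => δ * ∫ y, P.ψ (u (y, r)) ∂(μ r).toMeasure) r
        = (t - s) * (D * M + A) + δ * ∫ r in (s : ℝ)..t, IccExtend zero_le_one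
          (fun r : I => ∫ y, P.ψ (u (y, r)) ∂(μ r).toMeasure) r := by
      rw [← intervalIntegral.integral_const_mul, ← smul_eq_mul (_ - _) (_ + _),
        ← intervalIntegral.integral_const, ← intervalIntegral.integral_add intervalIntegrable_const
          ((intervalIntegrable_IccExtend' hi s t).const_mul δ)]
      rfl
    have h4 := integral_IccExtend_le hi
      (ae_of_all _ fun r : I => integral_nonneg fun y => hψ.nonneg (u (y, r))) hst
    rw [← μ.integral_spaceTime h.integrable_cost] at h4
    have h5 : (t : ℝ) - s < ε / (2 * (D * M + A + 1)) := by
      rw [dist_comm] at hd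
      exact (le_abs_self _).trans_lt hd
    have h6 : ((t : ℝ) - s) * (D * M + A) ≤ ε / 2 := by
      calc ((t : ℝ) - s) * (D * M + A) ≤ ε / (2 * (D * M + A + 1)) * (D * M + A + 1) := by
            refine mul_le_mul h5.le (by linarith) (by positivity) (by positivity)
        _ = ε / 2 := by field_simp
    have h7 : δ * c < ε / 2 := by
      rw [hδ, div_mul_eq_mul_div, div_lt_div_iff₀ (by positivity) two_pos]
      nlinarith
    have h8 : δ * ∫ p, P.ψ (u p) ∂μ.spaceTime ≤ δ * c := by gcongr; exact h.cost_le
    have h9 := mul_le_mul_of_nonneg_left h4 hδ0.le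
    linarith
  intro s t hd
  rcases le_total s t with hst | hst
  · exact key s t hst hd
  · rw [dist_comm]
    exact key t s hst (by rwa [dist_comm])

/-- Curves with uniformly bounded control cost are precompact in `C([0,1]; P₁)`. -/
theorem exists_tendsto_supDist (hF : IsAdmissibleField P.F) (hψ : IsControlCost P.ψ) {c : ℝ}
    (hc : 0 ≤ c) {μ : ℕ → Curve d} {u : ℕ → E d × I → P.U} (h : ∀ n, P.Controlled c (μ n) (u n)) :
    ∃ (k : ℕ → ℕ) (μ' : Curve d), StrictMono k ∧
      Tendsto (fun n => (μ (k n)).supDist μ') atTop (𝓝 0) := by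
  obtain ⟨b, hb, hbd⟩ := exists_tailMoment_bound hF hψ hc
  let f : ℕ → BoundedContinuousFunction I (P1 d) := fun n =>
    BoundedContinuousFunction.mkOfCompact ⟨(μ n).toFun, (μ n).continuous⟩
  -- The uniform tail bounds place all values in one compact subset of `P₁`, and the common modulus
  -- gives equicontinuity.
  have hcpt := BoundedContinuousFunction.arzela_ascoli _ (isCompact_setOf_integral_tailMoment_le hb)
    (range f) (by
      rintro _ x ⟨n, rfl⟩ m
      exact hbd (μ n) (u n) (h n) x m) (by
      intro s
      rw [Metric.equicontinuousAt_iff]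
      intro ε hε
      obtain ⟨η, hη, hm⟩ := exists_modulus hF hψ hc hε
      refine ⟨η, hη, fun t ht => ?_⟩
      rintro ⟨_, n, rfl⟩
      exact hm (μ n) (u n) (h n) s t (by rwa [dist_comm]))
  obtain ⟨g, -, k, hk, hlim⟩ := hcpt.tendsto_subseq (x := f)
    (fun n => subset_closure (mem_range_self n))
  refine ⟨k, ⟨g, fun s => ?_⟩, hk, ?_⟩
  · exact tendsto_iff_edist_tendsto_0.1 (g.continuous.tendsto s)
  · have h1 := tendsto_iff_dist_tendsto_zero.1 hlim
    have h2 := ENNReal.tendsto_ofReal h1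
    rw [ENNReal.ofReal_zero] at h2
    refine tendsto_of_tendsto_of_tendsto_of_le_of_le tendsto_const_nhds h2 (fun _ => zero_le)
      fun n => iSup_le fun t => ?_
    rw [← edist_eq_W1, edist_dist]
    exact ENNReal.ofReal_le_ofReal (BoundedContinuousFunction.dist_coe_le_dist
      (f := f (k n)) (g := g) t)

end Problem

/-! ### Lower semicontinuity of integrals under narrow convergence -/

/-- Layer cake: superlevel sets are open, so the portmanteau inequality holds at every level and
Fatou integrates it. The truncation at `N` keeps the levels real, since `g` may be infinite. -/
theorem lintegral_le_liminf_of_lowerSemicontinuous {X : Type*} [TopologicalSpace X]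
    [MeasurableSpace X] [BorelSpace X] [HasOuterApproxClosed X] {ms : ℕ → ProbabilityMeasure X}
    {m : ProbabilityMeasure X} (hm : Tendsto ms atTop (𝓝 m)) {g : X → ℝ≥0∞}
    (hg : LowerSemicontinuous g) :
    ∫⁻ x, g x ∂(m : Measure X) ≤ liminf (fun n => ∫⁻ x, g x ∂(ms n : Measure X)) atTop := by
  have hopen : ∀ N : ℕ, ∀ t : ℝ, 0 < t → IsOpen {x | t < (min (g x) N).toReal} := by
    intro N t ht
    have : {x | t < (min (g x) N).toReal} = {x | ENNReal.ofReal t < g x} ∩ {_x | t < N} := by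
      ext x
      have hN : (N : ℝ≥0∞) = ENNReal.ofReal N := by simp
      have hne : min (g x) N ≠ ⊤ := ne_top_of_le_ne_top (ENNReal.natCast_ne_top N) (min_le_right _ _)
      simp only [mem_ofPred_eq, mem_inter_iff]
      rw [← ENNReal.ofReal_lt_iff_lt_toReal ht.le hne, lt_min_iff, hN,
        ENNReal.ofReal_lt_ofReal_iff_of_nonneg ht.le]
    rw [this]
    exact (hg.isOpen_preimage _).inter isOpen_const
  have hsup : ∀ x, g x = ⨆ N : ℕ, min (g x) N := fun x => by
    rw [← inf_iSup_eq (α := ℝ≥0∞), ENNReal.iSup_natCast, inf_top_eq]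
  have hmeas : ∀ N : ℕ, Measurable fun x => min (g x) N := fun N =>
    hg.measurable.min measurable_const
  calc ∫⁻ x, g x ∂(m : Measure X) = ⨆ N : ℕ, ∫⁻ x, min (g x) N ∂(m : Measure X) := by
        rw [← lintegral_iSup hmeas fun N M h x => min_le_min le_rfl (by exact_mod_cast h)]
        exact lintegral_congr hsup
    _ ≤ _ := iSup_le fun N => ?_
  have hlayer : ∀ μ : Measure X, ∫⁻ x, min (g x) N ∂μ
      = ∫⁻ t in Ioi (0 : ℝ), μ {x | t < (min (g x) N).toReal} := by
    intro μ
    rw [← lintegral_eq_lintegral_meas_lt μ (ae_of_all _ fun x => ENNReal.toReal_nonneg)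
      (hmeas N).ennreal_toReal.aemeasurable]
    refine lintegral_congr fun x => (ENNReal.ofReal_toReal ?_).symm
    exact ne_top_of_le_ne_top (ENNReal.natCast_ne_top N) (min_le_right _ _)
  calc ∫⁻ x, min (g x) N ∂(m : Measure X)
      ≤ ∫⁻ t in Ioi (0 : ℝ), liminf (fun n => (ms n : Measure X)
          {x | t < (min (g x) N).toReal}) atTop := by
        rw [hlayer]
        refine setLIntegral_mono' measurableSet_Ioi fun t ht => ?_
        exact ProbabilityMeasure.le_liminf_measure_open_of_tendsto hm (hopen N t ht)
    _ ≤ liminf (fun n => ∫⁻ t in Ioi (0 : ℝ), (ms n : Measure X)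
          {x | t < (min (g x) N).toReal}) atTop :=
        lintegral_liminf_le fun n => Antitone.measurable fun s t hst =>
          measure_mono fun x hx => lt_of_le_of_lt hst hx
    _ = liminf (fun n => ∫⁻ x, min (g x) N ∂(ms n : Measure X)) atTop := by simp_rw [hlayer]
    _ ≤ _ := liminf_le_liminf (Eventually.of_forall fun n => lintegral_mono fun x => min_le_left _ _)

/-! ### Truncation -/

/-- Radial truncation at radius `R`. -/
def truncate {V : Type*} [NormedAddCommGroup V] [NormedSpace ℝ V] (R : ℝ) (w : V) : V :=
  (R / max R ‖w‖) • w

theorem continuous_truncate {V : Type*} [NormedAddCommGroup V] [NormedSpace ℝ V] {R : ℝ}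
    (hR : 0 < R) : Continuous (truncate R : V → V) :=
  (continuous_const.div (continuous_const.max continuous_norm)
    fun _ => (hR.trans_le (le_max_left _ _)).ne').smul continuous_id

theorem norm_truncate_le {V : Type*} [NormedAddCommGroup V] [NormedSpace ℝ V] {R : ℝ}
    (hR : 0 < R) (w : V) : ‖truncate R w‖ ≤ R := by
  have h : 0 < max R ‖w‖ := hR.trans_le (le_max_left _ _)
  rw [truncate, norm_smul, Real.norm_of_nonneg (by positivity), div_mul_eq_mul_div,
    div_le_iff₀ h]
  gcongr
  exact le_max_right _ _

theorem norm_sub_truncate_le {V : Type*} [NormedAddCommGroup V] [NormedSpace ℝ V] {R : ℝ}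
    (hR : 0 < R) (w : V) : ‖w - truncate R w‖ ≤ max (‖w‖ - R) 0 := by
  rcases le_total ‖w‖ R with h | h
  · rw [truncate, max_eq_left h, div_self hR.ne', one_smul, sub_self, norm_zero]
    exact le_max_right _ _
  · have hw : 0 < ‖w‖ := hR.trans_le h
    have : w - truncate R w = (1 - R / ‖w‖) • w := by
      rw [truncate, max_eq_right h, sub_smul, one_smul]
    rw [this, norm_smul, Real.norm_of_nonneg (sub_nonneg.2 ((div_le_one hw).2 h))]
    refine le_max_of_le_left (le_of_eq ?_)
    field_simp

theorem tendsto_of_forall_exists_tendsto {a : ℕ → ℝ} {l : ℝ}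
    (h : ∀ ε > 0, ∃ (b : ℕ → ℝ) (l' : ℝ), Tendsto b atTop (𝓝 l') ∧ (∀ n, |a n - b n| ≤ ε) ∧
      |l - l'| ≤ ε) : Tendsto a atTop (𝓝 l) := by
  rw [Metric.tendsto_atTop]
  intro ε hε
  obtain ⟨b, l', hb, h1, h2⟩ := h (ε / 4) (by positivity)
  obtain ⟨N, hN⟩ := Metric.tendsto_atTop.1 hb (ε / 4) (by positivity)
  refine ⟨N, fun n hn => ?_⟩
  have h3 := abs_lt.1 (hN n hn)
  have h4 := abs_le.1 (h1 n)
  have h5 := abs_le.1 h2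
  rw [Real.dist_eq, abs_lt]
  constructor <;> linarith

/-! ### Young measures -/

section Young

variable {U : Submodule ℝ (E d)} {ψ : U → ℝ}

theorem IsControlCost.integrable_of_cost (hψ : IsControlCost ψ) {Y : Type*} [MeasurableSpace Y]
    {m : Measure Y} [IsFiniteMeasure m] {u : Y → U} (hu : AEStronglyMeasurable u m)
    (h : Integrable (fun y => ψ (u y)) m) : Integrable u m := by
  obtain ⟨A, -, hA⟩ := hψ.exists_norm_le one_pos
  exact Integrable.mono' ((integrable_const A).add (h.const_mul 1)) hu (ae_of_all _ fun _ => hA _)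

theorem IsControlCost.integrable_of_lintegral (hψ : IsControlCost ψ) {Y : Type*}
    [MeasurableSpace Y] {m : Measure Y} {u : Y → U} (hu : AEStronglyMeasurable u m)
    (h : ∫⁻ y, ENNReal.ofReal (ψ (u y)) ∂m ≠ ⊤) : Integrable (fun y => ψ (u y)) m :=
  ⟨hψ.continuous.comp_aestronglyMeasurable hu,
    (hasFiniteIntegral_iff_ofReal (ae_of_all _ fun _ => hψ.nonneg _)).2 h.lt_top⟩

/-- Truncating the control in a linear functional costs little if the control cost is bounded. -/
theorem abs_integral_inner_sub_truncate_le {Y : Type*} [MeasurableSpace Y]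
    (hψ : ∀ u, 0 ≤ ψ u) {m : Measure Y} [IsFiniteMeasure m] {u : Y → U} (hu : Integrable u m)
    (hi : Integrable (fun y => ψ (u y)) m) {c : ℝ} (hc : ∫ y, ψ (u y) ∂m ≤ c)
    {f : Y → E d} (hf : AEStronglyMeasurable f m) {B : ℝ} (hB : 0 ≤ B) (hfB : ∀ y, ‖f y‖ ≤ B)
    {A δ : ℝ} (hA : ∀ u, ‖u‖ ≤ A + δ * ψ u) (hA0 : 0 < A) (hδ : 0 ≤ δ) :
    |∫ y, inner ℝ (f y) (u y : E d) ∂m - ∫ y, inner ℝ (f y) (truncate A (u y : E d)) ∂m|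
      ≤ B * (δ * c) := by
  have hu' : Integrable (fun y => (u y : E d)) m := U.subtypeL.integrable_comp hu
  have ht' : Integrable (fun y => truncate A (u y : E d)) m :=
    Integrable.of_bound ((continuous_truncate hA0).comp_aestronglyMeasurable
      hu'.aestronglyMeasurable) A (ae_of_all _ fun _ => norm_truncate_le hA0 _)
  have hin : ∀ w : Y → E d, Integrable w m → Integrable (fun y => inner ℝ (f y) (w y)) m := by
    intro w hw
    refine Integrable.mono' (hw.norm.const_mul B) (hf.inner hw.aestronglyMeasurable)
      (ae_of_all _ fun y => ?_)
    exact (norm_inner_le_norm _ _).trans (by gcongr; exact hfB y)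
  rw [← integral_sub (hin _ hu') (hin _ ht'), ← Real.norm_eq_abs]
  calc ‖∫ y, (inner ℝ (f y) (u y : E d) - inner ℝ (f y) (truncate A (u y : E d))) ∂m‖
      ≤ ∫ y, B * (δ * ψ (u y)) ∂m := by
        refine norm_integral_le_of_norm_le ((hi.const_mul δ).const_mul B) (ae_of_all _ fun y => ?_)
        rw [← inner_sub_right]
        refine (norm_inner_le_norm _ _).trans (mul_le_mul (hfB y) ?_ (norm_nonneg _) hB)
        -- Truncation at radius `A` removes `max (‖u‖ - A) 0`, and by `hA` this is at most `δ ψ(u)`.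
        refine (norm_sub_truncate_le hA0 _).trans (max_le ?_ (mul_nonneg hδ (hψ _)))
        linarith [hA (u y), Submodule.coe_norm (u y)]
    _ = B * (δ * ∫ y, ψ (u y) ∂m) := by rw [integral_const_mul, integral_const_mul]
    _ ≤ _ := by gcongr

/-- The cost bounds the mean of `‖u n‖`, so Markov's inequality bounds the mass outside large balls.
-/
theorem isTightMeasureSet_of_cost_le (hψ : IsControlCost ψ) {Y : Type*} [MeasurableSpace Y]
    {m : ℕ → Measure Y}
    [∀ n, IsProbabilityMeasure (m n)] {u : ℕ → Y → U} (hu : ∀ n, AEMeasurable (u n) (m n))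
    (hi : ∀ n, Integrable (fun x => ψ (u n x)) (m n)) {c : ℝ}
    (hc : ∀ n, ∫ x, ψ (u n x) ∂(m n) ≤ c) :
    IsTightMeasureSet (range fun n => (m n).map (u n)) := by
  obtain ⟨A, hA0, hA⟩ := hψ.exists_norm_le one_pos
  refine isTightMeasureSet_of_tendsto_measure_norm_gt ?_
  have hlim : Tendsto (fun r : ℝ => ENNReal.ofReal ((A + 1 * c) / r)) atTop (𝓝 0) := by
    rw [← ENNReal.ofReal_zero]
    exact ENNReal.tendsto_ofReal (tendsto_const_nhds.div_atTop tendsto_id)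
  refine tendsto_of_tendsto_of_tendsto_of_le_of_le' tendsto_const_nhds hlim
    (Eventually.of_forall fun _ => zero_le) ?_
  filter_upwards [eventually_gt_atTop 0] with r hr
  simp only [iSup_le_iff, mem_range, forall_exists_index, forall_apply_eq_imp_iff]
  intro n
  have hun := hψ.integrable_of_cost (hu n).aestronglyMeasurable (hi n)
  have hS : MeasurableSet {x : U | r < ‖x‖} := measurableSet_lt measurable_const measurable_norm
  rw [Measure.map_apply_of_aemeasurable (hu n) hS]
  have h1 : ∫ x, ‖u n x‖ ∂(m n) ≤ A + 1 * c := by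
    calc ∫ x, ‖u n x‖ ∂(m n) ≤ ∫ x, (A + 1 * ψ (u n x)) ∂(m n) :=
          integral_mono hun.norm ((integrable_const _).add ((hi n).const_mul _)) fun x => hA _
      _ = A + 1 * ∫ x, ψ (u n x) ∂(m n) := by
          rw [integral_add (integrable_const _) ((hi n).const_mul _), integral_const_mul]
          simp
      _ ≤ _ := by gcongr; exact hc n
  have h2 := mul_meas_ge_le_integral_of_nonneg (ae_of_all _ fun x => norm_nonneg (u n x))
    hun.norm r
  have h3 : (m n).real {x | r ≤ ‖u n x‖} ≤ (A + 1 * c) / r := by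
    rw [le_div_iff₀ hr, mul_comm]
    exact h2.trans h1
  calc (m n) (u n ⁻¹' {x | r < ‖x‖}) ≤ (m n) {x | r ≤ ‖u n x‖} :=
        measure_mono fun x (hx : r < ‖u n x‖) => hx.le
    _ = ENNReal.ofReal ((m n).real {x | r ≤ ‖u n x‖}) := (ofReal_measureReal).symm
    _ ≤ _ := ENNReal.ofReal_le_ofReal h3

variable {X : Type*} [MetricSpace X] [CompleteSpace X] [SecondCountableTopology X]
  [MeasurableSpace X] [BorelSpace X]

/-- The laws of `(x, u_n(x))` subconverge narrowly if the control costs are bounded. -/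
theorem exists_tendsto_graph (hψ : IsControlCost ψ) {m : ℕ → ProbabilityMeasure X}
    {m' : ProbabilityMeasure X} (hm : Tendsto m atTop (𝓝 m')) {u : ℕ → X → U}
    (hu : ∀ n, AEMeasurable (u n) (m n : Measure X))
    (hi : ∀ n, Integrable (fun x => ψ (u n x)) (m n : Measure X)) {c : ℝ}
    (hc : ∀ n, ∫ x, ψ (u n x) ∂(m n : Measure X) ≤ c) :
    ∃ (k : ℕ → ℕ) (l : ℕ → ProbabilityMeasure (X × U)) (l' : ProbabilityMeasure (X × U)),
      StrictMono k ∧ (∀ n, (l n : Measure (X × U))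
        = (m (k n) : Measure X).map fun x => (x, u (k n) x)) ∧ Tendsto l atTop (𝓝 l') ∧
      (l' : Measure (X × U)).fst = m' := by
  have hg : ∀ n, AEMeasurable (fun x => (x, u n x)) (m n : Measure X) := fun n =>
    aemeasurable_id.prodMk (hu n)
  let L : ℕ → ProbabilityMeasure (X × U) := fun n =>
    ⟨(m n : Measure X).map fun x => (x, u n x), Measure.isProbabilityMeasure_map (hg n)⟩
  have hL : ∀ n, (L n : Measure (X × U)) = (m n : Measure X).map fun x => (x, u n x) :=
    fun n => rfl
  have hfst : ∀ n, (L n : Measure (X × U)).fst = m n := fun n => by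
    rw [hL, Measure.fst, AEMeasurable.map_map_of_aemeasurable measurable_fst.aemeasurable (hg n)]
    exact Measure.map_id
  have hsnd : ∀ n, (L n : Measure (X × U)).snd = (m n : Measure X).map (u n) := fun n => by
    rw [hL, Measure.snd, AEMeasurable.map_map_of_aemeasurable measurable_snd.aemeasurable (hg n)]
    rfl
  have htight : IsTightMeasureSet {((μ : ProbabilityMeasure (X × U)) : Measure (X × U)) |
      μ ∈ range L} := by
    refine IsTightMeasureSet.prodMk ?_ ?_
    · have hcl : IsCompact (closure (range m)) :=
        hm.isCompact_insert_range.closure_of_subset (subset_insert _ _)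
      refine (isTightMeasureSet_of_isCompact_closure hcl).subset ?_
      rintro _ ⟨_, ⟨_, ⟨n, rfl⟩, rfl⟩, rfl⟩
      exact ⟨m n, mem_range_self n, (hfst n).symm⟩
    · refine (isTightMeasureSet_of_cost_le hψ hu hi hc).subset ?_
      rintro _ ⟨_, ⟨_, ⟨n, rfl⟩, rfl⟩, rfl⟩
      exact ⟨n, (hsnd n).symm⟩
  obtain ⟨l', -, k, hk, hlim⟩ := (isCompact_closure_of_isTightMeasureSet htight).tendsto_subseq
    (x := L) fun n => subset_closure (mem_range_self n)
  refine ⟨k, L ∘ k, l', hk, fun n => rfl, hlim, ?_⟩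
  have h1 := ProbabilityMeasure.tendsto_map_of_tendsto_of_continuous _ _ hlim
    (continuous_fst (X := X) (Y := U))
  have h2 : ∀ n, (((L ∘ k) n).map (continuous_fst (X := X) (Y := U)).measurable.aemeasurable)
      = m (k n) := fun n => Subtype.ext (hfst (k n))
  have h3 := tendsto_nhds_unique (h1.congr h2) (hm.comp hk.tendsto_atTop)
  exact congrArg Subtype.val h3

/-- Weak compactness of controls: along a narrowly convergent sequence of measures, controls of
bounded cost subconverge, and the cost is lower semicontinuous. -/
theorem exists_limit_control (hψ : IsControlCost ψ) {m : ℕ → ProbabilityMeasure X}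
    {m' : ProbabilityMeasure X} (hm : Tendsto m atTop (𝓝 m')) {u : ℕ → X → U}
    (hu : ∀ n, AEMeasurable (u n) (m n : Measure X))
    (hi : ∀ n, Integrable (fun x => ψ (u n x)) (m n : Measure X)) {c : ℝ}
    (hc : ∀ n, ∫ x, ψ (u n x) ∂(m n : Measure X) ≤ c) :
    ∃ (k : ℕ → ℕ) (u' : X → U), StrictMono k ∧ Integrable u' (m' : Measure X) ∧
      ∫⁻ x, ENNReal.ofReal (ψ (u' x)) ∂(m' : Measure X)
        ≤ liminf (fun n => ∫⁻ x, ENNReal.ofReal (ψ (u (k n) x)) ∂(m (k n) : Measure X)) atTop ∧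
      ∀ f : X → E d, Continuous f → (∃ B, ∀ x, ‖f x‖ ≤ B) →
        Tendsto (fun n => ∫ x, inner ℝ (f x) (u (k n) x : E d) ∂(m (k n) : Measure X)) atTop
          (𝓝 (∫ x, inner ℝ (f x) (u' x : E d) ∂(m' : Measure X))) := by
  obtain ⟨k, l, l', hk, hl, hlim, hfst⟩ := exists_tendsto_graph hψ hm hu hi hc
  have hg : ∀ n, AEMeasurable (fun x => (x, u n x)) (m n : Measure X) := fun n =>
    aemeasurable_id.prodMk (hu n)
  have hψc : Continuous fun p : X × U => ψ p.2 := hψ.continuous.comp continuous_snd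
  have hψm : Measurable fun p : X × U => ENNReal.ofReal (ψ p.2) := hψc.measurable.ennreal_ofReal
  have hcost : ∀ n, ∫⁻ p, ENNReal.ofReal (ψ p.2) ∂(l n : Measure (X × U))
      = ∫⁻ x, ENNReal.ofReal (ψ (u (k n) x)) ∂(m (k n) : Measure X) := fun n => by
    rw [hl, lintegral_map' hψm.aemeasurable (hg _)]
  have hlsc := lintegral_le_liminf_of_lowerSemicontinuous hlim
    (ENNReal.continuous_ofReal.comp hψc).lowerSemicontinuous
  simp only [Function.comp_apply, hcost] at hlsc
  have hle : ∀ n, ∫⁻ x, ENNReal.ofReal (ψ (u n x)) ∂(m n : Measure X) ≤ ENNReal.ofReal c := by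
    intro n
    rw [← ofReal_integral_eq_lintegral_ofReal (hi n) (ae_of_all _ fun x => hψ.nonneg _)]
    exact ENNReal.ofReal_le_ofReal (hc n)
  have hlc : ∫⁻ p, ENNReal.ofReal (ψ p.2) ∂(l' : Measure (X × U)) ≤ ENNReal.ofReal c :=
    hlsc.trans ((liminf_le_liminf (Eventually.of_forall fun n => hle (k n))).trans_eq
      (liminf_const _))
  have hc0 : 0 ≤ c := (integral_nonneg fun x => hψ.nonneg (u 0 x)).trans (hc 0)
  have hil : Integrable (fun p : X × U => ψ p.2) (l' : Measure (X × U)) :=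
    hψ.integrable_of_lintegral continuous_snd.aestronglyMeasurable
      (ne_top_of_le_ne_top ENNReal.ofReal_ne_top hlc)
  have hwl : Integrable (fun p : X × U => p.2) (l' : Measure (X × U)) :=
    hψ.integrable_of_cost continuous_snd.aestronglyMeasurable hil
  have hcl : ∫ p, ψ p.2 ∂(l' : Measure (X × U)) ≤ c := by
    rw [integral_eq_lintegral_of_nonneg_ae (ae_of_all _ fun p => hψ.nonneg _)
      hil.aestronglyMeasurable]
    exact ENNReal.toReal_le_of_le_ofReal hc0 hlc
  -- The limit law need not be carried by a graph. Its fibrewise barycentre preserves functionals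
  -- linear in the control and, by Jensen, does not increase the cost.
  let κ := (l' : Measure (X × U)).condKernel
  let u' : X → U := fun x => ∫ w, w ∂κ x
  have hu' : Integrable u' (m' : Measure X) := by
    rw [← hfst]
    exact hwl.integral_condKernel
  refine ⟨k, u', hk, hu', ?_, ?_⟩
  · refine le_trans ?_ hlsc
    calc ∫⁻ x, ENNReal.ofReal (ψ (u' x)) ∂(m' : Measure X)
        ≤ ∫⁻ x, ∫⁻ w, ENNReal.ofReal (ψ w) ∂κ x ∂(m' : Measure X) := by
          rw [← hfst]
          refine lintegral_mono_ae ?_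
          filter_upwards [hil.condKernel_ae, hwl.condKernel_ae] with x h1 h2
          rw [← ofReal_integral_eq_lintegral_ofReal h1 (ae_of_all _ fun w => hψ.nonneg _)]
          refine ENNReal.ofReal_le_ofReal ?_
          exact hψ.convex.map_integral_le hψ.continuous.continuousOn isClosed_univ
            (ae_of_all _ fun _ => mem_univ _) h2 h1
      _ = ∫⁻ p, ENNReal.ofReal (ψ p.2) ∂(l' : Measure (X × U)) := by
          rw [← hfst]
          exact Measure.lintegral_condKernel hψm
  · rintro f hf ⟨B, hB⟩
    have hB0 : 0 ≤ |B| := abs_nonneg B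
    have hfB : ∀ x, ‖f x‖ ≤ |B| := fun x => (hB x).trans (le_abs_self B)
    have hfl : Continuous fun p : X × U => f p.1 := hf.comp continuous_fst
    have hw' : Integrable (fun p : X × U => (p.2 : E d)) (l' : Measure (X × U)) :=
      U.subtypeL.integrable_comp hwl
    have hbary : ∫ x, inner ℝ (f x) (u' x : E d) ∂(m' : Measure X)
        = ∫ p, inner ℝ (f p.1) (p.2 : E d) ∂(l' : Measure (X × U)) := by
      have hI : Integrable (fun p : X × U => inner ℝ (f p.1) (p.2 : E d))
          (l' : Measure (X × U)) := by
        refine Integrable.mono' (hw'.norm.const_mul |B|)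
          (hfl.aestronglyMeasurable.inner hw'.aestronglyMeasurable) (ae_of_all _ fun p => ?_)
        exact (norm_inner_le_norm _ _).trans (by gcongr; exact hfB p.1)
      rw [← Measure.integral_condKernel hI, hfst]
      rw [← hfst]
      refine integral_congr_ae ?_
      filter_upwards [hwl.condKernel_ae] with x hx
      have := ((innerSL ℝ (f x)).comp U.subtypeL).integral_comp_comm hx
      simpa using this.symm
    rw [hbary]
    -- The observable is unbounded in the control. Truncation makes it bounded and continuous on `X
    -- × U`, with an error uniform in `n`.
    refine tendsto_of_forall_exists_tendsto fun ε hε => ?_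
    set δ := ε / (|B| + 1) / (c + 1) with hδ
    have hδ0 : 0 < δ := by positivity
    obtain ⟨A, hA0, hA⟩ := hψ.exists_norm_le hδ0
    -- `A` may be `0`, while the truncation radius must be positive.
    have hA' : ∀ u, ‖u‖ ≤ (A + 1) + δ * ψ u := fun u => (hA u).trans (by linarith)
    have hA1 : 0 < A + 1 := by linarith
    have hsmall : |B| * (δ * c) ≤ ε := by
      have : (|B| + 1) * (δ * (c + 1)) = ε := by rw [hδ]; field_simp
      rw [← this]
      gcongr <;> linarith
    have hTc : Continuous fun p : X × U => inner ℝ (f p.1) (truncate (A + 1) (p.2 : E d)) :=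
      hfl.inner ((continuous_truncate hA1).comp (continuous_subtype_val.comp continuous_snd))
    let T : BoundedContinuousFunction (X × U) ℝ :=
      BoundedContinuousFunction.ofNormedAddCommGroup
        (fun p => inner ℝ (f p.1) (truncate (A + 1) (p.2 : E d))) hTc (|B| * (A + 1)) fun p =>
          (norm_inner_le_norm _ _).trans (mul_le_mul (hfB _) (norm_truncate_le hA1 _)
            (norm_nonneg _) hB0)
    have hT := ProbabilityMeasure.tendsto_iff_forall_integral_tendsto.1 hlim T
    refine ⟨_, _, hT, fun n => ?_, ?_⟩
    · have : ∫ p, T p ∂(l n : Measure (X × U)) = ∫ x, inner ℝ (f x)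
          (truncate (A + 1) (u (k n) x : E d)) ∂(m (k n) : Measure X) := by
        rw [hl, integral_map (hg _) T.continuous.aestronglyMeasurable]
        rfl
      rw [this]
      exact (abs_integral_inner_sub_truncate_le hψ.nonneg
        (hψ.integrable_of_cost (hu _).aestronglyMeasurable (hi _)) (hi _) (hc _)
        hf.aestronglyMeasurable hB0 hfB hA' hA1 hδ0.le).trans hsmall
    · exact (abs_integral_inner_sub_truncate_le hψ.nonneg hwl hil hcl
        hfl.aestronglyMeasurable hB0 (fun p => hfB p.1) hA' hA1 hδ0.le).trans hsmall

end Young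

/-! ### Uniform convergence of curves -/

theorem Curve.edist_le_supDist (μ η : Curve d) (t : I) : edist (μ t) (η t) ≤ μ.supDist η :=
  le_iSup (fun t => W1 (μ t) (η t)) t

section Convergence

variable {μ : ℕ → Curve d} {μ' : Curve d}

theorem Curve.eventually_forall_dist_lt (h : Tendsto (fun n => (μ n).supDist μ') atTop (𝓝 0))
    {δ : ℝ} (hδ : 0 < δ) : ∀ᶠ n in atTop, ∀ t, dist (μ n t) (μ' t) < δ := by
  filter_upwards [h.eventually_lt_const (ENNReal.ofReal_pos.2 hδ)] with n hn t
  exact edist_lt_ofReal.1 (((μ n).edist_le_supDist μ' t).trans_lt hn)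

theorem Curve.tendsto_apply (h : Tendsto (fun n => (μ n).supDist μ') atTop (𝓝 0)) (t : I) :
    Tendsto (fun n => μ n t) atTop (𝓝 (μ' t)) :=
  Metric.tendsto_nhds.2 fun _ hδ => (Curve.eventually_forall_dist_lt h hδ).mono fun _ hn => hn t

/-- The probability measure `dμ_t ⊗ dt`. -/
def Curve.spaceTimeProb (μ : Curve d) : ProbabilityMeasure (E d × I) := ⟨μ.spaceTime, inferInstance⟩

/-- For a `K`-Lipschitz test function every time slice is `K`-Lipschitz in space, so the integrals
differ by at most `K` times the uniform distance of the curves. -/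
theorem Curve.tendsto_spaceTimeProb (h : Tendsto (fun n => (μ n).supDist μ') atTop (𝓝 0)) :
    Tendsto (fun n => (μ n).spaceTimeProb) atTop (𝓝 μ'.spaceTimeProb) := by
  rw [tendsto_iff_forall_lipschitz_integral_tendsto]
  rintro f ⟨C, hC⟩ ⟨K, hK⟩
  have hb : ∀ x, ‖f x‖ ≤ C + ‖f (0, 0)‖ := fun x => by
    have := norm_sub_norm_le (f x) (f (0, 0))
    have := hC x (0, 0)
    rw [dist_eq_norm] at this
    linarith
  have hi : ∀ η : Curve d, Integrable f η.spaceTime := fun η =>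
    Integrable.of_bound hK.continuous.aestronglyMeasurable _ (ae_of_all _ hb)
  rw [Metric.tendsto_atTop]
  intro ε hε
  obtain ⟨N, hN⟩ := eventually_atTop.1
    (Curve.eventually_forall_dist_lt h (δ := ε / (2 * (K + 1))) (by positivity))
  refine ⟨N, fun n hn => ?_⟩
  change dist (∫ p, f p ∂(μ n).spaceTime) (∫ p, f p ∂μ'.spaceTime) < ε
  rw [(μ n).integral_spaceTime (hi _), μ'.integral_spaceTime (hi _), dist_eq_norm,
    ← integral_sub ((μ n).integrable_integral (hi _)) (μ'.integrable_integral (hi _))]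
  have hle : ∀ t : I, ‖∫ y, f (y, t) ∂(μ n t).toMeasure - ∫ y, f (y, t) ∂(μ' t).toMeasure‖
      ≤ K * (ε / (2 * (K + 1))) := by
    intro t
    have hf : LipschitzWith K fun y => f (y, t) := by
      simpa using! hK.comp (LipschitzWith.prodMk_right t)
    exact (abs_integral_sub_le_dist _ _ hf).trans (by gcongr; exact (hN n hn t).le)
  refine (norm_integral_le_of_norm_le_const (ae_of_all _ hle)).trans_lt ?_
  have hK0 : (0 : ℝ) ≤ K := K.2
  have : (K : ℝ) * (ε / (2 * (K + 1))) ≤ ε / 2 := by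
    rw [mul_div_assoc', div_le_div_iff₀ (by positivity) two_pos]
    nlinarith
  simp only [probReal_univ, mul_one]
  linarith

end Convergence

/-! ### Lower semicontinuity of the state cost -/

theorem liminf_add_liminf_le (a b : ℕ → ℝ≥0∞) :
    liminf a atTop + liminf b atTop ≤ liminf (fun n => a n + b n) atTop := by
  simp only [liminf_eq_iSup_iInf_of_nat]
  rw [ENNReal.iSup_add_iSup_of_monotone]
  · exact iSup_mono fun n => le_iInf₂ fun i hi => add_le_add (iInf₂_le i hi) (iInf₂_le i hi)
  · exact fun m n h => le_iInf₂ fun i hi => iInf₂_le i (h.trans hi)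
  · exact fun m n h => le_iInf₂ fun i hi => iInf₂_le i (h.trans hi)

/-- The properties of the state cost used for lower semicontinuity. -/
theorem lowerSemicontinuous_cost {L : E d → P1 d → ℝ≥0∞}
    (hL : IsUniformlyContinuousCost L ∨ IsObstacleCost L) :
    (∀ μ : Curve d, LowerSemicontinuous fun p : E d × I => L p.1 (μ p.2)) ∧
    ∀ ε : ℝ, 0 < ε → ∃ δ > 0, ∀ y μ η, dist μ η < δ → L y η ≤ L y μ + ENNReal.ofReal ε := by
  rcases hL with ⟨hfin, hL⟩ | ⟨hconst, hL⟩
  · refine ⟨fun μ => Continuous.lowerSemicontinuous ?_, fun ε hε => ?_⟩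
    · have huc : UniformContinuous fun p : E d × P1 d => (L p.1 p.2).toReal := by
        rw [Metric.uniformContinuous_iff]
        intro ε hε
        obtain ⟨δ, hδ, h⟩ := hL ε hε
        refine ⟨δ, hδ, fun a b hab => h _ _ _ _ ((le_max_left _ _).trans_lt hab) ?_⟩
        rw [← edist_eq_W1, edist_lt_ofReal]
        exact (le_max_right _ _).trans_lt hab
      have : (fun p : E d × I => L p.1 (μ p.2))
          = fun p => ENNReal.ofReal (L p.1 (μ p.2)).toReal := by
        ext p
        rw [ENNReal.ofReal_toReal (hfin _ _)]
      rw [this]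
      exact ENNReal.continuous_ofReal.comp (huc.continuous.comp
        (continuous_fst.prodMk (μ.continuous.comp continuous_snd)))
    · obtain ⟨δ, hδ, h⟩ := hL ε hε
      refine ⟨δ, hδ, fun y μ η hd => ?_⟩
      have h1 := h y y μ η (by simpa using hδ) (by rwa [← edist_eq_W1, edist_lt_ofReal])
      rw [← ENNReal.ofReal_toReal (hfin y η), ← ENNReal.ofReal_toReal (hfin y μ),
        ← ENNReal.ofReal_add ENNReal.toReal_nonneg hε.le]
      refine ENNReal.ofReal_le_ofReal ?_
      linarith [(abs_lt.1 h1).1]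
  -- Any `δ` serves here, because `L` does not depend on the measure.
  · refine ⟨fun μ => ?_, fun ε hε => ⟨1, one_pos, fun y μ η _ => ?_⟩⟩
    · have h0 : (fun p : E d × I => L p.1 (μ p.2)) = (fun y => L y (μ 0)) ∘ Prod.fst := by
        ext p
        exact hconst _ _ _
      rw [h0]
      refine LowerSemicontinuous.comp ?_ continuous_fst
      obtain ⟨hopen, hcont⟩ := hL (μ 0)
      -- Openness of the infinity set settles `L y = ∞`. Elsewhere, nearby finite values are
      -- controlled by continuity and nearby infinite ones only help.
      intro y a (ha : a < L y (μ 0))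
      by_cases hy : L y (μ 0) = ⊤
      · filter_upwards [hopen.mem_nhds hy] with z hz
        rw [hy] at ha
        exact ha.trans_eq (show L z (μ 0) = ⊤ from hz).symm
      · have h1 := (hcont y (Ne.lt_top hy)).eventually_const_lt ha
        rw [eventually_nhdsWithin_iff] at h1
        filter_upwards [h1] with z hz
        by_cases hz' : L z (μ 0) = ⊤
        · change a < L z (μ 0)
          rw [hz']
          exact ha.trans_le le_top
        · exact hz (Ne.lt_top hz')
    · rw [hconst y η μ]
      exact le_self_add

/-- The total state cost is lower semicontinuous. -/
theorem lintegral_cost_le_liminf {L : E d → P1 d → ℝ≥0∞}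
    (hL : IsUniformlyContinuousCost L ∨ IsObstacleCost L) {μ : ℕ → Curve d} {μ' : Curve d}
    (h : Tendsto (fun n => (μ n).supDist μ') atTop (𝓝 0)) :
    ∫⁻ t : I, ∫⁻ y, L y (μ' t) ∂(μ' t).toMeasure
      ≤ liminf (fun n => ∫⁻ t : I, ∫⁻ y, L y (μ n t) ∂(μ n t).toMeasure) atTop := by
  obtain ⟨hlsc, hmod⟩ := lowerSemicontinuous_cost hL
  have htot : ∀ η : Curve d, ∫⁻ t : I, ∫⁻ y, L y (η t) ∂(η t).toMeasure
      = ∫⁻ p, L p.1 (η p.2) ∂η.spaceTime := fun η =>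
    (η.lintegral_spaceTime (hlsc η).measurable).symm
  simp_rw [htot]
  -- The measure argument of `L` is frozen at the limit curve, which gives one fixed lower
  -- semicontinuous integrand. The modulus of `L` pays for this with `ε`.
  refine ENNReal.le_of_forall_pos_le_add fun ε hε _ => ?_
  obtain ⟨δ, hδ, hδ'⟩ := hmod ε hε
  have h1 := lintegral_le_liminf_of_lowerSemicontinuous (Curve.tendsto_spaceTimeProb h) (hlsc μ')
  refine h1.trans ?_
  rw [← liminf_add_const _ _ _ (by isBoundedDefault) (by isBoundedDefault)]
  refine liminf_le_liminf ?_
  filter_upwards [Curve.eventually_forall_dist_lt h hδ] with n hn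
  calc ∫⁻ p, L p.1 (μ' p.2) ∂(μ n).spaceTime
      ≤ ∫⁻ p, (L p.1 (μ n p.2) + ε) ∂(μ n).spaceTime := by
        refine lintegral_mono fun p => ?_
        simpa using hδ' p.1 _ _ (hn p.2)
    _ = _ := by
        rw [lintegral_add_right _ measurable_const]
        simp

/-! ### Stability of the continuity equation -/

theorem hasGradientAt_slice {φ : E d × ℝ → ℝ} (hφ : ContDiff ℝ ∞ φ) (y : E d) (t : ℝ) :
    HasGradientAt (fun z : E d => φ (z, t)) ((InnerProductSpace.toDual ℝ (E d)).symm
      ((fderiv ℝ φ (y, t)).comp (ContinuousLinearMap.inl ℝ (E d) ℝ))) y := by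
  have h1 : HasFDerivAt φ (fderiv ℝ φ (y, t)) (y, t) :=
    (hφ.differentiable (by simp) _).hasFDerivAt
  exact (h1.comp y (hasFDerivAt_prodMk_left y t)).hasGradientAt

theorem hasDerivAt_slice {φ : E d × ℝ → ℝ} (hφ : ContDiff ℝ ∞ φ) (y : E d) (t : ℝ) :
    HasDerivAt (fun s : ℝ => φ (y, s)) (fderiv ℝ φ (y, t) (0, 1)) t := by
  have h1 : HasFDerivAt φ (fderiv ℝ φ (y, t)) (y, t) :=
    (hφ.differentiable (by simp) _).hasFDerivAt
  have h2 : HasDerivAt (fun s : ℝ => (y, s)) ((0 : E d), (1 : ℝ)) t :=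
    (hasDerivAt_const t y).prodMk (hasDerivAt_id t)
  exact h1.comp_hasDerivAt t h2

/-- The partial derivatives of a test function on `ℝ^d × [0,1]` are continuous with compact
support. -/
theorem exists_partials {φ : E d × ℝ → ℝ} (hφ : ContDiff ℝ ∞ φ) (hφc : HasCompactSupport φ) :
    Continuous (fun p : E d × I => deriv (fun s : ℝ => φ (p.1, s)) (p.2 : ℝ)) ∧
    HasCompactSupport (fun p : E d × I => deriv (fun s : ℝ => φ (p.1, s)) (p.2 : ℝ)) ∧
    Continuous (fun p : E d × I => gradient (fun z : E d => φ (z, (p.2 : ℝ))) p.1) ∧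
    HasCompactSupport (fun p : E d × I => gradient (fun z : E d => φ (z, (p.2 : ℝ))) p.1) := by
  have hc : Continuous (fderiv ℝ φ) := hφ.continuous_fderiv (by simp)
  let j : E d × I → E d × ℝ := Prod.map id Subtype.val
  have hj : IsClosedEmbedding j :=
    IsClosedEmbedding.id.prodMap (isClosed_Icc.isClosedEmbedding_subtypeVal)
  have hcs : HasCompactSupport (fderiv ℝ φ ∘ j) := (hφc.fderiv ℝ).comp_isClosedEmbedding hj
  have hcc : Continuous (fderiv ℝ φ ∘ j) := hc.comp hj.continuous
  have e1 : (fun p : E d × I => deriv (fun s : ℝ => φ (p.1, s)) (p.2 : ℝ))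
      = fun p => (fderiv ℝ φ ∘ j) p (0, 1) := by
    ext p
    exact (hasDerivAt_slice hφ p.1 p.2).deriv
  have e2 : (fun p : E d × I => gradient (fun z : E d => φ (z, (p.2 : ℝ))) p.1)
      = fun p => (InnerProductSpace.toDual ℝ (E d)).symm
        (((fderiv ℝ φ ∘ j) p).comp (ContinuousLinearMap.inl ℝ (E d) ℝ)) := by
    ext1 p
    exact (hasGradientAt_slice hφ p.1 p.2).gradient
  rw [e1, e2]
  refine ⟨hcc.clm_apply continuous_const, ?_, ?_, ?_⟩
  · exact hcs.comp_left (g := fun A : E d × ℝ →L[ℝ] ℝ => A (0, 1)) (by simp)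
  · exact (LinearIsometryEquiv.continuous _).comp (hcc.clm_comp continuous_const)
  · exact hcs.comp_left (g := fun A : E d × ℝ →L[ℝ] ℝ => (InnerProductSpace.toDual ℝ (E d)).symm
      (A.comp (ContinuousLinearMap.inl ℝ (E d) ℝ))) (by simp)

namespace Problem

variable {P : Problem d}

/-- The continuity equation passes to the limit. -/
theorem ContinuityEquation.of_tendsto (hF : IsAdmissibleField P.F) {μ : ℕ → Curve d} {μ' : Curve d}
    (h : Tendsto (fun n => (μ n).supDist μ') atTop (𝓝 0)) {ν : ℕ → Momentum P.U}
    {ν' : Momentum P.U}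
    (hν : ∀ f : E d × I → E d, Continuous f → (∃ B, ∀ x, ‖f x‖ ≤ B) →
      Tendsto (fun n => Momentum.pair f (ν n)) atTop (𝓝 (Momentum.pair f ν')))
    (hCE : ∀ n, P.ContinuityEquation (μ n) (ν n)) : P.ContinuityEquation μ' ν' := by
  intro φ hφ hφc hφs
  obtain ⟨hDc, hDs, hGc, hGs⟩ := exists_partials hφ hφc
  set D := fun p : E d × I => deriv (fun s : ℝ => φ (p.1, s)) (p.2 : ℝ) with hD
  set G := fun p : E d × I => gradient (fun z : E d => φ (z, (p.2 : ℝ))) p.1 with hG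
  obtain ⟨B, hB⟩ := hGs.exists_bound_of_continuous hGc
  have hB0 : 0 ≤ B := (norm_nonneg _).trans (hB (0, 0))
  have hcont : ∀ η : Curve d, Continuous fun p : E d × I => D p + inner ℝ (G p) (P.F p.1 (η p.2)) :=
    fun η => hDc.add (hGc.inner (continuous_field hF η))
  have hsupp : ∀ η : Curve d, HasCompactSupport fun p : E d × I =>
      D p + inner ℝ (G p) (P.F p.1 (η p.2)) := by
    intro η
    refine hDs.add (HasCompactSupport.intro hGs.isCompact fun p hp => ?_)
    rw [image_eq_zero_of_notMem_tsupport hp, inner_zero_left]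
  have hint : ∀ η ρ : Curve d, Integrable (fun p : E d × I =>
      D p + inner ℝ (G p) (P.F p.1 (η p.2))) ρ.spaceTime := fun η ρ =>
    (hcont η).integrable_of_hasCompactSupport (hsupp η)
  have hval : ∀ η : Curve d, (∫ t : I, ∫ y, (deriv (fun s : ℝ => φ (y, s)) (t : ℝ)
        + inner ℝ (gradient (fun z : E d => φ (z, (t : ℝ))) y) (P.F y (η t))) ∂(η t).toMeasure)
      = ∫ p, (D p + inner ℝ (G p) (P.F p.1 (η p.2))) ∂η.spaceTime := fun η =>
    (η.integral_spaceTime (hint η η)).symm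
  have hlim : Tendsto (fun n => ∫ p, (D p + inner ℝ (G p) (P.F p.1 (μ' p.2))) ∂(μ n).spaceTime)
      atTop (𝓝 (∫ p, (D p + inner ℝ (G p) (P.F p.1 (μ' p.2))) ∂μ'.spaceTime)) := by
    obtain ⟨C, hC⟩ := (hsupp μ').exists_bound_of_continuous (hcont μ')
    exact ProbabilityMeasure.tendsto_iff_forall_integral_tendsto.1 (Curve.tendsto_spaceTimeProb h)
      (BoundedContinuousFunction.ofNormedAddCommGroup _ (hcont μ') C hC)
  -- The field is replaced by its value along the limit curve. The error is bounded by the gradient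
  -- bound times the modulus of the field, uniformly in space-time.
  have hdiff : Tendsto (fun n => (∫ p, (D p + inner ℝ (G p) (P.F p.1 (μ n p.2))) ∂(μ n).spaceTime)
      - ∫ p, (D p + inner ℝ (G p) (P.F p.1 (μ' p.2))) ∂(μ n).spaceTime) atTop (𝓝 0) := by
    rw [Metric.tendsto_nhds]
    intro ε hε
    obtain ⟨δ, hδ, hδ'⟩ := hF.1 (ε / (2 * (B + 1))) (by positivity)
    filter_upwards [Curve.eventually_forall_dist_lt h hδ] with n hn
    rw [dist_zero_right, ← integral_sub (hint _ _) (hint _ _)]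
    have hle : ∀ p : E d × I, ‖(D p + inner ℝ (G p) (P.F p.1 (μ n p.2)))
        - (D p + inner ℝ (G p) (P.F p.1 (μ' p.2)))‖ ≤ B * (ε / (2 * (B + 1))) := by
      intro p
      rw [add_sub_add_left_eq_sub, ← inner_sub_right]
      refine (norm_inner_le_norm _ _).trans (mul_le_mul (hB p) ?_ (norm_nonneg _) hB0)
      rw [← dist_eq_norm]
      refine (hδ' _ _ _ _ (by simpa using hδ) ?_).le
      rw [← edist_eq_W1, edist_lt_ofReal]
      exact hn p.2
    refine (norm_integral_le_of_norm_le_const (ae_of_all _ hle)).trans_lt ?_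
    have : B * (ε / (2 * (B + 1))) ≤ ε / 2 := by
      rw [mul_div_assoc', div_le_div_iff₀ (by positivity) two_pos]
      nlinarith
    simp only [probReal_univ, mul_one]
    linarith
  have hsum := (hdiff.add hlim).add (hν G hGc ⟨B, hB⟩)
  simp only [sub_add_cancel, zero_add] at hsum
  rw [hval]
  refine tendsto_nhds_unique hsum (tendsto_const_nhds.congr fun n => ?_)
  rw [← hval]
  exact (hCE n φ hφ hφc hφs).symm

/-! ### The control cost -/

/-- Densities are unique almost everywhere, so all competitors in the infimum have the same cost. -/
theorem Psi_withDensityᵥ {μ : Curve d} {u : E d × I → P.U} (hu : Integrable u μ.spaceTime) :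
    P.Psi (μ.spaceTime.withDensityᵥ u) μ = ∫⁻ x, ENNReal.ofReal (P.ψ (u x)) ∂μ.spaceTime := by
  refine le_antisymm (iInf₂_le u ⟨hu, rfl⟩) (le_iInf₂ fun v hv => le_of_eq ?_)
  refine lintegral_congr_ae ?_
  filter_upwards [(hu.withDensityᵥ_eq_iff hv.1).1 hv.2] with x hx
  rw [hx]

theorem exists_control_of_Psi_ne_top {ν : Momentum P.U} {μ : Curve d} (h : P.Psi ν μ ≠ ⊤) :
    ∃ u, Integrable u μ.spaceTime ∧ ν = μ.spaceTime.withDensityᵥ u := by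
  by_contra! hne
  exact h (iInf₂_eq_top.2 fun u hu => absurd hu.2 (hne u hu.1))

end Problem

/-! ### The terminal constraint -/

theorem P1.integral_density_mul {μ : P1 d} (hμ : μ.toMeasure ≪ volume) (f : E d → ℝ) :
    ∫ y, density μ y * f y = ∫ y, f y ∂μ.toMeasure := by
  simpa only [smul_eq_mul] using! integral_rnDeriv_smul (f := f) hμ

/-- Convergence of the densities in `L²` identifies the narrow limit. -/
theorem eq_of_tendsto_of_tendsto_density {μ : ℕ → P1 d} {μ' η : P1 d}
    (hlim : Tendsto μ atTop (𝓝 μ')) (hμ : ∀ n, (μ n).toMeasure ≪ volume)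
    (hη : η.toMeasure ≪ volume)
    (h : Tendsto (fun n => ∫⁻ y, ENNReal.ofReal (|density (μ n) y - density η y| ^ 2)) atTop
      (𝓝 0)) : μ' = η := by
  have hmeas : ∀ ρ : P1 d, Measurable (density ρ) := fun ρ =>
    (Measure.measurable_rnDeriv _ _).ennreal_toReal
  have key : ∀ f : E d → ℝ, Continuous f → HasCompactSupport f →
      ∫ y, f y ∂μ'.toMeasure = ∫ y, f y ∂η.toMeasure := by
    intro f hf hfc
    obtain ⟨B, hB⟩ := hfc.exists_bound_of_continuous hf
    have h1 : Tendsto (fun n => ∫ y, f y ∂(μ n).toMeasure) atTop (𝓝 (∫ y, f y ∂μ'.toMeasure)) :=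
      ProbabilityMeasure.tendsto_iff_forall_integral_tendsto.1
        ((continuous_toProb.tendsto μ').comp hlim)
        (BoundedContinuousFunction.ofNormedAddCommGroup f hf B hB)
    have hint : ∀ ρ : P1 d, Integrable (fun y => density ρ y * f y) := fun ρ =>
      Integrable.mul_bdd (c := B) Measure.integrable_toReal_rnDeriv hf.aestronglyMeasurable
        (ae_of_all _ hB)
    have hf2 : (∫⁻ y, ‖f y‖ₑ ^ (2 : ℝ)) ^ (1 / (2 : ℝ)) ≠ ⊤ := by
      refine ENNReal.rpow_ne_top_of_nonneg (by norm_num) ?_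
      have hm : MemLp f 2 := hf.memLp_of_hasCompactSupport hfc
      have := (eLpNorm_lt_top_iff_lintegral_rpow_enorm_lt_top (by norm_num) (by norm_num)).1
        hm.eLpNorm_lt_top
      simpa using this.ne
    -- Cauchy–Schwarz against a compactly supported, hence square integrable, test function.
    have hbound : ∀ n, ‖∫ y, f y ∂(μ n).toMeasure - ∫ y, f y ∂η.toMeasure‖ₑ
        ≤ (∫⁻ y, ENNReal.ofReal (|density (μ n) y - density η y| ^ 2)) ^ (1 / (2 : ℝ))
          * (∫⁻ y, ‖f y‖ₑ ^ (2 : ℝ)) ^ (1 / (2 : ℝ)) := by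
      intro n
      rw [← P1.integral_density_mul (hμ n), ← P1.integral_density_mul hη,
        ← integral_sub (hint _) (hint _)]
      refine (enorm_integral_le_lintegral_enorm _).trans ?_
      have hHolder := ENNReal.lintegral_mul_le_Lp_mul_Lq volume Real.HolderConjugate.two_two
        (f := fun y => ‖density (μ n) y - density η y‖ₑ) (g := fun y => ‖f y‖ₑ)
        ((hmeas _).sub (hmeas _)).enorm.aemeasurable hf.measurable.enorm.aemeasurable
      have e1 : ∀ y, ‖density (μ n) y * f y - density η y * f y‖ₑ
          = ‖density (μ n) y - density η y‖ₑ * ‖f y‖ₑ := fun y => by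
        rw [← sub_mul, enorm_mul]
      have e2 : ∀ y, ‖density (μ n) y - density η y‖ₑ ^ (2 : ℝ)
          = ENNReal.ofReal (|density (μ n) y - density η y| ^ 2) := fun y => by
        rw [ENNReal.ofReal_pow (abs_nonneg _), ← Real.norm_eq_abs, ofReal_norm,
          ENNReal.rpow_two]
      simp_rw [e1]
      simp_rw [e2] at hHolder
      exact hHolder
    have h2 : Tendsto (fun n => ‖∫ y, f y ∂(μ n).toMeasure - ∫ y, f y ∂η.toMeasure‖ₑ) atTop
        (𝓝 0) := by
      have h3 := ENNReal.Tendsto.mul_const (b := (∫⁻ y, ‖f y‖ₑ ^ (2 : ℝ)) ^ (1 / (2 : ℝ)))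
        ((ENNReal.continuous_rpow_const (y := 1 / (2 : ℝ))).tendsto 0 |>.comp h) (Or.inr hf2)
      rw [ENNReal.zero_rpow_of_pos (by norm_num), zero_mul] at h3
      exact tendsto_of_tendsto_of_tendsto_of_le_of_le tendsto_const_nhds h3 (fun _ => zero_le)
        hbound
    have h4 := (h1.sub_const (∫ y, f y ∂η.toMeasure)).enorm
    have h5 := tendsto_nhds_unique h4 h2
    rwa [enorm_eq_zero, sub_eq_zero] at h5
  exact P1.ext (Measure.ext_of_integral_eq_on_compactlySupported fun f =>
    key f f.continuous f.hasCompactSupport)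

/-! ### Penalties, and limits of sequences of bounded energy -/

namespace Problem

variable {P : Problem d}

theorem softPenalty_target (h : HasL2Density P.m₁) (ε : ℝ) : P.softPenalty ε P.m₁ = 0 := by
  rw [softPenalty, if_pos h]
  simp

theorem hardPenalty_target : P.hardPenalty P.m₁ = 0 := if_pos rfl

theorem eq_target_of_energy_ne_top {μ : Curve d} {ν : Momentum P.U} (h : P.energy μ ν ≠ ⊤) :
    μ 1 = P.m₁ := by
  by_contra hne
  exact h (by rw [energy, hardPenalty, if_neg hne, add_top])

theorem energy_eq {μ : Curve d} (h : μ 1 = P.m₁) (ν : Momentum P.U) : P.energy μ ν = P.G μ ν := by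
  rw [energy, h, hardPenalty_target, add_zero]

theorem softPenalty_bound {ε : ℝ} (hε : 0 < ε) {μ : P1 d} {e : ℝ≥0∞} (he : e ≠ ⊤)
    (h : P.softPenalty ε μ ≤ e) : HasL2Density μ ∧
      ∫⁻ y, ENNReal.ofReal (|density μ y - density P.m₁ y| ^ 2) ≤ ENNReal.ofReal ε * e := by
  by_cases hμ : HasL2Density μ
  · refine ⟨hμ, ?_⟩
    rw [softPenalty, if_pos hμ] at h
    calc ∫⁻ y, ENNReal.ofReal (|density μ y - density P.m₁ y| ^ 2)
        = ENNReal.ofReal ε * (ENNReal.ofReal (1 / ε)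
          * ∫⁻ y, ENNReal.ofReal (|density μ y - density P.m₁ y| ^ 2)) := by
          rw [← mul_assoc, ← ENNReal.ofReal_mul hε.le, mul_one_div_cancel hε.ne',
            ENNReal.ofReal_one, one_mul]
      _ ≤ _ := by gcongr
  · rw [softPenalty, if_neg hμ, top_le_iff] at h
    exact absurd h he

/-- Subsequential compactness and lower semicontinuity for sequences of bounded energy. -/
theorem exists_limit (hP : P.Admissible) {μ : ℕ → Curve d} {ν : ℕ → Momentum P.U}
    (hmem : ∀ n, (μ n, ν n) ∈ P.constraintSet) {e : ℝ≥0∞} (he : e ≠ ⊤)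
    (hG : ∀ n, P.G (μ n) (ν n) ≤ e) :
    ∃ (μ' : Curve d) (ν' : Momentum P.U) (k : ℕ → ℕ), StrictMono k ∧
      Tendsto (fun n => (μ (k n)).supDist μ') atTop (𝓝 0) ∧
      Momentum.NarrowTendsto (fun n => ν (k n)) ν' ∧ (μ', ν') ∈ P.constraintSet ∧
      P.G μ' ν' ≤ liminf (fun n => P.G (μ (k n)) (ν (k n))) atTop := by
  have hF := hP.field
  have hψ := hP.control
  have hPsi : ∀ n, P.Psi (ν n) (μ n) ≤ e := fun n => le_self_add.trans (hG n)
  choose u hu hν using fun n => exists_control_of_Psi_ne_top (ne_top_of_le_ne_top he (hPsi n))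
  have hcost : ∀ n, ∫⁻ x, ENNReal.ofReal (P.ψ (u n x)) ∂(μ n).spaceTime ≤ e := fun n => by
    rw [← Psi_withDensityᵥ (hu n), ← hν n]
    exact hPsi n
  have hi : ∀ n, Integrable (fun x => P.ψ (u n x)) (μ n).spaceTime := fun n =>
    hψ.integrable_of_lintegral (hu n).aestronglyMeasurable (ne_top_of_le_ne_top he (hcost n))
  have hc : ∀ n, ∫ x, P.ψ (u n x) ∂(μ n).spaceTime ≤ e.toReal := fun n => by
    rw [integral_eq_lintegral_of_nonneg_ae (ae_of_all _ fun x => hψ.nonneg _)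
      (hi n).aestronglyMeasurable]
    exact ENNReal.toReal_mono he (hcost n)
  obtain ⟨k₁, μ', hk₁, hμ'⟩ := exists_tendsto_supDist hF hψ (c := e.toReal) ENNReal.toReal_nonneg
    (μ := μ) (u := u) fun n => ⟨hu n, hν n ▸ (hmem n).2.1, hi n, hc n, (hmem n).2.2⟩
  obtain ⟨k₂, u', hk₂, hu', hlsc, hpair⟩ := exists_limit_control hψ
    (Curve.tendsto_spaceTimeProb hμ') (u := fun n => u (k₁ n))
    (fun n => (hu (k₁ n)).aestronglyMeasurable.aemeasurable) (fun n => hi (k₁ n))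
    (fun n => hc (k₁ n))
  change Integrable u' μ'.spaceTime at hu'
  have hμk := hμ'.comp hk₂.tendsto_atTop
  -- Convergence against all `ℝ^d`-valued fields, not only `U`-valued ones: gradients of test
  -- functions in the continuity equation need not lie in `U`.
  have hpair' : ∀ f : E d × I → E d, Continuous f → (∃ B, ∀ x, ‖f x‖ ≤ B) →
      Tendsto (fun n => Momentum.pair f (ν (k₁ (k₂ n)))) atTop
        (𝓝 (Momentum.pair f (μ'.spaceTime.withDensityᵥ u'))) := by
    rintro f hf ⟨B, hB⟩
    rw [Momentum.pair_withDensityᵥ hu' hf.measurable hB]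
    refine (hpair f hf ⟨B, hB⟩).congr fun n => ?_
    rw [hν, Momentum.pair_withDensityᵥ (hu _) hf.measurable hB]
    rfl
  have hCE : P.ContinuityEquation μ' (μ'.spaceTime.withDensityᵥ u') :=
    ContinuityEquation.of_tendsto hF hμk hpair' fun n => (hmem _).2.1
  refine ⟨μ', μ'.spaceTime.withDensityᵥ u', k₁ ∘ k₂, hk₁.comp hk₂, hμk, fun f => ?_,
    ⟨ContinuityEquation.isAC hF hu' hCE, hCE, ?_⟩, ?_⟩
  · exact hpair' _ (continuous_subtype_val.comp f.continuous) ⟨‖f‖, fun x => f.norm_coe_le_norm x⟩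
  · exact tendsto_nhds_unique (Curve.tendsto_apply hμk 0)
      (tendsto_const_nhds.congr fun n => ((hmem (k₁ (k₂ n))).2.2).symm)
  · refine le_trans (add_le_add ?_ (lintegral_cost_le_liminf hP.cost hμk))
      (liminf_add_liminf_le _ _)
    rw [Psi_withDensityᵥ hu']
    refine hlsc.trans_eq (congrArg (fun a => liminf a atTop) (funext fun n => ?_))
    simp only [Function.comp_apply]
    rw [hν, Psi_withDensityᵥ (hu _)]
    rfl

end Problem

end MeanFieldControl

end

/-! ### Convergence of soft minimizers -/

theorem proposition1p1 {d : ℕ} (P : MeanFieldControl.Problem d)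
    (hP : P.Admissible) (hfeas : P.Feasible)
    (ε : ℕ → ℝ) (hε : ∀ n, 0 < ε n) (hε0 : Tendsto ε atTop (𝓝 0))
    (μ : ℕ → MeanFieldControl.Curve d) (ν : ℕ → MeanFieldControl.Momentum P.U)
    (hsol : ∀ n, P.IsSoftSolution (ε n) (μ n, ν n)) :
    ∃ (μ' : MeanFieldControl.Curve d) (ν' : MeanFieldControl.Momentum P.U) (k : ℕ → ℕ),
      StrictMono k ∧
      Tendsto (fun n => (μ (k n)).supDist μ') atTop (𝓝 0) ∧
      MeanFieldControl.Momentum.NarrowTendsto (fun n => ν (k n)) ν' ∧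
      P.IsSolution (μ', ν') ∧ μ' 1 = P.m₁ := by
  -- A competitor ending at the target pays no soft penalty, so the bound does not depend on `ε n`.
  have hcomp : ∀ n, ∀ q ∈ P.constraintSet, q.1 1 = P.m₁ →
      P.softEnergy (ε n) (μ n) (ν n) ≤ P.G q.1 q.2 := by
    intro n q hq h1
    have h2 : P.softEnergy (ε n) (μ n) (ν n) ≤ P.softEnergy (ε n) q.1 q.2 := (hsol n).2 hq
    rwa [MeanFieldControl.Problem.softEnergy.eq_1 P (ε n) q.1, h1, MeanFieldControl.Problem.softPenalty_target hP.target,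
      add_zero] at h2
  obtain ⟨q₀, hq₀, hq₀e⟩ := hfeas
  have hq₀1 := MeanFieldControl.Problem.eq_target_of_energy_ne_top hq₀e.ne
  rw [MeanFieldControl.Problem.energy_eq hq₀1] at hq₀e
  have he := hq₀e.ne
  obtain ⟨μ', ν', k, hk, hμ', hν', hmem, hG⟩ := MeanFieldControl.Problem.exists_limit hP (fun n => (hsol n).1) he
    fun n => le_self_add.trans (hcomp n q₀ hq₀ hq₀1)
  -- The penalty alone is also below the energy of `q₀`. Multiplied by `ε n`, this sends the `L²`
  -- distance to the target to zero.
  have hsoft : ∀ n, _ := fun n => MeanFieldControl.Problem.softPenalty_bound (hε n) he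
    (le_add_self.trans (hcomp n q₀ hq₀ hq₀1))
  have h1 : μ' 1 = P.m₁ := by
    refine MeanFieldControl.eq_of_tendsto_of_tendsto_density (MeanFieldControl.Curve.tendsto_apply hμ' 1)
      (fun n => (hsoft (k n)).1.1) hP.target.1 ?_
    have hlim := ENNReal.Tendsto.mul_const (b := P.G q₀.1 q₀.2)
      (ENNReal.tendsto_ofReal (hε0.comp hk.tendsto_atTop)) (Or.inr he)
    rw [ENNReal.ofReal_zero, zero_mul] at hlim
    exact tendsto_of_tendsto_of_tendsto_of_le_of_le tendsto_const_nhds hlim (fun _ => zero_le)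
      fun n => (hsoft (k n)).2
  refine ⟨μ', ν', k, hk, hμ', hν', ⟨hmem, fun q hq => ?_⟩, h1⟩
  change P.energy μ' ν' ≤ P.energy q.1 q.2
  by_cases hqe : P.energy q.1 q.2 = ⊤
  · rw [hqe]
    exact le_top
  · have hq1 := MeanFieldControl.Problem.eq_target_of_energy_ne_top hqe
    rw [MeanFieldControl.Problem.energy_eq h1, MeanFieldControl.Problem.energy_eq hq1]
    refine hG.trans ?_
    -- The nonnegative penalty is dropped, and each remaining term is at most the constant `P.G q.1
    -- q.2`.
    refine (liminf_le_liminf (Eventually.of_forall fun n =>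
      le_self_add.trans (hcomp (k n) q hq hq1))).trans_eq (liminf_const _)
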